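/- **Theorem (based on Spencer).** Let $G=(V,E)$ be a directed graph without parallel edges, with $|V|=n\ge 1$ vertices and non-negative real edge weights $w$, let $s\in V$, and let $t\in[1,n]$ be an integer. The distances $\mathrm{dist}_G(s,v)$ of all vertices $v\in V$ from $s$ can be computed in parallel within $\widetilde O(n^2t)$ work and $\widetilde O(n/t)$ depth, where $\widetilde O$ hides factors polylogarithmic in $n$, and $\mathrm{dist}_G(s,v)$ is the minimum weight of an $s\to v$ path ($\infty$ if there is none). In detail: the model is a synchronous parallel random access machine in which reals may only be copied, added and compared, and integers are words of $O(\log n)$ bits with the usual arithmetic operations. Work is the total number of operations performed, and depth is the number of operations on a longest chain of sequentially dependent ones. There are one program, which does not depend on $n$, $t$, $G$, $w$, $s$, and constants $C,c,k$ such that for all integers $1\le t\le n$, every such weighted digraph $G$ on the vertex set $\{0,\dots,n-1\}$, and every $s$, the program, given $n$, $|E|$, $s$, $t$ and the list of weighted edges of $G$ in any order, stores only integers below $(n+1)^c$ and halts with all distances $\mathrm{dist}_G(s,v)$ in memory (unreachable vertices being marked as such) after at most $C\,n^2t\,(1+\log n)^k$ work and at most $C\,\frac nt\,(1+\log n)^k$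 depth. -/

import Mathlib

/-! ## Weighted digraphs and distances -/

namespace WDigraph

/-- `p` is the sequence of edges of a path `u → v` of `G`. Vertices and edges may repeat, and the
empty sequence is a path from a vertex to itself. -/
def IsPath {V : Type*} (G : Digraph V) : V → V → List (V × V) → Prop
  | u, v, [] => u = v
  | u, v, e :: p => e.1 = u ∧ G.Adj e.1 e.2 ∧ IsPath G e.2 v p

/-- The weight of a sequence of edges: the sum of the weights of its members. -/
def pathWeight {V : Type*} (w : V → V → ℝ) (p : List (V × V)) : ℝ :=
  (p.map fun e => w e.1 e.2).sum

/-- The distance from `u` to `v` in the digraph `G` with edge weights `w`;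
it is `⊤` if there is no path from `u` to `v`. -/
noncomputable def dist {V : Type*} (G : Digraph V) (w : V → V → ℝ) (u v : V) : EReal :=
  ⨅ p : {p : List (V × V) // IsPath G u v p}, ((pathWeight w p.1 : ℝ) : EReal)

end WDigraph

/-! ## A parallel random access machine with integer words and real numbers

The machine is a synchronous PRAM presented in the work-depth style: one uniform program made of
sequential control and of parallel steps `for all i < N in parallel do ...`. Integers are words of
`O(log n)` bits with the usual arithmetic, and real numbers can only be copied, added and compared. -/

namespace PRAM

/-- The shared memory: named arrays of words and named arrays of real numbers. The constant
number of arrays that a program uses stands for that many regions of one address space. -/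
structure Mem where
  int : ℕ → ℕ → ℕ
  real : ℕ → ℕ → ℝ

mutual

/-- Word expressions. `idx` is the number of the executing processor, `read a e` is the
cell `e` of the array `a`, and `rle x y` is `1` if `x ≤ y` and `0` otherwise, for reals `x`, `y`. -/
inductive IExp : Type
  | lit : ℕ → IExp
  | idx : IExp
  | read : ℕ → IExp → IExp
  | add : IExp → IExp → IExp
  | sub : IExp → IExp → IExp
  | mul : IExp → IExp → IExp
  | div : IExp → IExp → IExp
  | mod : IExp → IExp → IExp
  | le : IExp → IExp → IExp
  | rle : RExp → RExp → IExp
  | ite : IExp → IExp → IExp → IExp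

/-- Real expressions: zero, cells of real arrays, sums, and a choice controlled by a word. -/
inductive RExp : Type
  | zero : RExp
  | read : ℕ → IExp → RExp
  | add : RExp → RExp → RExp
  | ite : IExp → RExp → RExp → RExp

end

mutual

/-- The value of a word expression on processor `i` (subtraction is truncated at `0`). -/
noncomputable def IExp.eval (σ : Mem) (i : ℕ) : IExp → ℕ
  | .lit k => k
  | .idx => i
  | .read a e => σ.int a (e.eval σ i)
  | .add e f => e.eval σ i + f.eval σ i
  | .sub e f => e.eval σ i - f.eval σ i
  | .mul e f => e.eval σ i * f.eval σ i
  | .div e f => e.eval σ i / f.eval σ i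
  | .mod e f => e.eval σ i % f.eval σ i
  | .le e f => if e.eval σ i ≤ f.eval σ i then 1 else 0
  | .rle x y => if x.eval σ i ≤ y.eval σ i then 1 else 0
  | .ite b e f => if b.eval σ i = 0 then f.eval σ i else e.eval σ i

/-- The value of a real expression on processor `i`. -/
noncomputable def RExp.eval (σ : Mem) (i : ℕ) : RExp → ℝ
  | .zero => 0
  | .read a e => σ.real a (e.eval σ i)
  | .add x y => x.eval σ i + y.eval σ i
  | .ite b x y => if b.eval σ i = 0 then y.eval σ i else x.eval σ i

end

mutual

/-- The number of operations in a word expression. -/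
def IExp.cost : IExp → ℕ
  | .lit _ => 1
  | .idx => 1
  | .read _ e => e.cost + 1
  | .add e f => e.cost + f.cost + 1
  | .sub e f => e.cost + f.cost + 1
  | .mul e f => e.cost + f.cost + 1
  | .div e f => e.cost + f.cost + 1
  | .mod e f => e.cost + f.cost + 1
  | .le e f => e.cost + f.cost + 1
  | .rle x y => x.cost + y.cost + 1
  | .ite b e f => b.cost + e.cost + f.cost + 1

/-- The number of operations in a real expression. -/
def RExp.cost : RExp → ℕ
  | .zero => 1
  | .read _ e => e.cost + 1
  | .add x y => x.cost + y.cost + 1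
  | .ite b x y => b.cost + x.cost + y.cost + 1

end

/-- Programs. `parI N g a p e` is the parallel step "for all `i < N` in parallel: if `g ≠ 0` then
write the word `e` into cell `p` of the word array `a`", and `parR` is the same for real arrays.
The tests of `ite` and `loop` and the bounds `N` are evaluated by processor `0`. -/
inductive Prog : Type
  | skip : Prog
  | parI (N g : IExp) (a : ℕ) (p e : IExp) : Prog
  | parR (N g : IExp) (a : ℕ) (p : IExp) (e : RExp) : Prog
  | seq : Prog → Prog → Prog
  | ite : IExp → Prog → Prog → Prog
  | loop : IExp → Prog → Prog

open Classical in
/-- An array after the processors `i < N` with `act i` have simultaneously written `val i` into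
cell `addr i`. If several processors write into one cell, the one with the least number succeeds. -/
noncomputable def scatter {α : Type} (N : ℕ) (act : ℕ → Prop) (addr : ℕ → ℕ) (val : ℕ → α)
    (old : ℕ → α) : ℕ → α := fun j =>
  if h : ∃ i, i < N ∧ act i ∧ addr i = j then val (Nat.find h) else old j

/-- The memory after a parallel write into the word array `a`. In a parallel step all
processors read before any of them writes. -/
noncomputable def Mem.writeI (σ : Mem) (N g : IExp) (a : ℕ) (p e : IExp) : Mem where
  int := Function.update σ.int a (scatter (N.eval σ 0) (fun i => g.eval σ i ≠ 0)
    (fun i => p.eval σ i) (fun i => e.eval σ i) (σ.int a))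
  real := σ.real

/-- The memory after a parallel write into the real array `a`. -/
noncomputable def Mem.writeR (σ : Mem) (N g : IExp) (a : ℕ) (p : IExp) (e : RExp) : Mem where
  int := σ.int
  real := Function.update σ.real a (scatter (N.eval σ 0) (fun i => g.eval σ i ≠ 0)
    (fun i => p.eval σ i) (fun i => e.eval σ i) (σ.real a))

/-- `Exec B P σ σ' W D`: started in memory `σ`, the program `P` halts in memory `σ'` after work `W`
(the total number of operations of all processors) and depth `D` (the number of operations on a
longest chain of dependent ones: the operations of distinct processors in one parallel step
are concurrent). All addresses and words that are written have to be below the word bound `B`,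
otherwise there is no execution. -/
inductive Exec (B : ℕ) : Prog → Mem → Mem → ℕ → ℕ → Prop
  | skip (σ : Mem) : Exec B .skip σ σ 1 1
  | parI (σ : Mem) (N g : IExp) (a : ℕ) (p e : IExp)
      (h : ∀ i < N.eval σ 0, g.eval σ i ≠ 0 → p.eval σ i < B ∧ e.eval σ i < B) :
      Exec B (.parI N g a p e) σ (σ.writeI N g a p e)
        (N.cost + N.eval σ 0 * (g.cost + p.cost + e.cost + 1))
        (N.cost + (g.cost + p.cost + e.cost + 1))
  | parR (σ : Mem) (N g : IExp) (a : ℕ) (p : IExp) (e : RExp)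
      (h : ∀ i < N.eval σ 0, g.eval σ i ≠ 0 → p.eval σ i < B) :
      Exec B (.parR N g a p e) σ (σ.writeR N g a p e)
        (N.cost + N.eval σ 0 * (g.cost + p.cost + e.cost + 1))
        (N.cost + (g.cost + p.cost + e.cost + 1))
  | seq {P Q : Prog} {σ σ₁ σ₂ : Mem} {W₁ W₂ D₁ D₂ : ℕ} :
      Exec B P σ σ₁ W₁ D₁ → Exec B Q σ₁ σ₂ W₂ D₂ →
      Exec B (.seq P Q) σ σ₂ (W₁ + W₂) (D₁ + D₂)
  | iteTrue {b : IExp} {P Q : Prog} {σ σ₁ : Mem} {W D : ℕ} :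
      b.eval σ 0 ≠ 0 → Exec B P σ σ₁ W D →
      Exec B (.ite b P Q) σ σ₁ (b.cost + W) (b.cost + D)
  | iteFalse {b : IExp} {P Q : Prog} {σ σ₁ : Mem} {W D : ℕ} :
      b.eval σ 0 = 0 → Exec B Q σ σ₁ W D →
      Exec B (.ite b P Q) σ σ₁ (b.cost + W) (b.cost + D)
  | loopDone {b : IExp} {P : Prog} {σ : Mem} :
      b.eval σ 0 = 0 → Exec B (.loop b P) σ σ b.cost b.cost
  | loopStep {b : IExp} {P : Prog} {σ σ₁ σ₂ : Mem} {W₁ W₂ D₁ D₂ : ℕ} :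
      b.eval σ 0 ≠ 0 → Exec B P σ σ₁ W₁ D₁ → Exec B (.loop b P) σ₁ σ₂ W₂ D₂ →
      Exec B (.loop b P) σ σ₂ (b.cost + W₁ + W₂) (b.cost + D₁ + D₂)

/-- The initial memory for a weighted digraph on `n` vertices given by the list `L` of its edges
(in any order), a source `s` and a parameter `t`. Word array `0` starts with `n`, the number of
edges, `s` and `t`; word arrays `1` and `2` hold the tails and heads of the edges, and
real array `0` holds their weights. Everything else is `0`. -/
noncomputable def input {n : ℕ} (L : List (Fin n × Fin n)) (w : Fin n → Fin n → ℝ) (s : Fin n)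
    (t : ℕ) : Mem where
  int
    | 0, j => [n, L.length, (s : ℕ), t].getD j 0
    | 1, j => (L.map fun e => (e.1 : ℕ)).getD j 0
    | 2, j => (L.map fun e => (e.2 : ℕ)).getD j 0
    | _, _ => 0
  real
    | 0, j => (L.map fun e => w e.1 e.2).getD j 0
    | _, _ => 0

/-- The number that the memory holds as the answer for vertex `v`: cell `v` of the real
array `1` if cell `v` of the word array `3` is nonzero, and `⊤` (unreachable) if that cell is `0`. -/
noncomputable def output (σ : Mem) (v : ℕ) : EReal :=
  if σ.int 3 v = 0 then ⊤ else ((σ.real 1 v : ℝ) : EReal)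

end PRAM

namespace PRAM

/-! ## Program notation and a calculus for bounded runs -/

-- The vertex set is padded to `N = 2 ^ ν` with `n ≤ N ≤ 2 * n`, and `t` is replaced by `K = 2 ^ κ`
-- with `K ≤ t ≤ 2 * K`. The algorithm is Dijkstra's, settling `K` vertices at a time. Let the
-- settled vertices, among them `s`, have exact distances `d`. The ball of `v` lists the `K`
-- unsettled vertices nearest to `v` by walks that are unsettled after `v`. A walk from `s` to an
-- unsettled `x` has a last settled vertex `u`, and its tail is measured by the ball of `u`: either
-- `x` is in the ball at no greater cost, or the ball is full of vertices that are no farther. Hence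
-- the `K` best offers `d u +` (entry of the ball of `u`), with distinct heads, are correct
-- distances of new vertices (`relax_exact`). A phase settles `K` new vertices or exhausts the
-- reachable ones, so `N / K` phases suffice (`phases_run`).
--
-- Balls come from repeated squaring: the `K` best entries of the join of the lists for `h` hops are
-- lists for `2 * h` hops (`BallInv.square`). Loops of weight zero are added at all vertices. They
-- allow walks to be padded to an exact number of hops, and they make it harmless to truncate
-- intermediate lists. After `ν` squarings there are `N` hops, which is enough because a walk can be
-- made repetition-free and then padded. The lists for one hop are the roots of tournament trees
-- over the out-edges (`ballInv_root`). When `K` vertices are settled, only the ancestors of their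
-- leaves are recomputed (`update_run`).
--
-- Ties are broken arbitrarily, so `IsTopK` does not determine a list. What is propagated is
-- domination, `Dom`: an entry is present at no greater cost, or the list is full of entries of no
-- greater cost. `IsTopK.full` and `IsTopK.dom_shift` carry it through selections.
--
-- The only nontrivial parallel primitive is the selection of the best entries with distinct words:
-- sort, keep the first cell of each word, sort again (`isTopK_of_sorted`). Sorting is by merging
-- with ranks found by binary search, of polylogarithmic depth. Building the trees and running the
-- phases uses at most `2 * N * K ^ 2` processors at a time, so up to logarithms their depth is `N /
-- K` and their work at most `N * K ^ 2 * (N / K) = N ^ 2 * K`.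

instance : Add IExp := ⟨.add⟩
instance : Sub IExp := ⟨.sub⟩
instance : Mul IExp := ⟨.mul⟩
instance : Div IExp := ⟨.div⟩
instance : Mod IExp := ⟨.mod⟩
instance (k : ℕ) : OfNat IExp k := ⟨.lit k⟩
instance : Add RExp := ⟨.add⟩

section Eval
variable (σ : Mem) (i : ℕ)

@[simp] theorem eval_ofNat (k : ℕ) : (OfNat.ofNat k : IExp).eval σ i = k := rfl
@[simp] theorem eval_zero : (0 : IExp).eval σ i = 0 := rfl
@[simp] theorem eval_one : (1 : IExp).eval σ i = 1 := rfl
@[simp] theorem eval_two : (2 : IExp).eval σ i = 2 := rfl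
@[simp] theorem eval_idx : (IExp.idx).eval σ i = i := rfl
@[simp] theorem eval_read (a : ℕ) (e : IExp) : (IExp.read a e).eval σ i = σ.int a (e.eval σ i) := rfl
@[simp] theorem eval_add (e f : IExp) : (e + f).eval σ i = e.eval σ i + f.eval σ i := rfl
@[simp] theorem eval_sub (e f : IExp) : (e - f).eval σ i = e.eval σ i - f.eval σ i := rfl
@[simp] theorem eval_mul (e f : IExp) : (e * f).eval σ i = e.eval σ i * f.eval σ i := rfl
@[simp] theorem eval_div (e f : IExp) : (e / f).eval σ i = e.eval σ i / f.eval σ i := rfl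
@[simp] theorem eval_mod (e f : IExp) : (e % f).eval σ i = e.eval σ i % f.eval σ i := rfl
@[simp] theorem eval_le (e f : IExp) :
    (IExp.le e f).eval σ i = if e.eval σ i ≤ f.eval σ i then 1 else 0 := rfl
@[simp] theorem eval_rle (x y : RExp) :
    (IExp.rle x y).eval σ i = if x.eval σ i ≤ y.eval σ i then 1 else 0 := rfl
@[simp] theorem eval_ite (b e f : IExp) :
    (IExp.ite b e f).eval σ i = if b.eval σ i = 0 then f.eval σ i else e.eval σ i := rfl
@[simp] theorem evalR_zero : (RExp.zero).eval σ i = 0 := rfl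
@[simp] theorem evalR_read (a : ℕ) (e : IExp) :
    (RExp.read a e).eval σ i = σ.real a (e.eval σ i) := rfl
@[simp] theorem evalR_add (x y : RExp) : (x + y).eval σ i = x.eval σ i + y.eval σ i := rfl
@[simp] theorem evalR_ite (b : IExp) (x y : RExp) :
    (RExp.ite b x y).eval σ i = if b.eval σ i = 0 then y.eval σ i else x.eval σ i := rfl

end Eval

/-- The register `a`: cell `0` of the word array `a`. -/
def reg (a : ℕ) : IExp := .read a 0

@[simp] theorem eval_reg (σ : Mem) (i a : ℕ) : (reg a).eval σ i = σ.int a 0 := rfl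

infixr:60 " ;; " => Prog.seq

/-- The memory with the word array `a` replaced by `f`. -/
def Mem.setI (σ : Mem) (a : ℕ) (f : ℕ → ℕ) : Mem := ⟨Function.update σ.int a f, σ.real⟩

/-- The memory with the real array `a` replaced by `f`. -/
def Mem.setR (σ : Mem) (a : ℕ) (f : ℕ → ℝ) : Mem := ⟨σ.int, Function.update σ.real a f⟩

@[simp] theorem setI_int (σ : Mem) (a b : ℕ) (f : ℕ → ℕ) :
    (σ.setI a f).int b = if b = a then f else σ.int b := by
  simp [Mem.setI, Function.update_apply]
@[simp] theorem setI_real (σ : Mem) (a : ℕ) (f : ℕ → ℕ) : (σ.setI a f).real = σ.real := rfl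
@[simp] theorem setR_real (σ : Mem) (a b : ℕ) (f : ℕ → ℝ) :
    (σ.setR a f).real b = if b = a then f else σ.real b := by
  simp [Mem.setR, Function.update_apply]
@[simp] theorem setR_int (σ : Mem) (a : ℕ) (f : ℕ → ℝ) : (σ.setR a f).int = σ.int := rfl

/-! ### Simultaneous writes -/

section Scatter
variable {α : Type} {N : ℕ} {act : ℕ → Prop} {addr : ℕ → ℕ} {val : ℕ → α} {old : ℕ → α}

theorem scatter_cases (j : ℕ) :
    (∃ i < N, act i ∧ addr i = j ∧ scatter N act addr val old j = val i) ∨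
    ((∀ i < N, act i → addr i ≠ j) ∧ scatter N act addr val old j = old j) := by
  classical
  by_cases h : ∃ i, i < N ∧ act i ∧ addr i = j
  · left
    obtain ⟨h1, h2, h3⟩ := Nat.find_spec h
    refine ⟨Nat.find h, h1, h2, h3, ?_⟩
    simp only [scatter]
    rw [dif_pos h]
  · right
    refine ⟨fun i hi ha he => h ⟨i, hi, ha, he⟩, ?_⟩
    simp only [scatter]
    rw [dif_neg h]

theorem scatter_first {i j : ℕ} (hi : i < N) (ha : act i) (hj : addr i = j)
    (hmin : ∀ i' < i, act i' → addr i' ≠ j) : scatter N act addr val old j = val i := by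
  classical
  have h : ∃ i, i < N ∧ act i ∧ addr i = j := ⟨i, hi, ha, hj⟩
  have : Nat.find h = i := by
    rw [Nat.find_eq_iff]
    exact ⟨⟨hi, ha, hj⟩, fun m hm ⟨_, h2, h3⟩ => hmin m hm h2 h3⟩
  simp only [scatter]
  rw [dif_pos h, this]

theorem scatter_inj {i : ℕ} (hi : i < N) (ha : act i)
    (hinj : ∀ i' < N, act i' → addr i' = addr i → i' = i) :
    scatter N act addr val old (addr i) = val i := by
  refine scatter_first hi ha rfl fun i' h1 h2 h3 => ?_
  have := hinj i' (h1.trans hi) h2 h3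
  omega

theorem scatter_of_not {j : ℕ} (h : ∀ i < N, act i → addr i ≠ j) :
    scatter N act addr val old j = old j := by
  rcases scatter_cases (N := N) (act := act) (addr := addr) (val := val) (old := old) j with
    ⟨i, h1, h2, h3, _⟩ | ⟨_, h2⟩
  · exact absurd h3 (h i h1 h2)
  · exact h2

theorem scatter_all {p : α → Prop} (hv : ∀ i < N, act i → p (val i)) (ho : ∀ j, p (old j)) (j : ℕ) :
    p (scatter N act addr val old j) := by
  rcases scatter_cases (N := N) (act := act) (addr := addr) (val := val) (old := old) j with
    ⟨i, h1, h2, _, h4⟩ | ⟨_, h2⟩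
  · rw [h4]; exact hv i h1 h2
  · rw [h2]; exact ho j

theorem scatter_id (hact : ∀ i, act i) :
    scatter N act (fun i => i) val old = fun j => if j < N then val j else old j := by
  funext j
  split_ifs with h
  · exact scatter_inj (addr := fun i => i) h (hact j) fun i' _ _ h => h
  · exact scatter_of_not fun i hi _ he => h (he ▸ hi)

/-- Blocks of `K` consecutive cells are written by the first of the competing blocks of
processors. -/
theorem scatter_block {K M : ℕ} {A : ℕ → ℕ} {a k : ℕ} (hk : k < K)
    (hact : ∀ i, act i) (haddr : ∀ i, addr i = A (i / K) * K + i % K) :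
    (∃ m < M, A m = a ∧ (∀ m' < m, A m' ≠ a) ∧
      scatter (M * K) act addr val old (a * K + k) = val (m * K + k)) ∨
    ((∀ m < M, A m ≠ a) ∧ scatter (M * K) act addr val old (a * K + k) = old (a * K + k)) := by
  classical
  have hK : 0 < K := by omega
  have key : ∀ i, addr i = a * K + k → A (i / K) = a ∧ i % K = k := by
    intro i hi
    rw [haddr] at hi
    have h1 : i % K < K := Nat.mod_lt _ hK
    have h2 := congrArg (· / K) hi
    have h3 := congrArg (· % K) hi
    simp only [Nat.mul_add_mod_of_lt h1, Nat.mul_add_mod_of_lt hk] at h3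
    rw [Nat.mul_comm (A _), Nat.mul_comm a] at h2
    simp only [Nat.mul_add_div hK, Nat.div_eq_of_lt h1, Nat.div_eq_of_lt hk, add_zero] at h2
    exact ⟨h2, h3⟩
  by_cases h : ∃ m, m < M ∧ A m = a
  · left
    obtain ⟨h1, h2⟩ := Nat.find_spec h
    refine ⟨Nat.find h, h1, h2, fun m' hm' he => Nat.find_min h hm' ⟨hm'.trans h1, he⟩, ?_⟩
    have hd : (Nat.find h * K + k) / K = Nat.find h := by
      rw [Nat.mul_comm, Nat.mul_add_div hK, Nat.div_eq_of_lt hk, add_zero]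
    have hm : (Nat.find h * K + k) % K = k := Nat.mul_add_mod_of_lt hk
    apply scatter_first
    · calc Nat.find h * K + k < Nat.find h * K + K := by omega
        _ = (Nat.find h + 1) * K := by ring
        _ ≤ M * K := Nat.mul_le_mul_right _ h1
    · exact hact _
    · rw [haddr, hd, hm, h2]
    · intro i' hi' _ he
      obtain ⟨e1, e2⟩ := key i' he
      have h4 : Nat.find h ≤ i' / K := by
        by_contra hlt
        push Not at hlt
        exact Nat.find_min h hlt ⟨hlt.trans h1, e1⟩
      have h5 : Nat.find h * K ≤ i' / K * K := Nat.mul_le_mul_right _ h4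
      have h6 := Nat.div_add_mod i' K
      rw [Nat.mul_comm] at h6
      omega
  · right
    refine ⟨fun m hm he => h ⟨m, hm, he⟩, scatter_of_not fun i hi _ he => ?_⟩
    exact h ⟨i / K, Nat.div_lt_of_lt_mul (by rw [Nat.mul_comm]; exact hi), (key i he).1⟩

end Scatter

/-! ### Runs -/

/-- From `σ`, the program `P` halts within depth `D`, using at most `X` processors at a time,
in a memory with the property `Q`. -/
def Run (B X : ℕ) (P : Prog) (σ : Mem) (D : ℕ) (Q : Mem → Prop) : Prop :=
  ∃ σ' W D', Exec B P σ σ' W D' ∧ W ≤ X * D' ∧ D' ≤ D ∧ Q σ'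

section Run
variable {B X D : ℕ} {σ : Mem} {Q : Mem → Prop}

theorem Run.mono {P : Prog} {D' : ℕ} {Q' : Mem → Prop} (h : Run B X P σ D Q) (hD : D ≤ D')
    (hQ : ∀ σ', Q σ' → Q' σ') : Run B X P σ D' Q' := by
  obtain ⟨σ', W, d, h1, h2, h3, h4⟩ := h
  exact ⟨σ', W, d, h1, h2, h3.trans hD, hQ _ h4⟩

theorem Run.seq {P P' : Prog} (D₁ D₂ : ℕ) (h : Run B X P σ D₁ fun σ₁ => Run B X P' σ₁ D₂ Q)
    (hD : D₁ + D₂ ≤ D := by omega) : Run B X (P ;; P') σ D Q := by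
  obtain ⟨σ₁, W₁, d₁, h1, h2, h3, σ₂, W₂, d₂, h4, h5, h6, h7⟩ := h
  exact ⟨σ₂, _, _, .seq h1 h4, by rw [mul_add]; omega, by omega, h7⟩

/-- The sequential part `a` is absorbed because the width is at least one. Thus a parallel step does
at most `X` times its depth in work, and this ratio is additive under composition, so that
afterwards only depth has to be counted. -/
theorem width_bound {X N a b : ℕ} (h : N ≤ X) (h1 : 1 ≤ X) :
    a + N * b ≤ X * (a + b) := by
  rw [mul_add]
  exact add_le_add (Nat.le_mul_of_pos_left _ h1) (Nat.mul_le_mul_right _ h)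

theorem Run.parI {N g : IExp} {a : ℕ} {p e : IExp} (hX : N.eval σ 0 ≤ X) (hX1 : 1 ≤ X)
    (h : ∀ i < N.eval σ 0, g.eval σ i ≠ 0 → p.eval σ i < B ∧ e.eval σ i < B)
    (hD : N.cost + (g.cost + p.cost + e.cost + 1) ≤ D)
    (hQ : Q (σ.setI a (scatter (N.eval σ 0) (fun i => g.eval σ i ≠ 0)
      (fun i => p.eval σ i) (fun i => e.eval σ i) (σ.int a)))) :
    Run B X (.parI N g a p e) σ D Q :=
  ⟨_, _, _, .parI σ N g a p e h, width_bound hX hX1, hD, hQ⟩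

theorem Run.parR {N g : IExp} {a : ℕ} {p : IExp} {e : RExp} (hX : N.eval σ 0 ≤ X) (hX1 : 1 ≤ X)
    (h : ∀ i < N.eval σ 0, g.eval σ i ≠ 0 → p.eval σ i < B)
    (hD : N.cost + (g.cost + p.cost + e.cost + 1) ≤ D)
    (hQ : Q (σ.setR a (scatter (N.eval σ 0) (fun i => g.eval σ i ≠ 0)
      (fun i => p.eval σ i) (fun i => e.eval σ i) (σ.real a)))) :
    Run B X (.parR N g a p e) σ D Q :=
  ⟨_, _, _, .parR σ N g a p e h, width_bound hX hX1, hD, hQ⟩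

/-- Parallel assignment of `e` to the cells `i < N` of the word array `a`. -/
def mapI (N : IExp) (a : ℕ) (e : IExp) : Prog := .parI N 1 a .idx e

/-- Parallel assignment of `e` to the cells `i < N` of the real array `a`. -/
def mapR (N : IExp) (a : ℕ) (e : RExp) : Prog := .parR N 1 a .idx e

/-- Assignment to a register. -/
def setReg (a : ℕ) (e : IExp) : Prog := .parI 1 1 a 0 e

theorem Run.mapI {N : IExp} {a : ℕ} {e : IExp} (hX : N.eval σ 0 ≤ X) (hX1 : 1 ≤ X)
    (h : ∀ i < N.eval σ 0, i < B ∧ e.eval σ i < B)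
    (hD : N.cost + (e.cost + 3) ≤ D)
    (hQ : Q (σ.setI a fun j => if j < N.eval σ 0 then e.eval σ j else σ.int a j)) :
    Run B X (mapI N a e) σ D Q := by
  refine Run.parI hX hX1 (fun i hi _ => h i hi) ?_ ?_
  · change N.cost + (1 + 1 + e.cost + 1) ≤ D
    omega
  · convert hQ using 2
    exact scatter_id fun i => one_ne_zero

theorem Run.mapR {N : IExp} {a : ℕ} {e : RExp} (hX : N.eval σ 0 ≤ X) (hX1 : 1 ≤ X)
    (h : ∀ i < N.eval σ 0, i < B)
    (hD : N.cost + (e.cost + 3) ≤ D)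
    (hQ : Q (σ.setR a fun j => if j < N.eval σ 0 then e.eval σ j else σ.real a j)) :
    Run B X (mapR N a e) σ D Q := by
  refine Run.parR hX hX1 (fun i hi _ => h i hi) ?_ ?_
  · change N.cost + (1 + 1 + e.cost + 1) ≤ D
    omega
  · convert hQ using 2
    exact scatter_id fun i => one_ne_zero

theorem Run.setReg {a : ℕ} {e : IExp} (hX1 : 1 ≤ X) (h : e.eval σ 0 < B) (hD : e.cost + 4 ≤ D)
    (hQ : Q (σ.setI a fun j => if j = 0 then e.eval σ 0 else σ.int a j)) :
    Run B X (setReg a e) σ D Q := by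
  refine Run.parI (by simpa using hX1) hX1 ?_ ?_ ?_
  · intro i hi _
    obtain rfl : i = 0 := by simpa using hi
    exact ⟨lt_of_le_of_lt (Nat.zero_le _) h, h⟩
  · change 1 + (1 + 1 + e.cost + 1) ≤ D
    omega
  · convert hQ using 2
    funext j
    split_ifs with hj
    · subst hj
      exact scatter_inj (addr := fun _ => 0) (i := 0) (act := fun _ => (1 : ℕ) ≠ 0)
        (by simp) one_ne_zero fun i' h _ _ => by simpa using h
    · exact scatter_of_not fun _ _ _ he => hj he.symm

/-- A loop that runs for `m` rounds. -/
theorem Run.loop {b : IExp} {P : Prog} (m D₁ : ℕ) (Inv : ℕ → Mem → Prop) (hX1 : 1 ≤ X)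
    (h0 : Inv 0 σ) (hb : ∀ j < m, ∀ τ, Inv j τ → b.eval τ 0 ≠ 0)
    (hstep : ∀ j < m, ∀ τ, Inv j τ → Run B X P τ D₁ (Inv (j + 1)))
    (hend : ∀ τ, Inv m τ → b.eval τ 0 = 0) (hQ : ∀ τ, Inv m τ → Q τ)
    (hD : m * (b.cost + D₁) + b.cost ≤ D) :
    Run B X (.loop b P) σ D Q := by
  have key : ∀ r j τ, j + r = m → Inv j τ →
      Run B X (.loop b P) τ (r * (b.cost + D₁) + b.cost) (Inv m) := by
    intro r
    induction r with
    | zero =>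
      intro j τ hj hi
      obtain rfl : j = m := by omega
      exact ⟨τ, _, _, .loopDone (hend τ hi), Nat.le_mul_of_pos_left _ hX1, by omega, hi⟩
    | succ r ih =>
      intro j τ hj hi
      obtain ⟨τ₁, W₁, d₁, h1, h2, h3, h4⟩ := hstep j (by omega) τ hi
      obtain ⟨τ₂, W₂, d₂, k1, k2, k3, k4⟩ := ih (j + 1) τ₁ (by omega) h4
      refine ⟨τ₂, _, _, .loopStep (hb j (by omega) τ hi) h1 k1, ?_, ?_, k4⟩
      · rw [mul_add, mul_add]
        have := Nat.le_mul_of_pos_left b.cost hX1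
        omega
      · rw [Nat.add_mul]
        omega
  exact (key m 0 σ (by omega) h0).mono hD hQ

end Run

/-- The arrays outside the lists `I` and `R` have not changed. -/
structure Frame (I R : List ℕ) (σ σ' : Mem) : Prop where
  int : ∀ a, a ∉ I → σ'.int a = σ.int a
  real : ∀ a, a ∉ R → σ'.real a = σ.real a

theorem Frame.refl {I R : List ℕ} (σ : Mem) : Frame I R σ σ := ⟨fun _ _ => rfl, fun _ _ => rfl⟩

theorem Frame.trans {I R I' R' : List ℕ} {σ σ₁ σ₂ : Mem} (h₁ : Frame I' R' σ σ₁)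
    (h₂ : Frame I R σ₁ σ₂) (hI : I' ⊆ I := by decide) (hR : R' ⊆ R := by decide) :
    Frame I R σ σ₂ :=
  ⟨fun a ha => (h₂.int a ha).trans (h₁.int a fun h => ha (hI h)),
   fun a ha => (h₂.real a ha).trans (h₁.real a fun h => ha (hR h))⟩

theorem Frame.mono {I R I' R' : List ℕ} {σ σ' : Mem} (h : Frame I' R' σ σ')
    (hI : I' ⊆ I := by decide) (hR : R' ⊆ R := by decide) : Frame I R σ σ' :=
  h.trans (Frame.refl _) hI hR

theorem Frame.comp {I R : List ℕ} {σ σ₁ σ₂ : Mem} (h₁ : Frame I R σ σ₁) (h₂ : Frame I R σ₁ σ₂) :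
    Frame I R σ σ₂ :=
  ⟨fun a ha => (h₂.int a ha).trans (h₁.int a ha), fun a ha => (h₂.real a ha).trans (h₁.real a ha)⟩

theorem Frame.setI {I R : List ℕ} {σ σ' : Mem} {a : ℕ} {f : ℕ → ℕ} (h : Frame I R σ σ')
    (ha : a ∈ I := by decide) : Frame I R σ (σ'.setI a f) :=
  ⟨fun b hb => by
    rw [setI_int, if_neg (fun e : b = a => hb (e ▸ ha)), h.int b hb], h.real⟩

theorem Frame.setR {I R : List ℕ} {σ σ' : Mem} {a : ℕ} {f : ℕ → ℝ} (h : Frame I R σ σ')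
    (ha : a ∈ R := by decide) : Frame I R σ (σ'.setR a f) :=
  ⟨h.int, fun b hb => by
    rw [setR_real, if_neg (fun e : b = a => hb (e ▸ ha)), h.real b hb]⟩

end PRAM

namespace PRAM

/-! ## Merging by ranks -/

section Rank

/-- A downward closed predicate holds on an initial segment, whose length is the number of its
members. This turns counting predecessors into a search for a threshold. -/
theorem prefix_card {h : ℕ} {P : ℕ → Prop} [DecidablePred P]
    (hP : ∀ i j, i ≤ j → j < h → P j → P i) {j : ℕ} (hj : j < h) :
    P j ↔ j < ((Finset.range h).filter P).card := by
  constructor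
  · intro hPj
    have : Finset.range (j + 1) ⊆ (Finset.range h).filter P := by
      intro i hi
      simp only [Finset.mem_range, Finset.mem_filter] at hi ⊢
      exact ⟨by omega, hP i j (by omega) hj hPj⟩
    have := Finset.card_le_card this
    simp only [Finset.card_range] at this
    omega
  · intro hlt
    by_contra hn
    have : (Finset.range h).filter P ⊆ Finset.range j := by
      intro i hi
      simp only [Finset.mem_range, Finset.mem_filter] at hi ⊢
      by_contra hij
      exact hn (hP j i (by omega) hi.1 hi.2)
    have := Finset.card_le_card this
    simp only [Finset.card_range] at this
    omega

-- Ranks and sorting permutations within blocks.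

variable {α : Type*} [LinearOrder α] (key : ℕ → α)

/-- The cells in the order of their keys, ties being broken by position. -/
def KeyLt (i j : ℕ) : Prop := key i < key j ∨ (key i = key j ∧ i < j)

theorem KeyLt.trans {key : ℕ → α} {i j k : ℕ} (h1 : KeyLt key i j) (h2 : KeyLt key j k) :
    KeyLt key i k := by
  unfold KeyLt at *
  rcases h1 with h1 | ⟨h1, h1'⟩ <;> rcases h2 with h2 | ⟨h2, h2'⟩
  · exact .inl (h1.trans h2)
  · exact .inl (h2 ▸ h1)
  · exact .inl (h1 ▸ h2)
  · exact .inr ⟨h1.trans h2, h1'.trans h2'⟩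

theorem KeyLt.irrefl {key : ℕ → α} (i : ℕ) : ¬ KeyLt key i i := by
  simp [KeyLt]

theorem KeyLt.total {key : ℕ → α} {i j : ℕ} (h : i ≠ j) : KeyLt key i j ∨ KeyLt key j i := by
  unfold KeyLt
  rcases lt_trichotomy (key i) (key j) with h1 | h1 | h1
  · exact .inl (.inl h1)
  · rcases lt_or_gt_of_ne h with h2 | h2
    · exact .inl (.inr ⟨h1, h2⟩)
    · exact .inr (.inr ⟨h1.symm, h2⟩)
  · exact .inr (.inl h1)

open Classical in
/-- The number of cells of the block of length `m` around `i` that precede `i`. -/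
noncomputable def rank (m i : ℕ) : ℕ :=
  ((Finset.range m).filter fun j => KeyLt key (i / m * m + j) i).card

/-- The position of the cell `i` after sorting its block of length `m`. -/
noncomputable def rankPos (m i : ℕ) : ℕ := i / m * m + rank key m i

variable {m : ℕ}

theorem rank_lt (hm : 0 < m) (i : ℕ) : rank key m i < m := by
  classical
  have : (Finset.range m).filter (fun j => KeyLt key (i / m * m + j) i) ⊂ Finset.range m := by
    refine Finset.filter_ssubset.2 ⟨i % m, Finset.mem_range.2 (Nat.mod_lt _ hm), ?_⟩
    rw [Nat.mul_comm, Nat.div_add_mod]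
    exact KeyLt.irrefl i
  simpa [rank] using Finset.card_lt_card this

theorem rankPos_div (hm : 0 < m) (i : ℕ) : rankPos key m i / m = i / m := by
  rw [rankPos, Nat.mul_comm, Nat.mul_add_div hm, Nat.div_eq_of_lt (rank_lt key hm i), add_zero]

/-- By transitivity every predecessor of `i` precedes `j`, and `i` itself is one predecessor more.
-/
theorem rank_strict (hm : 0 < m) {i j : ℕ} (hb : i / m = j / m) (h : KeyLt key i j) :
    rank key m i < rank key m j := by
  classical
  refine Finset.card_lt_card ?_
  rw [Finset.ssubset_iff_of_subset]
  · refine ⟨i % m, ?_, ?_⟩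
    · rw [Finset.mem_filter, ← hb, Nat.mul_comm, Nat.div_add_mod]
      exact ⟨Finset.mem_range.2 (Nat.mod_lt _ hm), h⟩
    · rw [Finset.mem_filter, Nat.mul_comm, Nat.div_add_mod]
      exact fun h => KeyLt.irrefl i h.2
  · intro l hl
    rw [Finset.mem_filter] at hl ⊢
    rw [← hb]
    exact ⟨hl.1, hl.2.trans h⟩

theorem rankPos_injective (hm : 0 < m) : Function.Injective (rankPos key m) := by
  intro i j h
  have hb : i / m = j / m := by
    rw [← rankPos_div key hm i, ← rankPos_div key hm j, h]
  by_contra hne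
  simp only [rankPos, hb, add_right_inj] at h
  rcases KeyLt.total (key := key) hne with h1 | h1
  · exact absurd h (rank_strict key hm hb h1).ne
  · exact absurd h (rank_strict key hm hb.symm h1).ne'

/-- Each block is finite and mapped into itself, so injectivity on it forces surjectivity. -/
theorem bijective_of_blocks (hm : 0 < m) {f : ℕ → ℕ} (hf : Function.Injective f)
    (hb : ∀ i, f i / m = i / m) : Function.Bijective f := by
  refine ⟨hf, fun p => ?_⟩
  have hmem : ∀ i, i / m = p / m ↔ i ∈ Finset.Ico (p / m * m) (p / m * m + m) := by
    intro i
    rw [Finset.mem_Ico, Nat.div_eq_iff hm]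
    omega
  have := Finset.surjOn_of_injOn_of_card_le (s := Finset.Ico (p / m * m) (p / m * m + m))
    (t := Finset.Ico (p / m * m) (p / m * m + m)) f
    (fun i hi => by
      rw [Finset.mem_coe, ← hmem] at hi ⊢
      rw [hb, hi]) hf.injOn le_rfl
  obtain ⟨i, _, hi⟩ := this (Finset.mem_coe.2 ((hmem p).1 rfl))
  exact ⟨i, hi⟩

/-- The cells that go to the positions of sorted blocks of length `m`; the cells from `tot` on
stay. -/
theorem exists_sortPerm (hm : 0 < m) (tot : ℕ) (htot : m ∣ tot) :
    ∃ π : Equiv.Perm ℕ, (∀ i, π i / m = i / m) ∧ (∀ i < tot, π (rankPos key m i) = i) ∧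
      (∀ i, tot ≤ i → π i = i) ∧
      ∀ i j, i ≤ j → j < tot → i / m = j / m → key (π i) ≤ key (π j) := by
  classical
  obtain ⟨q, rfl⟩ := htot
  let f : ℕ → ℕ := fun i => if i < m * q then rankPos key m i else i
  have hfb : ∀ i, f i / m = i / m := by
    intro i
    simp only [f]
    split_ifs
    · exact rankPos_div key hm i
    · rfl
  have hlt : ∀ i, f i < m * q ↔ i < m * q := by
    intro i
    rw [Nat.mul_comm, ← Nat.div_lt_iff_lt_mul hm, ← Nat.div_lt_iff_lt_mul hm, hfb]
  have hinj : Function.Injective f := by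
    intro i j h
    have hij : i < m * q ↔ j < m * q := by rw [← hlt i, ← hlt j, h]
    simp only [f] at h
    by_cases hi : i < m * q
    · rw [if_pos hi, if_pos (hij.1 hi)] at h
      exact rankPos_injective key hm h
    · rw [if_neg hi, if_neg (fun h => hi (hij.2 h))] at h
      exact h
  -- `f` sends a cell to its sorted place; the wanted permutation names the cell that arrives at a
  -- place, hence it is the inverse.
  let e := Equiv.ofBijective f (bijective_of_blocks hm hinj hfb)
  have he : ∀ i, e i = f i := fun i => rfl
  have hsb : ∀ i, e.symm i / m = i / m := by
    intro i
    rw [← hfb, ← he, e.apply_symm_apply]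
  refine ⟨e.symm, hsb, ?_, ?_, ?_⟩
  · intro i hi
    rw [e.symm_apply_eq, he]
    simp only [f, if_pos hi]
  · intro i hi
    rw [e.symm_apply_eq, he]
    simp only [f, if_neg (not_lt.2 hi)]
  -- If the keys were in the wrong order, `rank_strict` would put the place `j` before the place
  -- `i`.
  · intro i j hij hj hb
    by_contra hlt'
    push Not at hlt'
    have hi' : e.symm i < m * q := by rw [← hlt, ← he, e.apply_symm_apply]; omega
    have hj' : e.symm j < m * q := by rw [← hlt, ← he, e.apply_symm_apply]; omega
    have hbb : e.symm j / m = e.symm i / m := by rw [hsb, hsb, hb]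
    have h1 := rank_strict key hm hbb (.inl hlt')
    have h2 : i = rankPos key m (e.symm i) := by
      have := e.apply_symm_apply i
      rw [he] at this
      simp only [f, if_pos hi'] at this
      exact this.symm
    have h3 : j = rankPos key m (e.symm j) := by
      have := e.apply_symm_apply j
      rw [he] at this
      simp only [f, if_pos hj'] at this
      exact this.symm
    rw [rankPos] at h2 h3
    rw [hbb] at h3
    omega

-- Ranks in the sibling half of a block.

/-- The other half of the block of length `2 * h` around `i`. -/
def sibBase (h i : ℕ) : ℕ := (i / h + 1 - 2 * (i / h % 2)) * h

open Classical in
/-- The number of cells of the sibling half that precede `i`. -/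
noncomputable def sibCount (h i : ℕ) : ℕ :=
  ((Finset.range h).filter fun j => KeyLt key (sibBase h i + j) i).card

/-- In a sorted half the predecessors of `i` are exactly the cells to its left, `i % h` of them,
whatever ties there are. So only the rank in the sibling half has to be computed. -/
theorem rankPos_eq {h : ℕ} (hh : 0 < h)
    (hs : ∀ i j, i ≤ j → i / h = j / h → key i ≤ key j) (i : ℕ) :
    rankPos key (2 * h) i = i / (2 * h) * (2 * h) + i % h + sibCount key h i := by
  classical
  have hown : ((Finset.range h).filter fun j => KeyLt key (i / h * h + j) i).card = i % h := by
    have : ((Finset.range h).filter fun j => KeyLt key (i / h * h + j) i) =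
        Finset.range (i % h) := by
      ext j
      have hi := Nat.div_add_mod i h
      have hlt := Nat.mod_lt i hh
      rw [Nat.mul_comm] at hi
      simp only [Finset.mem_filter, Finset.mem_range]
      have hblk : j < h → (i / h * h + j) / h = i / h := by
        intro hj
        rw [Nat.mul_comm, Nat.mul_add_div hh, Nat.div_eq_of_lt hj, add_zero]
      constructor
      · rintro ⟨hj, hk⟩
        by_contra hge
        have := hs i (i / h * h + j) (by omega) (hblk hj).symm
        rcases hk with hk | ⟨_, hk⟩
        · exact absurd hk (not_lt.2 this)
        · omega
      · intro hj
        have hj' : j < h := by omega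
        refine ⟨hj', ?_⟩
        have hle := hs (i / h * h + j) i (by omega) (hblk hj')
        rcases hle.lt_or_eq with h1 | h1
        · exact .inl h1
        · exact .inr ⟨h1, by omega⟩
    rw [this, Finset.card_range]
  have hsplit : rank key (2 * h) i =
      ((Finset.range h).filter fun j => KeyLt key (i / (2 * h) * (2 * h) + j) i).card +
      ((Finset.range h).filter fun j => KeyLt key (i / (2 * h) * (2 * h) + h + j) i).card := by
    rw [rank, two_mul, Finset.card_filter, Finset.sum_range_add, ← Finset.card_filter,
      ← Finset.card_filter]
    simp only [add_assoc]
  have hd : i / (2 * h) = i / h / 2 := by rw [Nat.mul_comm, Nat.div_div_eq_div_mul]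
  rw [rankPos, hsplit, sibCount, sibBase]
  rcases Nat.mod_two_eq_zero_or_one (i / h) with hp | hp
  · have h1 : i / (2 * h) * (2 * h) = i / h * h := by
      rw [hd, ← mul_assoc]
      congr 1
      omega
    have h2 : (i / h + 1 - 2 * (i / h % 2)) * h = i / h * h + h := by
      rw [hp, Nat.mul_zero, Nat.sub_zero, Nat.succ_mul]
    rw [h1, h2, hown]
    omega
  · have h1 : i / (2 * h) * (2 * h) + h = i / h * h := by
      rw [hd, ← mul_assoc, ← Nat.succ_mul]
      congr 1
      omega
    have h2 : (i / h + 1 - 2 * (i / h % 2)) * h = i / (2 * h) * (2 * h) := by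
      rw [hd, ← mul_assoc]
      congr 1
      omega
    rw [h1, h2, hown]
    omega

theorem sibBase_add_div {h : ℕ} (hh : 0 < h) (i : ℕ) {j : ℕ} (hj : j < h) :
    (sibBase h i + j) / h = i / h + 1 - 2 * (i / h % 2) := by
  rw [sibBase, Nat.mul_comm, Nat.mul_add_div hh, Nat.div_eq_of_lt hj, add_zero]

theorem sibBase_add_lt {h q : ℕ} (hh : 0 < h) {i j : ℕ} (hi : i < q * (2 * h)) (hj : j < h) :
    sibBase h i + j < q * (2 * h) := by
  have h1 := sibBase_add_div hh i hj
  have h2 : i / h < 2 * q := by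
    rw [Nat.div_lt_iff_lt_mul hh]
    calc i < q * (2 * h) := hi
      _ = 2 * q * h := by ring
  have h3 : (sibBase h i + j) / h < 2 * q := by
    rw [h1]
    generalize i / h = a at h2
    omega
  rw [Nat.div_lt_iff_lt_mul hh] at h3
  calc _ < _ := h3
    _ = q * (2 * h) := by ring

/-- Whether a cell of the sibling half precedes `i` is a comparison of keys. -/
theorem sib_keyLt {h : ℕ} (hh : 0 < h) (i : ℕ) {j : ℕ} (hj : j < h) :
    KeyLt key (sibBase h i + j) i ↔
      if i / h % 2 = 0 then key (sibBase h i + j) < key i else key (sibBase h i + j) ≤ key i := by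
  have h1 := sibBase_add_div hh i hj
  split_ifs with hp
  · have : i < sibBase h i + j := by
      by_contra hle
      push Not at hle
      have := Nat.div_le_div_right (c := h) hle
      rw [h1] at this
      generalize i / h = a at this hp
      omega
    unfold KeyLt
    constructor
    · rintro (h | ⟨_, h⟩)
      · exact h
      · omega
    · exact .inl
  · have : sibBase h i + j < i := by
      by_contra hle
      push Not at hle
      have := Nat.div_le_div_right (c := h) hle
      rw [h1] at this
      generalize i / h = a at this hp
      omega
    unfold KeyLt
    rw [le_iff_lt_or_eq]
    constructor
    · rintro (h | ⟨h, _⟩)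
      · exact .inl h
      · exact .inr h
    · rintro (h | h)
      · exact .inl h
      · exact .inr ⟨h, this⟩

/-- The sibling half is sorted, so its cells that precede `i` form an initial segment; this
justifies the binary search for `sibCount`. -/
theorem sib_prefix {h : ℕ} (hh : 0 < h)
    (hs : ∀ i j, i ≤ j → i / h = j / h → key i ≤ key j) (i : ℕ) {j : ℕ} (hj : j < h) :
    KeyLt key (sibBase h i + j) i ↔ j < sibCount key h i := by
  classical
  refine prefix_card (P := fun j => KeyLt key (sibBase h i + j) i) ?_ hj
  intro a b hab hb hP
  have hle := hs (sibBase h i + a) (sibBase h i + b) (by omega)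
    (by rw [sibBase_add_div hh i (by omega), sibBase_add_div hh i hb])
  rw [sib_keyLt key hh i (by omega)] at hP ⊢
  split_ifs at hP ⊢
  · exact lt_of_le_of_lt hle hP
  · exact hle.trans hP

theorem sibCount_le (h i : ℕ) : sibCount key h i ≤ h := by
  classical
  exact (Finset.card_filter_le _ _).trans (Finset.card_range h).le

end Rank

end PRAM

namespace PRAM

/-! ## Sorting a buffer

The buffer consists of the word array `11` and the real array `2`. A cell with word `0` is empty,
and empty cells are sorted to the end. Register `6` holds the length of the buffer, and
register `7` the length of the segments that are to be sorted. -/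

/-- The sorting key of an entry. -/
noncomputable def entKey (p : ℕ × ℝ) : WithTop ℝ := if p.1 = 0 then ⊤ else (p.2 : WithTop ℝ)

/-- The cell `i` of the buffer. -/
def buf (σ : Mem) (i : ℕ) : ℕ × ℝ := (σ.int 11 i, σ.real 2 i)

/-- The probed cell of the sibling half. -/
def probe : IExp := (.idx / reg 8 + 1 - 2 * (.idx / reg 8 % 2)) * reg 8 + .read 10 .idx + reg 9 - 1

/-- Whether the probed cell precedes the own cell. -/
def precedes : IExp :=
  .ite (.idx / reg 8 % 2)
    (.ite (.read 11 .idx) (.ite (.read 11 probe) (.rle (.read 2 probe) (.read 2 .idx)) 0) 1)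
    (.ite (.read 11 probe) (.ite (.read 11 .idx) (1 - .rle (.read 2 .idx) (.read 2 probe)) 1) 0)

/-- If the count is to grow from `c` by `s`, the last of the new cells must precede `i`, which
explains the `- 1` in the probe. Ties favour the left half: a cell of the right half compares
weakly, one of the left half strictly, as `1 - rle`. The inner tests on words implement the key `⊤`
of empty cells. -/
theorem precedes_eval (σ : Mem) (i : ℕ) {c s h : ℕ} (hh : σ.int 8 0 = h) (hp : 0 < h)
    (hc : σ.int 10 i = c) (hs : σ.int 9 0 = s) (h1 : 1 ≤ s) (h2 : c + s ≤ h) :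
    precedes.eval σ i ≠ 0 ↔ KeyLt (fun j => entKey (buf σ j)) (sibBase h i + (c + s - 1)) i := by
  have hpr : probe.eval σ i = sibBase h i + (c + s - 1) := by
    simp only [probe, eval_sub, eval_add, eval_mul, eval_div, eval_mod, eval_idx, eval_reg, hh,
      eval_one, eval_two, eval_read, hc, hs, sibBase]
    omega
  rw [sib_keyLt _ hp i (by omega)]
  simp only [precedes, eval_ite, eval_div, eval_mod, eval_idx, eval_reg, hh, eval_two, eval_read,
    hpr, eval_rle, evalR_read, eval_zero, eval_one, eval_sub, entKey, buf]
  split_ifs <;> simp_all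

/-- Binary search for the number of cells of the sibling half that precede each cell. -/
def search : Prog :=
  mapI (reg 6) 10 0 ;; setReg 9 (reg 8) ;;
  .loop (reg 9)
    (mapI (reg 6) 10 (.ite (.le (.read 10 .idx + reg 9) (reg 8))
      (.ite precedes (.read 10 .idx + reg 9) (.read 10 .idx)) (.read 10 .idx)) ;;
    setReg 9 (reg 9 / 2))

variable {B X : ℕ}

/-- After `m` rounds the stored number is at most the count, and less than `2 ^ (l + 1 - m)` below
it. The count can be the whole half `2 ^ l`, so the first increment is `2 ^ l` itself and `l + 1`
rounds are needed. -/
theorem search_run {σ : Mem} {q l : ℕ} (h8 : σ.int 8 0 = 2 ^ l) (h6 : σ.int 6 0 = q * (2 * 2 ^ l))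
    (hX : q * (2 * 2 ^ l) ≤ X) (hX1 : 1 ≤ X) (hB : 2 ^ l < B) (hXB : X ≤ B)
    (hs : ∀ i j, i ≤ j → j < q * (2 * 2 ^ l) → i / 2 ^ l = j / 2 ^ l →
      entKey (buf σ i) ≤ entKey (buf σ j)) :
    Run B X search σ ((l + 1) * 200 + 30) fun σ' =>
      (∀ i < q * (2 * 2 ^ l), σ'.int 10 i =
        sibCount (fun j => if j < q * (2 * 2 ^ l) then entKey (buf σ j) else ⊤) (2 ^ l) i) ∧
      Frame [9, 10] [] σ σ' := by
  set tot := q * (2 * 2 ^ l) with htot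
  -- The rank lemmas ask for sorted halves everywhere; the cells beyond the buffer are given the key
  -- `⊤`.
  set key : ℕ → WithTop ℝ := fun j => if j < tot then entKey (buf σ j) else ⊤ with hkey
  have hpos : 0 < 2 ^ l := by positivity
  have hs' : ∀ i j, i ≤ j → i / 2 ^ l = j / 2 ^ l → key i ≤ key j := by
    intro i j hij hb
    simp only [hkey]
    by_cases hj : j < tot
    · rw [if_pos hj, if_pos (by omega)]
      exact hs i j hij hj hb
    · rw [if_neg hj]
      exact le_top
  refine Run.seq 10 ((l + 1) * 200 + 20) ?_
  refine Run.mapI (by simpa [h6] using hX) hX1 ?_ (by decide) ?_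
  · intro i hi
    simp only [eval_reg, h6] at hi
    exact ⟨by omega, by simpa using by omega⟩
  refine Run.seq 10 ((l + 1) * 200 + 10) ?_
  refine Run.setReg hX1 (by simpa [h8] using hB) (by decide) ?_
  refine Run.loop (l + 1) 190 (fun m τ => τ.int 9 0 = 2 ^ l / 2 ^ m ∧ Frame [9, 10] [] σ τ ∧
    ∀ i < tot, τ.int 10 i ≤ sibCount key (2 ^ l) i ∧
      sibCount key (2 ^ l) i < τ.int 10 i + 2 ^ (l + 1 - m)) hX1 ?_ ?_ ?_ ?_ ?_ ?_
  · refine ⟨by simp [h8], ((Frame.refl _).setI.setI), fun i hi => ?_⟩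
    have := sibCount_le key (2 ^ l) i
    simp only [setI_int, eval_reg, h6, hi, if_true, eval_zero, Nat.reduceEqDiff, if_false]
    have h2 : 2 ^ (l + 1 - 0) = 2 * 2 ^ l := by rw [Nat.sub_zero, pow_succ]; ring
    omega
  · rintro j hj τ ⟨h9, -⟩
    rw [eval_reg, h9, Nat.pow_div (by omega) (by norm_num)]
    positivity
  · rintro m hm τ ⟨h9, hf, hC⟩
    rw [Nat.pow_div (by omega) (by norm_num)] at h9
    have e6 : τ.int 6 0 = tot := by rw [hf.int 6 (by decide), h6]
    have e8 : τ.int 8 0 = 2 ^ l := by rw [hf.int 8 (by decide), h8]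
    have hst : 0 < 2 ^ (l - m) := by positivity
    have hst2 : 2 ^ (l + 1 - m) = 2 * 2 ^ (l - m) := by
      rw [Nat.succ_sub (by omega), pow_succ]; ring
    have hbuf : ∀ j, buf τ j = buf σ j := by
      intro j
      simp only [buf, hf.int 11 (by decide), hf.real 2 (by decide)]
    have hev : ∀ i < tot, ∀ c, τ.int 10 i = c →
        IExp.eval τ i (.ite (.le (.read 10 .idx + reg 9) (reg 8))
          (.ite precedes (.read 10 .idx + reg 9) (.read 10 .idx)) (.read 10 .idx)) =
        if c + 2 ^ (l - m) ≤ sibCount key (2 ^ l) i then c + 2 ^ (l - m) else c := by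
      intro i hi c hc
      have hle := sibCount_le key (2 ^ l) i
      simp only [eval_ite, eval_le, eval_add, eval_read, eval_idx, eval_reg, hc, h9, e8]
      by_cases h1 : c + 2 ^ (l - m) ≤ 2 ^ l
      · have h2 := precedes_eval τ i e8 hpos hc h9 hst h1
        have h3 : KeyLt (fun j => entKey (buf τ j)) (sibBase (2 ^ l) i + (c + 2 ^ (l - m) - 1)) i ↔
            KeyLt key (sibBase (2 ^ l) i + (c + 2 ^ (l - m) - 1)) i := by
          have h4 : sibBase (2 ^ l) i + (c + 2 ^ (l - m) - 1) < tot :=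
            sibBase_add_lt hpos hi (by omega)
          simp only [KeyLt, hkey, if_pos h4, if_pos hi, hbuf]
        rw [h3, sib_prefix key hpos hs' i (by omega)] at h2
        by_cases h5 : c + 2 ^ (l - m) ≤ sibCount key (2 ^ l) i
        · simp [h1, h5, h2.2 (by omega)]
        · have : precedes.eval τ i = 0 := by
            by_contra h6
            have := h2.1 h6
            omega
          simp [h1, h5, this]
      · simp only [h1, if_false, if_true]
        rw [if_neg (by omega)]
    refine Run.seq 180 10 ?_
    refine Run.mapI (by simpa [e6] using hX) hX1 ?_ (by decide) ?_
    · intro i hi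
      simp only [eval_reg, e6] at hi
      refine ⟨by omega, ?_⟩
      rw [hev i hi _ rfl]
      have := sibCount_le key (2 ^ l) i
      have := (hC i hi).1
      split_ifs <;> omega
    · refine Run.setReg hX1 ?_ (by decide) ?_
      · simp only [eval_div, eval_reg, setI_int, eval_two, Nat.reduceEqDiff, if_false, h9]
        have := Nat.pow_le_pow_right (n := 2) (by norm_num) (Nat.sub_le l m)
        omega
      · refine ⟨?_, hf.setI.setI, ?_⟩
        · simp only [eval_div, eval_reg, setI_int, eval_two, Nat.reduceEqDiff, if_false, if_true, h9]
          rw [pow_succ, ← Nat.div_div_eq_div_mul, Nat.pow_div (by omega) (by norm_num)]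
        · intro i hi
          simp only [setI_int, eval_reg, e6, hi, if_true, Nat.reduceEqDiff, if_false]
          rw [hev i hi _ rfl]
          have := hC i hi
          have h7 : l + 1 - (m + 1) = l - m := by omega
          rw [h7]
          split_ifs <;> omega
  · rintro τ ⟨h9, -⟩
    rw [eval_reg, h9, Nat.pow_succ]
    exact Nat.div_eq_of_lt (by omega)
  · rintro τ ⟨-, hf, hC⟩
    refine ⟨fun i hi => ?_, hf⟩
    have := hC i hi
    simp only [Nat.sub_self, pow_zero] at this
    omega
  · change (l + 1) * (2 + 190) + 2 ≤ (l + 1) * 200 + 10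
    omega

/-- Merge sort of the segments of the buffer. -/
def sort : Prog :=
  setReg 8 1 ;;
  .loop (.le (reg 8 + 1) (reg 7))
    (search ;;
    mapI (reg 6) 10 (.idx / (2 * reg 8) * (2 * reg 8) + .idx % reg 8 + .read 10 .idx) ;;
    .parI (reg 6) 1 11 (.read 10 .idx) (.read 11 .idx) ;;
    .parR (reg 6) 1 2 (.read 10 .idx) (.read 2 .idx) ;;
    setReg 8 (reg 8 * 2))

/-- `σ'` has the cells of the buffer of `σ`, permuted within the segments of length `m`, such that
the segments below `tot` are sorted. -/
def SortedBuf (m tot : ℕ) (σ σ' : Mem) : Prop :=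
  ∃ π : Equiv.Perm ℕ, (∀ i, π i / m = i / m) ∧ (∀ i, buf σ' i = buf σ (π i)) ∧
    ∀ i j, i ≤ j → j < tot → i / m = j / m → entKey (buf σ' i) ≤ entKey (buf σ' j)

/-- Every cell moves to its rank in the merged block. Ranks are distinct, so the writes do not
collide, and words and reals undergo the same permutation. -/
theorem merge_run {σ : Mem} {q l : ℕ} (h8 : σ.int 8 0 = 2 ^ l) (h6 : σ.int 6 0 = q * (2 * 2 ^ l))
    (hX : q * (2 * 2 ^ l) ≤ X) (hX1 : 1 ≤ X) (hB : 2 * 2 ^ l < B) (hXB : X ≤ B)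
    (hw : ∀ i, σ.int 11 i < B)
    (hs : ∀ i j, i ≤ j → j < q * (2 * 2 ^ l) → i / 2 ^ l = j / 2 ^ l →
      entKey (buf σ i) ≤ entKey (buf σ j)) :
    Run B X (search ;;
    mapI (reg 6) 10 (.idx / (2 * reg 8) * (2 * reg 8) + .idx % reg 8 + .read 10 .idx) ;;
    .parI (reg 6) 1 11 (.read 10 .idx) (.read 11 .idx) ;;
    .parR (reg 6) 1 2 (.read 10 .idx) (.read 2 .idx) ;;
    setReg 8 (reg 8 * 2)) σ ((l + 1) * 200 + 130) fun σ' =>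
      σ'.int 8 0 = 2 ^ (l + 1) ∧ SortedBuf (2 ^ (l + 1)) (q * (2 * 2 ^ l)) σ σ' ∧
      Frame [8, 9, 10, 11] [2] σ σ' := by
  set tot := q * (2 * 2 ^ l) with htot
  set key : ℕ → WithTop ℝ := fun j => if j < tot then entKey (buf σ j) else ⊤ with hkey
  have hpos : 0 < 2 ^ l := by positivity
  have hs' : ∀ i j, i ≤ j → i / 2 ^ l = j / 2 ^ l → key i ≤ key j := by
    intro i j hij hb
    simp only [hkey]
    by_cases hj : j < tot
    · rw [if_pos hj, if_pos (by omega)]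
      exact hs i j hij hj hb
    · rw [if_neg hj]
      exact le_top
  have hm : 0 < 2 * 2 ^ l := by omega
  obtain ⟨π, hπb, hπr, hπo, hπs⟩ := exists_sortPerm key hm tot ⟨q, by rw [htot, mul_comm]⟩
  have hπr' : ∀ i < tot, π.symm i = rankPos key (2 * 2 ^ l) i := by
    intro i hi
    rw [Equiv.symm_apply_eq, hπr i hi]
  have hlt : ∀ i, π i < tot ↔ i < tot := by
    intro i
    rw [htot, ← Nat.div_lt_iff_lt_mul hm, ← Nat.div_lt_iff_lt_mul hm, hπb]
  refine Run.seq ((l + 1) * 200 + 30) 100 ?_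
  refine (search_run h8 h6 hX hX1 (by omega) hXB hs).mono le_rfl ?_
  rintro τ ⟨hC, hf⟩
  have e6 : τ.int 6 0 = tot := by rw [hf.int 6 (by decide), h6]
  have e8 : τ.int 8 0 = 2 ^ l := by rw [hf.int 8 (by decide), h8]
  have hpos' : ∀ i < tot, IExp.eval τ i
      (.idx / (2 * reg 8) * (2 * reg 8) + .idx % reg 8 + .read 10 .idx) = π.symm i := by
    intro i hi
    simp only [eval_add, eval_mul, eval_div, eval_mod, eval_idx, eval_two, eval_reg, e8, eval_read,
      hC i hi]
    rw [hπr' i hi, rankPos_eq key hpos hs']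
  have hsl : ∀ i < tot, π.symm i < tot := by
    intro i hi
    rw [← hlt, Equiv.apply_symm_apply]
    exact hi
  have hscat : ∀ {α : Type} (old : ℕ → α) (addr : ℕ → ℕ), (∀ i < tot, addr i = π.symm i) →
      scatter tot (fun i => (1 : IExp).eval τ i ≠ 0) addr old old = fun j => old (π j) := by
    intro α old addr ha
    funext j
    by_cases hj : j < tot
    · have h1 := (hlt j).2 hj
      have h2 : addr (π j) = j := by rw [ha _ h1, Equiv.symm_apply_apply]
      conv_lhs => rw [← h2]
      refine scatter_inj h1 one_ne_zero fun i' hi' _ he => ?_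
      rw [ha i' hi', h2, Equiv.symm_apply_eq] at he
      exact he
    · rw [hπo j (by omega)]
      refine scatter_of_not fun i hi _ he => ?_
      rw [ha i hi] at he
      have := hsl i hi
      omega
  refine Run.seq 40 60 ?_
  refine Run.mapI (by simpa [e6] using hX) hX1 ?_ (by decide) ?_
  · intro i hi
    rw [eval_reg, e6] at hi
    rw [hpos' i hi]
    have := hsl i hi
    omega
  simp only [eval_reg, e6]
  refine Run.seq 20 40 ?_
  refine Run.parI (by simpa [e6] using hX) hX1 ?_ (by decide) ?_
  · intro i hi _
    simp only [eval_reg, setI_int, Nat.reduceEqDiff, if_false, e6] at hi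
    simp only [eval_read, eval_idx, setI_int, if_true, hi, hpos' i hi, Nat.reduceEqDiff, if_false]
    have := hsl i hi
    rw [hf.int 11 (by decide)]
    exact ⟨by omega, hw i⟩
  refine Run.seq 20 20 ?_
  refine Run.parR (by simpa [e6] using hX) hX1 ?_ (by decide) ?_
  · intro i hi _
    simp only [eval_reg, setI_int, Nat.reduceEqDiff, if_false, e6] at hi
    simp only [eval_read, eval_idx, setI_int, if_true, hi, hpos' i hi, Nat.reduceEqDiff, if_false]
    have := hsl i hi
    omega
  refine Run.setReg hX1 ?_ (by decide) ?_
  · simp only [eval_reg, setI_int, setR_int, Nat.reduceEqDiff, if_false, eval_mul, eval_two, e8]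
    omega
  have hb : ∀ j, buf (((((τ.setI 10 fun j => if j < tot then IExp.eval τ j
      (.idx / (2 * reg 8) * (2 * reg 8) + .idx % reg 8 + .read 10 .idx) else τ.int 10 j).setI 11
      fun j => τ.int 11 (π j)).setR 2 fun j => τ.real 2 (π j)).setI 8
      fun j => if j = 0 then 2 ^ (l + 1) else τ.int 8 j)) j = buf σ (π j) := by
    intro j
    simp only [buf, setI_int, setI_real, setR_int, setR_real, Nat.reduceEqDiff, if_false, if_true,
      hf.int 11 (by decide), hf.real 2 (by decide)]
  have hfin : ∀ σ', σ' = ((((τ.setI 10 fun j => if j < tot then IExp.eval τ j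
      (.idx / (2 * reg 8) * (2 * reg 8) + .idx % reg 8 + .read 10 .idx) else τ.int 10 j).setI 11
      fun j => τ.int 11 (π j)).setR 2 fun j => τ.real 2 (π j)).setI 8
      fun j => if j = 0 then 2 ^ (l + 1) else τ.int 8 j) → 
      σ'.int 8 0 = 2 ^ (l + 1) ∧ SortedBuf (2 ^ (l + 1)) tot σ σ' ∧
      Frame [8, 9, 10, 11] [2] σ σ' := by
    rintro σ' rfl
    refine ⟨by simp, ⟨π, ?_, hb, ?_⟩, (hf.mono).setI.setI.setR.setI⟩
    · intro i
      rw [pow_succ, mul_comm]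
      exact hπb i
    · intro i j hij hj hbl
      rw [hb, hb]
      rw [pow_succ, mul_comm] at hbl
      have := hπs i j hij hj hbl
      simp only [hkey, if_pos ((hlt j).2 hj), if_pos ((hlt i).2 (by omega : i < tot))] at this
      exact this
  apply hfin
  congr 1
  · congr 1
    · congr 1
      simp only [eval_reg, setI_int, Nat.reduceEqDiff, if_false, if_true, e6, eval_read, eval_idx]
      exact hscat (τ.int 11) _ fun i hi => by rw [if_pos hi, hpos' i hi]
    · simp only [eval_reg, setI_int, setI_real, Nat.reduceEqDiff, if_false, if_true, e6, eval_read,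
        eval_idx, evalR_read]
      exact hscat (τ.real 2) _ fun i hi => by rw [if_pos hi, hpos' i hi]
  · funext j
    simp only [eval_reg, setI_int, setR_int, Nat.reduceEqDiff, if_false, eval_mul, eval_two, e8,
      pow_succ]

/-- Bottom-up merge sort: `l` rounds, each with a binary search of depth linear in `l`. The
permutations of the rounds compose because the blocks are nested. -/
theorem sort_run {σ : Mem} {q l : ℕ} (h7 : σ.int 7 0 = 2 ^ l) (h6 : σ.int 6 0 = q * 2 ^ l)
    (hX : q * 2 ^ l ≤ X) (hX1 : 1 ≤ X) (hB : 2 ^ l < B) (hXB : X ≤ B)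
    (hw : ∀ i, σ.int 11 i < B) :
    Run B X sort σ ((l + 1) * ((l + 1) * 400)) fun σ' =>
      SortedBuf (2 ^ l) (q * 2 ^ l) σ σ' ∧ Frame [8, 9, 10, 11] [2] σ σ' := by
  have h1B : 1 < B := lt_of_le_of_lt (Nat.one_le_two_pow) hB
  have hge : 10 ≤ (l + 1) * ((l + 1) * 400) :=
    le_trans (by omega) (Nat.le_mul_of_pos_left ((l + 1) * 400) (by omega))
  refine Run.seq 10 ((l + 1) * ((l + 1) * 400) - 10) ?_ (by omega)
  refine Run.setReg hX1 (by simpa using h1B) (by decide) ?_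
  refine Run.loop l ((l + 1) * 200 + 130) (fun m τ => τ.int 8 0 = 2 ^ m ∧
    SortedBuf (2 ^ m) (q * 2 ^ l) σ τ ∧ Frame [8, 9, 10, 11] [2] σ τ) hX1 ?_ ?_ ?_ ?_ ?_ ?_
  · refine ⟨by simp, ⟨Equiv.refl _, fun _ => rfl, ?_, ?_⟩, (Frame.refl _).setI⟩
    · intro i
      simp [buf]
    · intro i j _ _ hij
      simp only [pow_zero, Nat.div_one] at hij
      rw [hij]
  · rintro m hm τ ⟨h8, -, hf⟩
    have : 2 ^ m < 2 ^ l := Nat.pow_lt_pow_right (by norm_num) hm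
    simp only [eval_le, eval_add, eval_reg, h8, eval_one, hf.int 7 (by decide), h7]
    rw [if_pos (by omega)]
    exact one_ne_zero
  · rintro m hm τ ⟨h8, ⟨π, p1, p2, p3⟩, hf⟩
    have hpw : 2 ^ l = 2 ^ (l - (m + 1)) * (2 * 2 ^ m) := by
      rw [← pow_succ', ← pow_add]
      congr 1
      omega
    have hq : q * 2 ^ l = q * 2 ^ (l - (m + 1)) * (2 * 2 ^ m) := by rw [hpw, mul_assoc]
    have hle : 2 * 2 ^ m ≤ 2 ^ l := by
      rw [← pow_succ']
      exact Nat.pow_le_pow_right (by norm_num) hm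
    rw [hq] at p3
    refine (merge_run (B := B) h8 (by rw [hf.int 6 (by decide), h6, hq]) (hq ▸ hX) hX1 (by omega) hXB ?_
      p3).mono ?_ ?_
    · intro i
      have := congrArg Prod.fst (p2 i)
      simp only [buf] at this
      rw [this]
      exact hw _
    · have : (m + 1) * 200 ≤ (l + 1) * 200 := by omega
      omega
    · rintro τ' ⟨k1, ⟨π', k2, k3, k4⟩, k5⟩
      rw [← hq] at k4
      refine ⟨k1, ⟨π'.trans π, ?_, ?_, k4⟩, hf.trans k5⟩
      · intro i
        simp only [Equiv.trans_apply]
        rw [pow_succ, ← Nat.div_div_eq_div_mul, p1, Nat.div_div_eq_div_mul, ← pow_succ, k2]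
      · intro i
        rw [k3, p2, Equiv.trans_apply]
  · rintro τ ⟨h8, -, hf⟩
    simp only [eval_le, eval_add, eval_reg, h8, eval_one, hf.int 7 (by decide), h7]
    rw [if_neg (by omega)]
  · rintro τ ⟨-, h1, h2⟩
    exact ⟨h1, h2⟩
  · have hc : ((reg 8 + 1).le (reg 7)).cost = 7 := rfl
    rw [hc]
    have : l * (7 + ((l + 1) * 200 + 130)) + 7 = l * l * 200 + l * 337 + 7 := by ring
    have : (l + 1) * ((l + 1) * 400) = l * l * 400 + l * 800 + 400 := by ring
    omega

end PRAM

namespace PRAM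

/-! ## The best entries of each segment -/

/-- Empty cells have key `⊤`, so nothing empty stands before a nonempty cell in sorted order. -/
theorem entKey_le {p p' : ℕ × ℝ} (h : entKey p ≤ entKey p') (h' : p'.1 ≠ 0) :
    p.1 ≠ 0 ∧ p.2 ≤ p'.2 := by
  unfold entKey at h
  rw [if_neg h'] at h
  split_ifs at h with h0
  · simp at h
  · exact ⟨h0, by exact_mod_cast h⟩

/-- `L` lists `K` entries of `In` with distinct nonzero words (or fewer, if there are fewer), each
with the least value of its word, and no other word has a smaller value than those of a
full list. -/
structure IsTopK (K : ℕ) (In : Set (ℕ × ℝ)) (L : ℕ → ℕ × ℝ) : Prop where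
  mem : ∀ k < K, (L k).1 ≠ 0 → L k ∈ In
  inj : ∀ k < K, ∀ k' < K, (L k).1 ≠ 0 → (L k).1 = (L k').1 → k = k'
  dom : ∀ p ∈ In, p.1 ≠ 0 → (∃ k < K, (L k).1 = p.1 ∧ (L k).2 ≤ p.2) ∨
    ∀ k < K, (L k).1 ≠ 0 ∧ (L k).2 ≤ p.2

theorem IsTopK.congr {K : ℕ} {In : Set (ℕ × ℝ)} {L L' : ℕ → ℕ × ℝ} (h : IsTopK K In L)
    (hL : ∀ k < K, L' k = L k) : IsTopK K In L' := by
  refine ⟨fun k hk => ?_, fun k hk k' hk' => ?_, fun p hp h0 => (h.dom p hp h0).imp ?_ ?_⟩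
  · rw [hL k hk]
    exact h.mem k hk
  · rw [hL k hk, hL k' hk']
    exact h.inj k hk k' hk'
  · rintro ⟨k, hk, e⟩
    exact ⟨k, hk, by rw [hL k hk]; exact e⟩
  · intro e k hk
    rw [hL k hk]
    exact e k hk

/-- The entries of the segment `s` of length `m`. -/
def segSet (f : ℕ → ℕ × ℝ) (m s : ℕ) : Set (ℕ × ℝ) := {p | ∃ r < m, f (s * m + r) = p}

theorem seg_div {m r : ℕ} (s : ℕ) (hr : r < m) : (s * m + r) / m = s := by
  rw [Nat.mul_comm, Nat.mul_add_div (by omega), Nat.div_eq_of_lt hr, add_zero]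

theorem seg_mod {m r : ℕ} (s : ℕ) (hr : r < m) : (s * m + r) % m = r :=
  Nat.mul_add_mod_of_lt hr

theorem seg_lt {m r s q : ℕ} (hs : s < q) (hr : r < m) : s * m + r < q * m :=
  calc s * m + r < s * m + m := by omega
    _ = (s + 1) * m := by ring
    _ ≤ q * m := Nat.mul_le_mul_right _ hs

theorem seg_inj {m r r' s s' : ℕ} (hr : r < m) (hr' : r' < m) (h : s * m + r = s' * m + r') :
    s = s' ∧ r = r' :=
  ⟨by rw [← seg_div s hr, h, seg_div s' hr'], by rw [← seg_mod s hr, h, seg_mod s' hr']⟩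

/-- The cell of the table for the word of the own cell in its segment. -/
def tabCell : IExp := .idx / reg 7 * reg 4 + (.read 11 .idx - 1)

/-- Replace each segment of the buffer by its best entries, in the sense of `IsTopK`. -/
def topk : Prog :=
  sort ;;
  .parI (reg 6) (.read 11 .idx) 12 tabCell .idx ;;
  mapI (reg 6) 11 (.ite (.read 12 tabCell - .idx + (.idx - .read 12 tabCell)) 0 (.read 11 .idx)) ;;
  sort

-- Removing repeated words and selecting the best entries.

/-- Of the cells with equal words in a segment of the buffer, only the first one is left. -/
structure Dedup (m tot : ℕ) (σ σ' : Mem) : Prop where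
  eq : ∀ i < tot, σ'.int 11 i ≠ 0 → buf σ' i = buf σ i
  inj : ∀ i < tot, ∀ j < tot, i / m = j / m → σ'.int 11 i ≠ 0 → σ'.int 11 i = σ'.int 11 j → i = j
  ex : ∀ i < tot, σ.int 11 i ≠ 0 → ∃ j ≤ i, j / m = i / m ∧ σ'.int 11 j = σ.int 11 i

variable {B X : ℕ}

/-- Every nonempty cell writes its number into a table cell encoding its segment and word. The least
number wins, so precisely the first cell of each word reads itself back. The table need not be
cleared: a cell consulted for a nonempty word has just been written, and for an empty word both
outcomes leave `0`. -/
theorem dedup_run {σ : Mem} {q m N D : ℕ} {P : Prog} {Q : Mem → Prop} (hm : 0 < m)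
    (h7 : σ.int 7 0 = m) (h6 : σ.int 6 0 = q * m)
    (h4 : σ.int 4 0 = N) (hX : q * m ≤ X) (hX1 : 1 ≤ X) (hXB : X ≤ B) (hN : N < B)
    (hq : q * N ≤ B) (hw : ∀ i, σ.int 11 i ≤ N)
    (hP : ∀ τ, Dedup m (q * m) σ τ → Frame [11, 12] [] σ τ → (∀ i, τ.int 11 i ≤ N) →
      Run B X P τ D Q) :
    Run B X (.parI (reg 6) (.read 11 .idx) 12 tabCell .idx ;;
      mapI (reg 6) 11 (.ite (.read 12 tabCell - .idx + (.idx - .read 12 tabCell)) 0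
        (.read 11 .idx)) ;; P) σ (D + 100) Q := by
  classical
  set F : ℕ → ℕ := fun i => i / m * N + (σ.int 11 i - 1) with hF
  have hcell : ∀ i, tabCell.eval σ i = F i := by
    intro i
    simp [tabCell, h7, h4, hF]
  have hFi : ∀ i j, σ.int 11 i ≠ 0 → σ.int 11 j ≠ 0 → F i = F j →
      i / m = j / m ∧ σ.int 11 i = σ.int 11 j := by
    intro i j hi hj h
    have h1 := hw i
    have h2 := hw j
    obtain ⟨e1, e2⟩ := seg_inj (by omega) (by omega) h
    exact ⟨e1, by omega⟩
  set T : ℕ → ℕ := scatter (q * m) (fun i => σ.int 11 i ≠ 0) F (fun i => i) (σ.int 12) with hT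
  have hT1 : ∀ i < q * m, σ.int 11 i ≠ 0 → T (F i) ≤ i ∧ T (F i) / m = i / m ∧
      σ.int 11 (T (F i)) = σ.int 11 i := by
    intro i hi h0
    have hex : ∃ j, j < q * m ∧ σ.int 11 j ≠ 0 ∧ F j = F i := ⟨i, hi, h0, rfl⟩
    have hval : T (F i) = Nat.find hex := by
      simp only [hT, scatter]
      rw [dif_pos hex]
      congr
    obtain ⟨s1, s2, s3⟩ := Nat.find_spec hex
    rw [hval]
    obtain ⟨e1, e2⟩ := hFi _ _ s2 h0 s3
    exact ⟨Nat.find_le ⟨hi, h0, rfl⟩, e1, e2⟩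
  refine Run.seq 50 (D + 50) ?_
  refine Run.parI (by simpa [h6] using hX) hX1 ?_ (by decide) ?_
  · intro i hi h0
    simp only [eval_reg, h6] at hi
    simp only [eval_read, eval_idx] at h0
    rw [hcell]
    refine ⟨?_, by rw [eval_idx]; omega⟩
    have h1 := hw i
    exact (seg_lt ((Nat.div_lt_iff_lt_mul hm).2 hi) (by omega)).trans_le hq
  have hsc : scatter ((reg 6).eval σ 0) (fun i => (IExp.read 11 .idx).eval σ i ≠ 0)
      (fun i => tabCell.eval σ i) (fun i => IExp.idx.eval σ i) (σ.int 12) = T := by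
    simp only [hcell, eval_reg, h6, eval_read, eval_idx, hT]
  rw [hsc]
  have hcell2 : ∀ i, tabCell.eval (σ.setI 12 T) i = F i := by
    intro i
    simp [tabCell, h7, h4, hF]
  have hval : ∀ i < q * m, IExp.eval (σ.setI 12 T) i
      (.ite (.read 12 tabCell - .idx + (.idx - .read 12 tabCell)) 0 (.read 11 .idx)) =
      if T (F i) = i then σ.int 11 i else 0 := by
    intro i hi
    simp only [eval_ite, eval_add, eval_sub, eval_read, hcell2, eval_idx, setI_int, if_true,
      eval_zero, Nat.reduceEqDiff, if_false]
    -- With truncated subtraction, the sum of the two differences vanishes exactly if the numbers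
    -- agree.
    by_cases h : T (F i) = i
    · simp [h]
    · rw [if_neg (by omega), if_neg h]
  refine Run.seq 50 D ?_
  refine Run.mapI (by simpa [h6] using hX) hX1 ?_ (by decide) ?_
  · intro i hi
    simp only [eval_reg, setI_int, Nat.reduceEqDiff, if_false, h6] at hi
    rw [hval i hi]
    have := hw i
    exact ⟨by omega, by split_ifs <;> omega⟩
  set τ := (σ.setI 12 T).setI 11 fun j =>
    if j < (reg 6).eval (σ.setI 12 T) 0 then IExp.eval (σ.setI 12 T) j
      (.ite (.read 12 tabCell - .idx + (.idx - .read 12 tabCell)) 0 (.read 11 .idx))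
    else (σ.setI 12 T).int 11 j with hτ
  have h11 : ∀ i, τ.int 11 i = if i < q * m then (if T (F i) = i then σ.int 11 i else 0)
      else σ.int 11 i := by
    intro i
    simp only [hτ, setI_int, if_true, eval_reg, Nat.reduceEqDiff, if_false, h6]
    by_cases hi : i < q * m
    · rw [if_pos hi, if_pos hi, hval i hi]
    · rw [if_neg hi, if_neg hi]
  refine hP τ ⟨?_, ?_, ?_⟩ (Frame.refl _).setI.setI ?_
  · intro i hi h0
    rw [h11, if_pos hi] at h0
    have h1 : T (F i) = i := by
      by_contra h
      exact h0 (if_neg h)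
    simp only [buf, h11, if_pos hi, if_pos h1]
    rfl
  · intro i hi j hj hb h0 he
    rw [h11, if_pos hi] at h0
    have h1 : T (F i) = i := by
      by_contra h
      exact h0 (if_neg h)
    rw [h11 i, h11 j, if_pos hi, if_pos hj, if_pos h1] at he
    rw [if_pos h1] at h0
    have h2 : T (F j) = j := by
      by_contra h
      rw [if_neg h] at he
      exact h0 he
    rw [if_pos h2] at he
    rw [← h1, ← h2]
    simp only [hF, hb, he]
  · intro i hi h0
    obtain ⟨e1, e2, e3⟩ := hT1 i hi h0
    refine ⟨T (F i), e1, e2, ?_⟩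
    have h2 : F (T (F i)) = F i := by
      change T (F i) / m * N + (σ.int 11 (T (F i)) - 1) = _
      rw [e2, e3]
    rw [h11, if_pos (by omega), h2, if_pos rfl, e3]
  · intro i
    rw [h11]
    have := hw i
    split_ifs <;> omega

/-- After the first sort the first cell of a word has its least value, and it is the one that
survives. The second sort moves the survivors to the front in order of value. A survivor that misses
the first `K` cells is preceded by `K` nonempty cells of no larger value, which is the second
alternative of `dom`. -/
theorem isTopK_of_sorted {σ τ₁ τ₂ σ' : Mem} {m q : ℕ} (h1 : SortedBuf m (q * m) σ τ₁)
    (h2 : Dedup m (q * m) τ₁ τ₂) (h3 : SortedBuf m (q * m) τ₂ σ') {s K : ℕ} (hs : s < q)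
    (hK : K ≤ m) :
    IsTopK K (segSet (buf σ) m s) fun k => buf σ' (s * m + k) := by
  obtain ⟨π, a1, a2, a3⟩ := h1
  obtain ⟨ρ, b1, b2, b3⟩ := h3
  have hm0 : ∀ i, i / m = s → s * m + i % m = i := by
    intro i hi
    have := Nat.div_add_mod i m
    rw [hi, mul_comm] at this
    exact this
  have hb : ∀ i, buf σ' i = buf τ₂ (ρ i) := b2
  have hlt : ∀ k < m, ∀ π : Equiv.Perm ℕ, (∀ i, π i / m = i / m) →
      π (s * m + k) < q * m ∧ π (s * m + k) / m = s := by
    intro k hk π hπ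
    have h := hπ (s * m + k)
    rw [seg_div s hk] at h
    refine ⟨?_, h⟩
    rw [← Nat.div_lt_iff_lt_mul (by omega), h]
    exact hs
  refine ⟨?_, ?_, ?_⟩
  · intro k hk h0
    simp only [hb] at h0 ⊢
    obtain ⟨l1, l2⟩ := hlt k (by omega) ρ b1
    rw [h2.eq _ l1 h0, a2]
    refine ⟨π (ρ (s * m + k)) % m, Nat.mod_lt _ (by omega), ?_⟩
    rw [hm0]
    rw [a1, l2]
  · intro k hk k' hk' h0 he
    simp only [hb] at h0 he
    obtain ⟨l1, l2⟩ := hlt k (by omega) ρ b1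
    obtain ⟨l1', l2'⟩ := hlt k' (by omega) ρ b1
    have := ρ.injective (h2.inj _ l1 _ l1' (l2.trans l2'.symm) h0 he)
    omega
  · rintro p ⟨r, hr, rfl⟩ h0
    have hπs : ∀ i, π.symm i / m = i / m := fun i => by rw [← a1, Equiv.apply_symm_apply]
    have hρs : ∀ i, ρ.symm i / m = i / m := fun i => by rw [← b1, Equiv.apply_symm_apply]
    obtain ⟨l1, l2⟩ := hlt r hr π.symm hπs
    set i₁ := π.symm (s * m + r) with hi₁
    have e1 : buf τ₁ i₁ = buf σ (s * m + r) := by rw [a2, hi₁, Equiv.apply_symm_apply]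
    have hz : τ₁.int 11 i₁ = (buf σ (s * m + r)).1 := congrArg Prod.fst e1
    obtain ⟨j, hj, hjs, hjw⟩ := h2.ex i₁ l1 (by rw [hz]; exact h0)
    have hjlt : j < q * m := by omega
    have ej := h2.eq j hjlt (by rw [hjw, hz]; exact h0)
    have hle : (buf τ₂ j).2 ≤ (buf σ (s * m + r)).2 := by
      have := a3 j i₁ hj l1 hjs
      rw [← ej, e1] at this
      exact (entKey_le this h0).2
    have hjw' : (buf τ₂ j).1 = (buf σ (s * m + r)).1 := by
      change τ₂.int 11 j = _
      rw [hjw, hz]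
    set i₂ := ρ.symm j with hi₂
    have e2 : buf σ' i₂ = buf τ₂ j := by rw [hb, hi₂, Equiv.apply_symm_apply]
    have hi₂s : i₂ / m = s := by rw [hi₂, hρs, hjs, l2]
    have hi₂m := hm0 i₂ hi₂s
    have hi₂lt : i₂ < q * m := by
      rw [← Nat.div_lt_iff_lt_mul (by omega), hi₂s]
      exact hs
    by_cases hk : i₂ % m < K
    · left
      refine ⟨i₂ % m, hk, ?_⟩
      simp only [hi₂m, e2]
      exact ⟨hjw', hle⟩
    · right
      intro k hk'
      have := b3 (s * m + k) i₂ (by omega) hi₂lt (by rw [seg_div s (by omega), hi₂s])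
      rw [e2] at this
      obtain ⟨t1, t2⟩ := entKey_le this (by rw [hjw']; exact h0)
      exact ⟨t1, t2.trans hle⟩

theorem topk_run {σ : Mem} {q l N : ℕ} (h7 : σ.int 7 0 = 2 ^ l) (h6 : σ.int 6 0 = q * 2 ^ l)
    (h4 : σ.int 4 0 = N) (hX : q * 2 ^ l ≤ X) (hX1 : 1 ≤ X) (hB : 2 ^ l < B) (hXB : X ≤ B)
    (hN : N < B) (hq : q * N ≤ B) (hw : ∀ i, σ.int 11 i ≤ N) :
    Run B X topk σ ((l + 1) * ((l + 1) * 900)) fun σ' =>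
      (∀ s < q, ∀ K ≤ 2 ^ l, IsTopK K (segSet (buf σ) (2 ^ l) s) fun k => buf σ' (s * 2 ^ l + k)) ∧
      (∀ i, σ'.int 11 i ≤ N) ∧ Frame [8, 9, 10, 11, 12] [2] σ σ' := by
  have hwB : ∀ {τ τ' : Mem}, SortedBuf (2 ^ l) (q * 2 ^ l) τ τ' → (∀ i, τ.int 11 i ≤ N) →
      ∀ i, τ'.int 11 i ≤ N := by
    rintro τ τ' ⟨π, -, h, -⟩ hb i
    have := congrArg Prod.fst (h i)
    simp only [buf] at this
    rw [this]
    exact hb _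
  have hge : 100 ≤ (l + 1) * ((l + 1) * 100) :=
    le_trans (by omega) (Nat.le_mul_of_pos_left ((l + 1) * 100) (by omega))
  have hsum : (l + 1) * ((l + 1) * 900) = (l + 1) * ((l + 1) * 400) + (l + 1) * ((l + 1) * 400) +
    (l + 1) * ((l + 1) * 100) := by ring
  refine Run.seq ((l + 1) * ((l + 1) * 400)) ((l + 1) * ((l + 1) * 400) + 100) ?_
  refine (sort_run h7 h6 hX hX1 hB hXB fun i => (hw i).trans_lt hN).mono le_rfl ?_
  rintro τ₁ ⟨s1, f1⟩
  refine dedup_run (m := 2 ^ l) (by positivity) (by rw [f1.int 7 (by decide), h7])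
    (by rw [f1.int 6 (by decide), h6]) (by rw [f1.int 4 (by decide), h4]) hX hX1 hXB hN hq
    (hwB s1 hw) ?_
  intro τ₂ d2 f2 w2
  have f12 : Frame [8, 9, 10, 11, 12] [2] σ τ₂ := Frame.comp f1.mono f2.mono
  refine (sort_run (by rw [f12.int 7 (by decide), h7]) (by rw [f12.int 6 (by decide), h6])
    hX hX1 hB hXB fun i => (w2 i).trans_lt hN).mono le_rfl ?_
  rintro σ' ⟨s3, f3⟩
  exact ⟨fun s hs K hK => isTopK_of_sorted s1 d2 s3 hs hK, hwB s3 w2, f12.comp f3.mono⟩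

end PRAM

namespace PRAM

/-! ## Tournament trees of out-neighbours

Register `4` holds the size `2 ^ ν` of the vertex set, and register `5` the length `2 ^ κ` of the
lists. The arrays `14` and `3` hold, for every vertex `v`, a binary tree whose nodes are numbered
`1, ..., 2 ^ (ν + 1) - 1` in heap order and have one list each. The leaf `2 ^ ν + x` is for the
edge from `v` to `x`, with adjacency in the word array `15` and weight in the real array `4`;
it is empty if `x` is marked in the word array `3`. -/

/-- The size bounds under which the program runs. -/
structure Bounds (B X ν κ : ℕ) : Prop where
  le : κ ≤ ν
  width : 2 * (2 ^ ν * (2 ^ κ * 2 ^ κ)) ≤ X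
  width_le : X ≤ B
  word : 8 * (2 ^ ν * 2 ^ ν * (2 ^ κ * 2 ^ κ)) ≤ B

variable {B X ν κ : ℕ}

theorem Bounds.width_pos (b : Bounds B X ν κ) : 1 ≤ X := by
  have := b.width
  have : 0 < 2 ^ ν * (2 ^ κ * 2 ^ κ) := by positivity
  omega

theorem Bounds.lt_word (b : Bounds B X ν κ) {a c : ℕ} (ha : a ≤ 2 ^ ν * 2 ^ ν)
    (hc : c ≤ 2 ^ κ * 2 ^ κ) : 4 * (a * c) < B := by
  have := b.word
  have h1 : a * c ≤ 2 ^ ν * 2 ^ ν * (2 ^ κ * 2 ^ κ) := Nat.mul_le_mul ha hc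
  have : 0 < 2 ^ ν * 2 ^ ν * (2 ^ κ * 2 ^ κ) := by positivity
  omega

theorem le_sq_pow (n : ℕ) : 2 ^ n ≤ 2 ^ n * 2 ^ n := Nat.le_mul_of_pos_left _ (by positivity)

theorem one_le_sq_pow (n : ℕ) : 1 ≤ 2 ^ n * 2 ^ n := Nat.mul_pos (by positivity) (by positivity)

theorem Bounds.four_lt (b : Bounds B X ν κ) : 4 * 2 ^ ν < B := by
  have := b.lt_word (le_sq_pow ν) (one_le_sq_pow κ)
  omega

theorem Bounds.pow_le (b : Bounds B X ν κ) : 2 ^ κ ≤ 2 ^ ν := Nat.pow_le_pow_right (by norm_num) b.le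

/-- The segments in use have lengths `2 ^ (κ + 1)`, `2 ^ (2 * κ)` and `2 ^ (ν + κ)`; the hypothesis
on `l` covers them all, so one depth bound serves every selection. -/
theorem topk_run_le (b : Bounds B X ν κ) {σ : Mem} {q l : ℕ} (h7 : σ.int 7 0 = 2 ^ l)
    (h6 : σ.int 6 0 = q * 2 ^ l) (h4 : σ.int 4 0 = 2 ^ ν) (hX : q * 2 ^ l ≤ X)
    (hl : l ≤ 2 * ν + 1) (hq : q ≤ 2 ^ ν * 2 ^ κ) (hlB : 2 ^ l < B)
    (hw : ∀ i, σ.int 11 i ≤ 2 ^ ν) :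
    Run B X topk σ (3600 * ((ν + 1) * (ν + 1))) fun σ' =>
      (∀ s < q, ∀ K ≤ 2 ^ l, IsTopK K (segSet (buf σ) (2 ^ l) s) fun k => buf σ' (s * 2 ^ l + k)) ∧
      (∀ i, σ'.int 11 i ≤ 2 ^ ν) ∧ Frame [8, 9, 10, 11, 12] [2] σ σ' := by
  have h1 := b.lt_word le_rfl (le_sq_pow κ)
  have h2 : q * 2 ^ ν ≤ 2 ^ ν * 2 ^ ν * 2 ^ κ := by
    calc q * 2 ^ ν ≤ 2 ^ ν * 2 ^ κ * 2 ^ ν := Nat.mul_le_mul_right _ hq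
      _ = _ := by ring
  refine (topk_run h7 h6 h4 hX b.width_pos hlB b.width_le ?_ (by omega) hw).mono ?_ fun _ h => h
  · have := b.four_lt
    omega
  · calc (l + 1) * ((l + 1) * 900) ≤ (2 * (ν + 1)) * ((2 * (ν + 1)) * 900) := by
          gcongr <;> omega
      _ = 3600 * ((ν + 1) * (ν + 1)) := by ring

/-- The cells of the lists of the trees. -/
def tree (σ : Mem) (a : ℕ) : ℕ × ℝ := (σ.int 14 a, σ.real 3 a)

/-- The list of the node `h` of the tree of `v`. -/
def node (ν κ : ℕ) (σ : Mem) (v h : ℕ) (k : ℕ) : ℕ × ℝ :=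
  tree σ ((v * (2 * 2 ^ ν) + h) * 2 ^ κ + k)

/-- The entries of the children of the node `h` of the tree of `v`. -/
def kids (ν κ : ℕ) (σ : Mem) (v h : ℕ) : Set (ℕ × ℝ) :=
  {p | ∃ r < 2 ^ (κ + 1), tree σ ((v * (2 * 2 ^ ν) + 2 * h) * 2 ^ κ + r) = p}

/-- In heap order the lists of `2 * h` and `2 * h + 1` are adjacent, so that the entries of both
children form one segment of length `2 ^ (κ + 1)`. -/
theorem mem_kids {σ : Mem} {v h : ℕ} {p : ℕ × ℝ} :
    p ∈ kids ν κ σ v h ↔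
      ∃ k < 2 ^ κ, node ν κ σ v (2 * h) k = p ∨ node ν κ σ v (2 * h + 1) k = p := by
  have h2 : 2 ^ (κ + 1) = 2 ^ κ + 2 ^ κ := by rw [pow_succ]; ring
  have h3 : ∀ k, (v * (2 * 2 ^ ν) + (2 * h + 1)) * 2 ^ κ + k =
      (v * (2 * 2 ^ ν) + 2 * h) * 2 ^ κ + (2 ^ κ + k) := fun k => by ring
  simp only [kids, node, Set.mem_ofPred_eq, h2, h3]
  constructor
  · rintro ⟨r, hr, rfl⟩
    by_cases hr' : r < 2 ^ κ
    · exact ⟨r, hr', .inl rfl⟩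
    · refine ⟨r - 2 ^ κ, by omega, .inr ?_⟩
      rw [Nat.add_sub_cancel' (by omega)]
  · rintro ⟨k, hk, h | h⟩
    · exact ⟨k, by omega, h⟩
    · exact ⟨2 ^ κ + k, by omega, h⟩

/-- The ancestor of the leaf of `T[seg % K]` on the level given by register `17`. -/
def anc (seg : IExp) : IExp := (reg 4 + .read 13 (seg % reg 5)) / reg 17

/-- The cell of the children's lists for the own cell of the buffer. -/
def loadCell : IExp :=
  (.idx / reg 7 / reg 5 * (2 * reg 4) + 2 * anc (.idx / reg 7)) * reg 5 + .idx % reg 7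

/-- The cell of the ancestor's list for the processor. -/
def storeCell : IExp :=
  (.idx / reg 5 / reg 5 * (2 * reg 4) + anc (.idx / reg 5)) * reg 5 + .idx % reg 5

/-- The cell of the buffer that is stored by the processor. -/
def storeSrc : IExp := .idx / reg 5 * reg 7 + .idx % reg 5

/-- Recompute the lists of the ancestors on one level. -/
def levelUp : Prog :=
  mapI (reg 6) 11 (.read 14 loadCell) ;;
  mapR (reg 6) 2 (.read 3 loadCell) ;;
  topk ;;
  .parI (reg 4 * reg 5 * reg 5) 1 14 storeCell (.read 11 storeSrc) ;;
  .parR (reg 4 * reg 5 * reg 5) 1 3 storeCell (.read 2 storeSrc) ;;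
  setReg 17 (reg 17 * 2)

/-- The memory is set up for the lists of length `2 ^ κ` on `2 ^ ν` vertices. -/
structure Setup (ν κ : ℕ) (σ : Mem) : Prop where
  size : σ.int 4 0 = 2 ^ ν
  len : σ.int 5 0 = 2 ^ κ
  buf_le : ∀ i, σ.int 11 i ≤ 2 ^ ν
  tree_le : ∀ i, σ.int 14 i ≤ 2 ^ ν
  targets : ∀ i, σ.int 13 i < 2 ^ ν

/-- The segment `v * 2 ^ κ + j` recomputes the ancestor of the target `j` in the tree of `v`. The
children are those of the memory `σ` before the step, since all reading precedes the stores; that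
they are still the same afterwards is for `update_run` to show. -/
theorem levelUp_run (b : Bounds B X ν κ) {σ : Mem} (hσ : Setup ν κ σ) {dv : ℕ}
    (h17 : σ.int 17 0 = dv) (hdv : 0 < dv) (hdvB : dv ≤ 2 ^ ν)
    (h7 : σ.int 7 0 = 2 ^ (κ + 1)) (h6 : σ.int 6 0 = 2 ^ ν * 2 ^ κ * 2 ^ (κ + 1)) :
    Run B X levelUp σ (3600 * ((ν + 1) * (ν + 1)) + 300) fun σ' =>
      σ'.int 17 0 = dv * 2 ∧ Setup ν κ σ' ∧ Frame [8, 9, 10, 11, 12, 14, 17] [2, 3] σ σ' ∧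
      ∀ v < 2 ^ ν, ∀ h < 2 * 2 ^ ν,
        (IsTopK (2 ^ κ) (kids ν κ σ v h) (node ν κ σ' v h) ∧
          ∃ j < 2 ^ κ, h = (2 ^ ν + σ.int 13 j) / dv) ∨
        ((∀ k < 2 ^ κ, node ν κ σ' v h k = node ν κ σ v h k) ∧
          ∀ j < 2 ^ κ, h ≠ (2 ^ ν + σ.int 13 j) / dv) := by
  obtain ⟨h4, h5, hbuf, htree, hT⟩ := hσ
  have hX1 := b.width_pos
  have hXB := b.width_le
  have hp2 : 2 ^ (κ + 1) = 2 * 2 ^ κ := by rw [pow_succ]; ring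
  have htot : 2 ^ ν * 2 ^ κ * 2 ^ (κ + 1) ≤ X := by
    calc _ = 2 * (2 ^ ν * (2 ^ κ * 2 ^ κ)) := by rw [hp2]; ring
      _ ≤ X := b.width
  have hst : 2 ^ ν * 2 ^ κ * 2 ^ κ ≤ X := by
    refine le_trans ?_ htot
    rw [hp2]
    exact Nat.mul_le_mul_left _ (by omega)
  have h4B := b.four_lt
  have htreeB := b.lt_word le_rfl (le_sq_pow κ)
  have hK : 0 < 2 ^ κ := by positivity
  set A : ℕ → ℕ := fun m => m / 2 ^ κ * (2 * 2 ^ ν) + (2 ^ ν + σ.int 13 (m % 2 ^ κ)) / dv with hA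
  have hanc : ∀ j, (2 ^ ν + σ.int 13 j) / dv < 2 * 2 ^ ν := by
    intro j
    have := hT j
    exact (Nat.div_le_self _ _).trans_lt (by omega)
  have hload : ∀ i, loadCell.eval σ i =
      (i / 2 ^ (κ + 1) / 2 ^ κ * (2 * 2 ^ ν) +
        2 * ((2 ^ ν + σ.int 13 (i / 2 ^ (κ + 1) % 2 ^ κ)) / dv)) * 2 ^ κ + i % 2 ^ (κ + 1) := by
    intro i
    simp [loadCell, anc, h7, h5, h4, h17]
  refine Run.seq 50 (3600 * ((ν + 1) * (ν + 1)) + 250) ?_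
  refine Run.mapI (by simpa [h6] using htot) hX1 ?_ (by decide) ?_
  · intro i hi
    rw [eval_reg, h6] at hi
    rw [eval_read]
    have := htree (loadCell.eval σ i)
    omega
  refine Run.seq 50 (3600 * ((ν + 1) * (ν + 1)) + 200) ?_
  refine Run.mapR (by simpa [h6] using htot) hX1 ?_ (by decide) ?_
  · intro i hi
    simp only [eval_reg, setI_int, Nat.reduceEqDiff, if_false, h6] at hi
    omega
  simp only [eval_reg, h6, eval_read, setI_int, setI_real, evalR_read, Nat.reduceEqDiff, if_false]
  set τ := (σ.setI 11 _).setR 2 _ with hτ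
  have hf : Frame [8, 9, 10, 11, 12] [2] σ τ := (Frame.refl σ).setI.setR
  have hτbuf : ∀ i < 2 ^ ν * 2 ^ κ * 2 ^ (κ + 1), buf τ i = tree σ (loadCell.eval σ i) := by
    intro i hi
    have : ∀ f, loadCell.eval (σ.setI 11 f) i = loadCell.eval σ i := by
      intro f
      simp [loadCell, anc]
    simp only [buf, hτ, setR_int, setI_int, if_true, if_pos hi, setR_real, this, tree]
  have hτw : ∀ i, τ.int 11 i ≤ 2 ^ ν := by
    intro i
    simp only [hτ, setR_int, setI_int, if_true]
    split_ifs
    · exact htree _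
    · exact hbuf _
  refine Run.seq (3600 * ((ν + 1) * (ν + 1))) 200 ?_
  refine (topk_run_le (q := 2 ^ ν * 2 ^ κ) (l := κ + 1) b (by rw [hf.int 7 (by decide), h7])
    (by rw [hf.int 6 (by decide), h6]) (by rw [hf.int 4 (by decide), h4]) htot
    (by have := b.le; omega) le_rfl ?_ hτw).mono le_rfl ?_
  · have := b.pow_le
    omega
  rintro τ₁ ⟨htop, hw₁, hf₁⟩
  have hf1 : Frame [8, 9, 10, 11, 12] [2] σ τ₁ := hf.comp hf₁
  have e4 : τ₁.int 4 0 = 2 ^ ν := by rw [hf1.int 4 (by decide), h4]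
  have e5 : τ₁.int 5 0 = 2 ^ κ := by rw [hf1.int 5 (by decide), h5]
  have e7 : τ₁.int 7 0 = 2 ^ (κ + 1) := by rw [hf1.int 7 (by decide), h7]
  have e17 : τ₁.int 17 0 = dv := by rw [hf1.int 17 (by decide), h17]
  have e13 : τ₁.int 13 = σ.int 13 := hf1.int 13 (by decide)
  have e14 : τ₁.int 14 = σ.int 14 := hf1.int 14 (by decide)
  have er3 : τ₁.real 3 = σ.real 3 := hf1.real 3 (by decide)
  have hstore : ∀ i, storeCell.eval τ₁ i = A (i / 2 ^ κ) * 2 ^ κ + i % 2 ^ κ := by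
    intro i
    simp [storeCell, anc, e5, e4, e17, e13, hA]
  have hstore' : ∀ f i, storeCell.eval (τ₁.setI 14 f) i = A (i / 2 ^ κ) * 2 ^ κ + i % 2 ^ κ := by
    intro f i
    simp [storeCell, anc, e5, e4, e17, e13, hA]
  have hsrc : ∀ i, storeSrc.eval τ₁ i = i / 2 ^ κ * 2 ^ (κ + 1) + i % 2 ^ κ := by
    intro i
    simp [storeSrc, e5, e7]
  have hsrc' : ∀ f i, storeSrc.eval (τ₁.setI 14 f) i = i / 2 ^ κ * 2 ^ (κ + 1) + i % 2 ^ κ := by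
    intro f i
    simp [storeSrc, e5, e7]
  have haddrB : ∀ i < 2 ^ ν * 2 ^ κ * 2 ^ κ, A (i / 2 ^ κ) * 2 ^ κ + i % 2 ^ κ < B := by
    intro i hi
    have h1 : i / 2 ^ κ < 2 ^ ν * 2 ^ κ := (Nat.div_lt_iff_lt_mul hK).2 hi
    have h2 : i / 2 ^ κ / 2 ^ κ < 2 ^ ν := (Nat.div_lt_iff_lt_mul hK).2 h1
    have h3 := seg_lt (seg_lt h2 (hanc (i / 2 ^ κ % 2 ^ κ))) (Nat.mod_lt i hK)
    have h4 : 2 ^ ν * (2 * 2 ^ ν) * 2 ^ κ = 2 * (2 ^ ν * 2 ^ ν * 2 ^ κ) := by ring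
    exact lt_of_lt_of_le h3 (by omega)
  refine Run.seq 80 120 ?_
  refine Run.parI (by simpa [e4, e5] using hst) hX1 ?_ (by decide) ?_
  · intro i hi _
    simp only [eval_mul, eval_reg, e4, e5] at hi
    rw [hstore, eval_read]
    have := hw₁ (storeSrc.eval τ₁ i)
    exact ⟨haddrB i hi, by omega⟩
  simp only [eval_mul, eval_reg, e4, e5, eval_read, hstore, hsrc]
  refine Run.seq 80 40 ?_
  refine Run.parR (by simpa [e4, e5] using hst) hX1 ?_ (by decide) ?_
  · intro i hi _
    simp only [eval_mul, eval_reg, setI_int, Nat.reduceEqDiff, if_false, e4, e5] at hi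
    rw [hstore']
    exact haddrB i hi
  simp only [eval_mul, eval_reg, setI_int, setI_real, Nat.reduceEqDiff, if_false, e4, e5,
    evalR_read, hstore', hsrc']
  refine Run.setReg hX1 ?_ (by decide) ?_
  · simp only [eval_mul, eval_reg, setI_int, setR_int, Nat.reduceEqDiff, if_false, e17, eval_two]
    omega
  set f14 := scatter (2 ^ ν * 2 ^ κ * 2 ^ κ) (fun i => (1 : IExp).eval τ₁ i ≠ 0)
    (fun i => A (i / 2 ^ κ) * 2 ^ κ + i % 2 ^ κ)
    (fun i => τ₁.int 11 (i / 2 ^ κ * 2 ^ (κ + 1) + i % 2 ^ κ)) (τ₁.int 14) with hf14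
  set f3 := scatter (2 ^ ν * 2 ^ κ * 2 ^ κ) (fun i => (1 : IExp).eval (τ₁.setI 14 f14) i ≠ 0)
    (fun i => A (i / 2 ^ κ) * 2 ^ κ + i % 2 ^ κ)
    (fun i => τ₁.real 2 (i / 2 ^ κ * 2 ^ (κ + 1) + i % 2 ^ κ)) (τ₁.real 3) with hf3
  set σ' := ((τ₁.setI 14 f14).setR 3 f3).setI 17 _ with hσ'
  have hσ14 : σ'.int 14 = f14 := by simp [hσ']
  have hσ3 : σ'.real 3 = f3 := by simp [hσ']
  have hf' : Frame [8, 9, 10, 11, 12, 14, 17] [2, 3] σ σ' := (hf1.mono).setI.setR.setI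
  refine ⟨by simp [hσ', e17], ⟨?_, ?_, ?_, ?_, ?_⟩, hf', ?_⟩
  · rw [hf'.int 4 (by decide), h4]
  · rw [hf'.int 5 (by decide), h5]
  · intro i
    simpa [hσ'] using hw₁ i
  · intro i
    rw [hσ14, hf14]
    exact scatter_all (p := fun x => x ≤ 2 ^ ν) (fun _ _ _ => hw₁ _) (fun j => by
      rw [e14]; exact htree j) i
  · rw [hf'.int 13 (by decide)]
    exact hT
  clear_value σ'
  have h14 := fun v h k hk => scatter_block (M := 2 ^ ν * 2 ^ κ) (a := v * (2 * 2 ^ ν) + h) (A := A)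
    (act := fun i => (1 : IExp).eval τ₁ i ≠ 0) (addr := fun i => A (i / 2 ^ κ) * 2 ^ κ + i % 2 ^ κ)
    (val := fun i => τ₁.int 11 (i / 2 ^ κ * 2 ^ (κ + 1) + i % 2 ^ κ)) (old := τ₁.int 14) (k := k) hk
    (fun _ => one_ne_zero) (fun _ => rfl)
  have h3 := fun v h k hk => scatter_block (M := 2 ^ ν * 2 ^ κ) (a := v * (2 * 2 ^ ν) + h) (A := A)
    (act := fun i => (1 : IExp).eval (τ₁.setI 14 f14) i ≠ 0)
    (addr := fun i => A (i / 2 ^ κ) * 2 ^ κ + i % 2 ^ κ)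
    (val := fun i => τ₁.real 2 (i / 2 ^ κ * 2 ^ (κ + 1) + i % 2 ^ κ)) (old := τ₁.real 3) (k := k) hk
    (fun _ => one_ne_zero) (fun _ => rfl)
  rw [← hf14, e14] at h14
  rw [← hf3, er3] at h3
  intro v hv h hh
  have hAa : ∀ m < 2 ^ ν * 2 ^ κ, A m = v * (2 * 2 ^ ν) + h →
      m / 2 ^ κ = v ∧ (2 ^ ν + σ.int 13 (m % 2 ^ κ)) / dv = h := by
    intro m hm he
    exact seg_inj (hanc _) hh he
  by_cases hex : ∃ j < 2 ^ κ, h = (2 ^ ν + σ.int 13 j) / dv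
  · left
    refine ⟨?_, hex⟩
    obtain ⟨j, hj, hjh⟩ := hex
    have hAm : ∃ m, m < 2 ^ ν * 2 ^ κ ∧ A m = v * (2 * 2 ^ ν) + h := by
      refine ⟨v * 2 ^ κ + j, seg_lt hv hj, ?_⟩
      simp only [hA]
      rw [seg_div _ hj, seg_mod _ hj, hjh]
    classical
    -- Several targets can share an ancestor. The first of their blocks wins in the word array and
    -- in the real array alike, so the stored words and values belong together.
    set m := Nat.find hAm with hm
    obtain ⟨m1, m2⟩ := Nat.find_spec hAm
    rw [← hm] at m1 m2
    obtain ⟨m3, m4⟩ := hAa m m1 m2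
    have huniq : ∀ m' < 2 ^ ν * 2 ^ κ, A m' = v * (2 * 2 ^ ν) + h →
        (∀ m'' < m', A m'' ≠ v * (2 * 2 ^ ν) + h) → m' = m := by
      intro m' l1 l2 l3
      rw [hm, eq_comm, Nat.find_eq_iff]
      exact ⟨⟨l1, l2⟩, fun m'' l4 l5 => l3 m'' l4 l5.2⟩
    have hseg : segSet (buf τ) (2 ^ (κ + 1)) m = kids ν κ σ v h := by
      ext p
      simp only [segSet, kids, Set.mem_ofPred_eq]
      refine exists_congr fun r => and_congr_right fun hr => ?_
      rw [hτbuf _ (seg_lt m1 hr), hload, seg_div _ hr, seg_mod _ hr, m3, m4]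
    have htk := htop m m1 (2 ^ κ) (by omega)
    rw [hseg] at htk
    refine htk.congr fun k hk => ?_
    simp only [node, tree, buf, hσ14, hσ3]
    congr 1
    · rcases h14 v h k hk with ⟨m', l1, l2, l3, l4⟩ | ⟨l1, _⟩
      · rw [l4, huniq m' l1 l2 l3, seg_div _ hk, seg_mod _ hk]
      · exact absurd m2 (l1 m m1)
    · rcases h3 v h k hk with ⟨m', l1, l2, l3, l4⟩ | ⟨l1, _⟩
      · rw [l4, huniq m' l1 l2 l3, seg_div _ hk, seg_mod _ hk]
      · exact absurd m2 (l1 m m1)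
  · right
    push Not at hex
    refine ⟨?_, hex⟩
    intro k hk
    have hno : ∀ m < 2 ^ ν * 2 ^ κ, A m ≠ v * (2 * 2 ^ ν) + h := by
      intro m hm he
      exact hex (m % 2 ^ κ) (Nat.mod_lt _ hK) (hAa m hm he).2.symm
    simp only [node, tree, hσ14, hσ3]
    congr 1
    · rcases h14 v h k hk with ⟨m', l1, l2, l3, l4⟩ | ⟨_, l1⟩
      · exact absurd l2 (hno m' l1)
      · exact l1
    · rcases h3 v h k hk with ⟨m', l1, l2, l3, l4⟩ | ⟨_, l1⟩
      · exact absurd l2 (hno m' l1)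
      · exact l1

end PRAM

namespace PRAM

variable {B X ν κ : ℕ}

/-! ### Updating the trees -/

/-- The vertex whose leaves are recomputed by the processor. -/
def target : IExp := .read 13 (.idx % reg 5)

/-- The first cell of the list of the leaf. -/
def leafCell : IExp := (.idx / reg 5 * (2 * reg 4) + (reg 4 + target)) * reg 5

/-- The cell of the matrices for the edge of the leaf. -/
def edgeCell : IExp := .idx / reg 5 * reg 4 + target

/-- Recompute the leaves of the vertices in `T` and then all their ancestors. -/
def update : Prog :=
  .parI (reg 4 * reg 5) 1 14 leafCell
    (.ite (.read 3 target) 0 (.ite (.read 15 edgeCell) (target + 1) 0)) ;;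
  .parR (reg 4 * reg 5) 1 3 leafCell (.read 4 edgeCell) ;;
  setReg 7 (2 * reg 5) ;;
  setReg 6 (reg 4 * reg 5 * reg 7) ;;
  setReg 17 2 ;;
  .loop (.le (reg 17) (reg 4)) levelUp

/-- The current entry of the leaf of the edge from `v` to `x`. -/
def leafEntry (ν : ℕ) (σ : Mem) (v x : ℕ) : ℕ × ℝ :=
  (if σ.int 3 x = 0 then if σ.int 15 (v * 2 ^ ν + x) = 0 then 0 else x + 1 else 0,
    σ.real 4 (v * 2 ^ ν + x))

/-- Every inner node has the best entries of its children. -/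
def TreeCons (ν κ : ℕ) (σ : Mem) : Prop :=
  ∀ v < 2 ^ ν, ∀ h, 1 ≤ h → h < 2 ^ ν → IsTopK (2 ^ κ) (kids ν κ σ v h) (node ν κ σ v h)

theorem kids_congr {σ σ' : Mem} {v h : ℕ}
    (h1 : ∀ k < 2 ^ κ, node ν κ σ' v (2 * h) k = node ν κ σ v (2 * h) k)
    (h2 : ∀ k < 2 ^ κ, node ν κ σ' v (2 * h + 1) k = node ν κ σ v (2 * h + 1) k) :
    kids ν κ σ' v h = kids ν κ σ v h := by
  ext p
  rw [mem_kids, mem_kids]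
  refine exists_congr fun k => and_congr_right fun hk => ?_
  rw [h1 k hk, h2 k hk]

/-- A leaf uses only the first cell of its list. Equal targets produce equal entries, so collisions
between them do not matter. -/
theorem leaf_run (b : Bounds B X ν κ) {σ : Mem} (hσ : Setup ν κ σ) {P : Prog} {D : ℕ}
    {Q : Mem → Prop}
    (hP : ∀ τ, Setup ν κ τ → Frame [14] [3] σ τ →
      (∀ v < 2 ^ ν, ∀ h < 2 * 2 ^ ν, ∀ k < 2 ^ κ,
        (k = 0 ∧ (∃ j < 2 ^ κ, h = 2 ^ ν + σ.int 13 j) ∧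
          node ν κ τ v h k = leafEntry ν σ v (h - 2 ^ ν)) ∨
        (¬ (k = 0 ∧ ∃ j < 2 ^ κ, h = 2 ^ ν + σ.int 13 j) ∧
          node ν κ τ v h k = node ν κ σ v h k)) → Run B X P τ D Q) :
    Run B X (.parI (reg 4 * reg 5) 1 14 leafCell
        (.ite (.read 3 target) 0 (.ite (.read 15 edgeCell) (target + 1) 0)) ;;
      .parR (reg 4 * reg 5) 1 3 leafCell (.read 4 edgeCell) ;; P) σ (D + 120) Q := by
  obtain ⟨h4, h5, hbuf, htree, hT⟩ := hσ
  have hX1 := b.width_pos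
  have hXB := b.width_le
  have hK : 0 < 2 ^ κ := by positivity
  have hw : 2 ^ ν * 2 ^ κ ≤ X := by
    have h1 := b.width
    have h2 : 2 ^ ν * 2 ^ κ ≤ 2 ^ ν * (2 ^ κ * 2 ^ κ) := Nat.mul_le_mul_left _ (le_sq_pow κ)
    omega
  have h4B := b.four_lt
  have htreeB := b.lt_word le_rfl (le_sq_pow κ)
  have hNT : ∀ j, 2 ^ ν + σ.int 13 j < 2 * 2 ^ ν := by
    intro j
    have := hT j
    omega
  have hcell : ∀ i, leafCell.eval σ i =
      (i / 2 ^ κ * (2 * 2 ^ ν) + (2 ^ ν + σ.int 13 (i % 2 ^ κ))) * 2 ^ κ + 0 := by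
    intro i
    simp [leafCell, target, h4, h5]
  have hcell' : ∀ f i, leafCell.eval (σ.setI 14 f) i =
      (i / 2 ^ κ * (2 * 2 ^ ν) + (2 ^ ν + σ.int 13 (i % 2 ^ κ))) * 2 ^ κ + 0 := by
    intro f i
    simp [leafCell, target, h4, h5]
  have hval : ∀ i, IExp.eval σ i (.ite (.read 3 target) 0 (.ite (.read 15 edgeCell) (target + 1) 0)) =
      (leafEntry ν σ (i / 2 ^ κ) (σ.int 13 (i % 2 ^ κ))).1 := by
    intro i
    simp [edgeCell, target, h4, h5, leafEntry]
  have hval' : ∀ f i, RExp.eval (σ.setI 14 f) i (.read 4 edgeCell) =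
      (leafEntry ν σ (i / 2 ^ κ) (σ.int 13 (i % 2 ^ κ))).2 := by
    intro f i
    simp [edgeCell, target, h4, h5, leafEntry]
  have hleaf : ∀ i, (leafEntry ν σ (i / 2 ^ κ) (σ.int 13 (i % 2 ^ κ))).1 ≤ 2 ^ ν := by
    intro i
    have := hT (i % 2 ^ κ)
    simp only [leafEntry]
    split_ifs <;> omega
  have haddrB : ∀ i < 2 ^ ν * 2 ^ κ,
      (i / 2 ^ κ * (2 * 2 ^ ν) + (2 ^ ν + σ.int 13 (i % 2 ^ κ))) * 2 ^ κ + 0 < B := by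
    intro i hi
    have h3 := seg_lt (seg_lt ((Nat.div_lt_iff_lt_mul hK).2 hi) (hNT (i % 2 ^ κ))) hK
    have h4 : 2 ^ ν * (2 * 2 ^ ν) * 2 ^ κ = 2 * (2 ^ ν * 2 ^ ν * 2 ^ κ) := by ring
    exact lt_of_lt_of_le h3 (by omega)
  refine Run.seq 60 (D + 60) ?_
  refine Run.parI (by simpa [h4, h5] using hw) hX1 ?_ (by decide) ?_
  · intro i hi _
    simp only [eval_mul, eval_reg, h4, h5] at hi
    rw [hval, hcell]
    have := hleaf i
    exact ⟨haddrB i hi, by omega⟩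
  simp only [eval_mul, eval_reg, h4, h5, hcell, hval]
  refine Run.seq 60 D ?_
  refine Run.parR (by simpa [h4, h5] using hw) hX1 ?_ (by decide) ?_
  · intro i hi _
    simp only [eval_mul, eval_reg, setI_int, Nat.reduceEqDiff, if_false, h4, h5] at hi
    rw [hcell']
    exact haddrB i hi
  simp only [eval_mul, eval_reg, setI_int, Nat.reduceEqDiff, if_false, h4, h5, hcell', hval']
  have key : ∀ {α : Type} (act : ℕ → Prop) (val : ℕ → ℕ → α) (old : ℕ → α), (∀ i, act i) →
      ∀ v < 2 ^ ν, ∀ h < 2 * 2 ^ ν, ∀ k < 2 ^ κ,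
        (k = 0 ∧ (∃ j < 2 ^ κ, h = 2 ^ ν + σ.int 13 j) →
          scatter (2 ^ ν * 2 ^ κ) act
            (fun i => (i / 2 ^ κ * (2 * 2 ^ ν) + (2 ^ ν + σ.int 13 (i % 2 ^ κ))) * 2 ^ κ + 0)
            (fun i => val (i / 2 ^ κ) (σ.int 13 (i % 2 ^ κ))) old
            ((v * (2 * 2 ^ ν) + h) * 2 ^ κ + k) = val v (h - 2 ^ ν)) ∧
        (¬ (k = 0 ∧ ∃ j < 2 ^ κ, h = 2 ^ ν + σ.int 13 j) →
          scatter (2 ^ ν * 2 ^ κ) act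
            (fun i => (i / 2 ^ κ * (2 * 2 ^ ν) + (2 ^ ν + σ.int 13 (i % 2 ^ κ))) * 2 ^ κ + 0)
            (fun i => val (i / 2 ^ κ) (σ.int 13 (i % 2 ^ κ))) old
            ((v * (2 * 2 ^ ν) + h) * 2 ^ κ + k) = old ((v * (2 * 2 ^ ν) + h) * 2 ^ κ + k)) := by
    intro α act val old hact v hv h hh k hk
    rcases scatter_cases (N := 2 ^ ν * 2 ^ κ) (act := act)
      (addr := fun i => (i / 2 ^ κ * (2 * 2 ^ ν) + (2 ^ ν + σ.int 13 (i % 2 ^ κ))) * 2 ^ κ + 0)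
      (val := fun i => val (i / 2 ^ κ) (σ.int 13 (i % 2 ^ κ))) (old := old)
      ((v * (2 * 2 ^ ν) + h) * 2 ^ κ + k) with ⟨i, l1, -, l2, l3⟩ | ⟨l1, l2⟩
    · obtain ⟨e1, e2⟩ := seg_inj hK hk l2
      obtain ⟨e3, e4⟩ := seg_inj (hNT _) hh e1
      constructor
      · intro _
        rw [l3, e3]
        congr 1
        omega
      · intro hn
        exact absurd ⟨e2.symm, i % 2 ^ κ, Nat.mod_lt _ hK, e4.symm⟩ hn
    · constructor
      · rintro ⟨rfl, j, hj, rfl⟩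
        refine absurd ?_ (l1 (v * 2 ^ κ + j) (seg_lt hv hj) (hact _))
        rw [seg_div _ hj, seg_mod _ hj]
      · exact fun _ => l2
  set f14 := scatter (2 ^ ν * 2 ^ κ) (fun i => (1 : IExp).eval σ i ≠ 0)
    (fun i => (i / 2 ^ κ * (2 * 2 ^ ν) + (2 ^ ν + σ.int 13 (i % 2 ^ κ))) * 2 ^ κ + 0)
    (fun i => (leafEntry ν σ (i / 2 ^ κ) (σ.int 13 (i % 2 ^ κ))).1) (σ.int 14) with hf14
  have k14 := key (fun i => (1 : IExp).eval σ i ≠ 0) (fun v x => (leafEntry ν σ v x).1) (σ.int 14)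
    (fun _ => one_ne_zero)
  have k3 := key (fun i => (1 : IExp).eval (σ.setI 14 f14) i ≠ 0)
    (fun v x => (leafEntry ν σ v x).2) (σ.real 3) (fun _ => one_ne_zero)
  refine hP _ ⟨?_, ?_, ?_, ?_, ?_⟩ (Frame.refl σ).setI.setR ?_
  · simpa using h4
  · simpa using h5
  · simpa using hbuf
  · intro i
    simp only [setI_int, setR_int, if_true, hf14]
    exact scatter_all (p := fun x => x ≤ 2 ^ ν) (fun _ _ _ => hleaf _) htree i
  · simpa using hT
  · intro v hv h hh k hk
    simp only [node, tree, setI_int, setR_int, if_true, setR_real, setI_real]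
    rw [← hf14] at k14
    by_cases hc : k = 0 ∧ ∃ j < 2 ^ κ, h = 2 ^ ν + σ.int 13 j
    · left
      refine ⟨hc.1, hc.2, Prod.ext ?_ ?_⟩
      · exact (k14 v hv h hh k hk).1 hc
      · exact (k3 v hv h hh k hk).1 hc
    · right
      refine ⟨hc, Prod.ext ?_ ?_⟩
      · exact (k14 v hv h hh k hk).2 hc
      · exact (k3 v hv h hh k hk).2 hc

/-- The ancestors at distance `d` from the leaves fill one heap level. Levels are disjoint ranges of
numbers, so rewriting one level leaves the children on the level below untouched. -/
theorem anc_bounds {x d : ℕ} (hx : x < 2 ^ ν) (hd : d ≤ ν) :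
    2 ^ (ν - d) ≤ (2 ^ ν + x) / 2 ^ d ∧ (2 ^ ν + x) / 2 ^ d < 2 * 2 ^ (ν - d) := by
  have h : 2 ^ ν = 2 ^ (ν - d) * 2 ^ d := by rw [← pow_add, Nat.sub_add_cancel hd]
  have hp : 0 < 2 ^ d := by positivity
  rw [Nat.le_div_iff_mul_le hp, Nat.div_lt_iff_lt_mul hp, mul_assoc, ← h]
  omega

/-- New leaves can spoil consistency only at proper ancestors of targets. Before round `m` the only
possible failures are at ancestors at distance `m + 1` or more, and the round repairs distance `m +
1`. After `ν` rounds the remaining distances give the number `0`, which is no node. -/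
theorem update_run (b : Bounds B X ν κ) {σ : Mem} (hσ : Setup ν κ σ) :
    Run B X update σ ((ν + 1) * (5000 * ((ν + 1) * (ν + 1)))) fun σ' =>
      Setup ν κ σ' ∧ Frame [6, 7, 8, 9, 10, 11, 12, 14, 17] [2, 3] σ σ' ∧
      (TreeCons ν κ σ → TreeCons ν κ σ') ∧
      ∀ v < 2 ^ ν, ∀ x < 2 ^ ν, ∀ k < 2 ^ κ,
        (k = 0 ∧ (∃ j < 2 ^ κ, x = σ.int 13 j) ∧
          node ν κ σ' v (2 ^ ν + x) k = leafEntry ν σ v x) ∨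
        (¬ (k = 0 ∧ ∃ j < 2 ^ κ, x = σ.int 13 j) ∧
          node ν κ σ' v (2 ^ ν + x) k = node ν κ σ v (2 ^ ν + x) k) := by
  have hX1 := b.width_pos
  have hT := hσ.targets
  have h4B := b.four_lt
  have htotB := b.lt_word (le_sq_pow ν) le_rfl
  have hKN := b.pow_le
  set S := (ν + 1) * (ν + 1) with hS
  have hS1 : 1 ≤ S := Nat.mul_pos (by omega) (by omega)
  have hDD : (ν + 1) * (5000 * S) = 5000 * (ν * S) + 5000 * S := by ring
  refine (leaf_run b hσ (D := (ν + 1) * (5000 * S) - 120) ?_).mono (by omega) fun _ h => h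
  intro τ hτ hf hnode
  have e4 := hτ.size
  have e5 := hτ.len
  refine Run.seq 20 ((ν + 1) * (5000 * S) - 140) ?_
  refine Run.setReg hX1 ?_ (by decide) ?_
  · simp only [eval_mul, eval_reg, eval_two, e5]
    omega
  refine Run.seq 20 ((ν + 1) * (5000 * S) - 160) ?_
  have hp2 : 2 ^ (κ + 1) = 2 * 2 ^ κ := by rw [pow_succ]; ring
  refine Run.setReg hX1 ?_ (by decide) ?_
  · simp only [eval_mul, eval_reg, eval_two, e5, e4, setI_int, Nat.reduceEqDiff, if_false, if_true]
    have : 2 ^ ν * 2 ^ κ * (2 * 2 ^ κ) = 2 * (2 ^ ν * (2 ^ κ * 2 ^ κ)) := by ring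
    omega
  refine Run.seq 20 ((ν + 1) * (5000 * S) - 180) ?_
  refine Run.setReg hX1 ?_ (by decide) ?_
  · rw [eval_two]
    have : 0 < 2 ^ ν := by positivity
    omega
  simp only [eval_mul, eval_reg, eval_two, e4, e5, setI_int, Nat.reduceEqDiff, if_false, if_true]
  set τ₀ := ((τ.setI 7 _).setI 6 _).setI 17 _ with hτ₀
  have hf₀ : Frame [6, 7, 17] [] τ τ₀ := (Frame.refl τ).setI.setI.setI
  have hn₀ : ∀ v h k, node ν κ τ₀ v h k = node ν κ τ v h k := by
    intro v h k
    simp [node, tree, hτ₀]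
  have hset₀ : Setup ν κ τ₀ := by
    obtain ⟨a1, a2, a3, a4, a5⟩ := hτ
    refine ⟨?_, ?_, ?_, ?_, ?_⟩ <;> simpa [hτ₀]
  have h6 : τ₀.int 6 0 = 2 ^ ν * 2 ^ κ * 2 ^ (κ + 1) := by simp [hτ₀, hp2]
  have h7 : τ₀.int 7 0 = 2 ^ (κ + 1) := by simp [hτ₀, hp2]
  have h17 : τ₀.int 17 0 = 2 := by simp [hτ₀]
  clear_value τ₀
  refine Run.loop ν (3600 * S + 300) (fun m ρ => ρ.int 17 0 = 2 ^ (m + 1) ∧ Setup ν κ ρ ∧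
    Frame [8, 9, 10, 11, 12, 14, 17] [2, 3] τ₀ ρ ∧
    (∀ v < 2 ^ ν, ∀ h < 2 * 2 ^ ν, 2 ^ ν ≤ h → ∀ k < 2 ^ κ, node ν κ ρ v h k = node ν κ τ v h k) ∧
    (TreeCons ν κ σ → ∀ v < 2 ^ ν, ∀ h, 1 ≤ h → h < 2 ^ ν →
      IsTopK (2 ^ κ) (kids ν κ ρ v h) (node ν κ ρ v h) ∨
      ∃ j < 2 ^ κ, ∃ e, m + 1 ≤ e ∧ h = (2 ^ ν + σ.int 13 j) / 2 ^ e)) hX1 ?_ ?_ ?_ ?_ ?_ ?_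
  · refine ⟨by simpa using h17, hset₀, Frame.refl _, fun v _ h _ _ k _ => hn₀ v h k, ?_⟩
    intro hcons v hv h h1 hh
    by_cases hex : ∃ j < 2 ^ κ, ∃ e, 0 + 1 ≤ e ∧ h = (2 ^ ν + σ.int 13 j) / 2 ^ e
    · exact .inr hex
    · left
      have hin : ∀ h' < 2 * 2 ^ ν, h' / 2 = h ∨ h' = h → ∀ k < 2 ^ κ,
          node ν κ τ₀ v h' k = node ν κ σ v h' k := by
        intro h' hh' ho k hk
        rw [hn₀]
        rcases hnode v hv h' hh' k hk with ⟨-, ⟨j, hj, hjh⟩, -⟩ | ⟨-, h⟩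
        · rcases ho with ho | ho
          · exact absurd ⟨j, hj, 1, le_rfl, by rw [pow_one, ← hjh, ho]⟩ hex
          · omega
        · exact h
      rw [kids_congr (hin (2 * h) (by omega) (.inl (by omega)))
        (hin (2 * h + 1) (by omega) (.inl (by omega)))]
      exact (hcons v hv h h1 hh).congr (hin h (by omega) (.inr rfl))
  · rintro m hm ρ ⟨q1, q2, -⟩
    simp only [eval_le, eval_reg, q1, q2.size]
    rw [if_pos (Nat.pow_le_pow_right (by norm_num) hm)]
    exact one_ne_zero
  · rintro m hm ρ ⟨q1, q2, q3, q4, q5⟩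
    have e13 : ρ.int 13 = σ.int 13 := by
      rw [q3.int 13 (by decide), hf₀.int 13 (by decide), hf.int 13 (by decide)]
    refine (levelUp_run b q2 q1 (by positivity) (Nat.pow_le_pow_right (by norm_num) hm)
      (by rw [q3.int 7 (by decide), h7]) (by rw [q3.int 6 (by decide), h6])).mono le_rfl ?_
    rintro ρ' ⟨r1, r2, r3, r4⟩
    rw [e13] at r4
    refine ⟨by rw [r1, ← pow_succ], r2, q3.comp r3, ?_, ?_⟩
    · intro v hv h hh hle k hk
      rcases r4 v hv h hh with ⟨-, j, hj, hjh⟩ | ⟨r5, -⟩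
      · have := (anc_bounds (hT j) hm).2
        have h2 : 2 * 2 ^ (ν - (m + 1)) ≤ 2 ^ ν := by
          rw [← pow_succ']
          exact Nat.pow_le_pow_right (by norm_num) (by omega)
        simp only [Nat.succ_eq_add_one] at this
        omega
      · rw [r5 k hk, q4 v hv h hh hle k hk]
    · intro hcons v hv h h1 hh
      rcases r4 v hv h (by omega) with ⟨r5, j, hj, hjh⟩ | ⟨r5, r6⟩
      · left
        have hb := (anc_bounds (hT j) hm).1
        rw [← hjh] at hb
        have hin : ∀ h' < 2 * 2 ^ ν, 2 * h ≤ h' → ∀ k < 2 ^ κ,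
            node ν κ ρ' v h' k = node ν κ ρ v h' k := by
          intro h' hh' hge k hk
          rcases r4 v hv h' hh' with ⟨-, j', hj', hjh'⟩ | ⟨r7, -⟩
          · have := (anc_bounds (hT j') hm).2
            simp only [Nat.succ_eq_add_one] at hb this
            omega
          · exact r7 k hk
        rw [kids_congr (hin (2 * h) (by omega) (by omega)) (hin (2 * h + 1) (by omega) (by omega))]
        exact r5
      · by_cases hex : ∃ j < 2 ^ κ, ∃ e, m + 1 + 1 ≤ e ∧ h = (2 ^ ν + σ.int 13 j) / 2 ^ e
        · exact .inr hex
        · left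
          have hin : ∀ h' < 2 * 2 ^ ν, h' / 2 = h → ∀ k < 2 ^ κ,
              node ν κ ρ' v h' k = node ν κ ρ v h' k := by
            intro h' hh' hd k hk
            rcases r4 v hv h' hh' with ⟨-, j', hj', hjh'⟩ | ⟨r7, -⟩
            · refine absurd ⟨j', hj', m + 1 + 1, le_rfl, ?_⟩ hex
              rw [pow_succ, ← Nat.div_div_eq_div_mul, ← hjh', hd]
            · exact r7 k hk
          rw [kids_congr (hin (2 * h) (by omega) (by omega)) (hin (2 * h + 1) (by omega) (by omega))]
          rcases q5 hcons v hv h h1 hh with q6 | ⟨j, hj, e, he, hjh⟩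
          · exact q6.congr r5
          · rcases Nat.eq_or_lt_of_le he with he' | he'
            · exact absurd (he' ▸ hjh) (r6 j hj)
            · exact absurd ⟨j, hj, e, he', hjh⟩ hex
  · rintro ρ ⟨q1, q2, -⟩
    simp only [eval_le, eval_reg, q1, q2.size]
    rw [if_neg]
    have : 2 ^ ν < 2 ^ (ν + 1) := Nat.pow_lt_pow_right (by norm_num) (by omega)
    omega
  · rintro ρ ⟨-, q2, q3, q4, q5⟩
    refine ⟨q2, hf.mono.comp (hf₀.mono.comp q3.mono), ?_, ?_⟩
    · intro hcons v hv h h1 hh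
      rcases q5 hcons v hv h h1 hh with q6 | ⟨j, hj, e, he, hjh⟩
      · exact q6
      · have h2 := hT j
        have h3 : 2 ^ (ν + 1) ≤ 2 ^ e := Nat.pow_le_pow_right (by norm_num) he
        rw [pow_succ] at h3
        rw [Nat.div_eq_of_lt (by omega)] at hjh
        omega
    · intro v hv x hx k hk
      rw [q4 v hv (2 ^ ν + x) (by omega) (by omega) k hk]
      rcases hnode v hv (2 ^ ν + x) (by omega) k hk with ⟨l1, ⟨j, hj, hjx⟩, l2⟩ | ⟨l1, l2⟩
      · exact .inl ⟨l1, ⟨j, hj, by omega⟩, by rw [l2, Nat.add_sub_cancel_left]⟩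
      · refine .inr ⟨?_, l2⟩
        rintro ⟨e1, j, hj, hjx⟩
        exact l1 ⟨e1, j, hj, by omega⟩
  · have hc : (IExp.le (reg 17) (reg 4)).cost = 5 := rfl
    have h1 : ν * (5 + (3600 * S + 300)) = 3600 * (ν * S) + 305 * ν := by ring
    have h2 : ν ≤ ν * S := Nat.le_mul_of_pos_right _ hS1
    rw [hc, h1, hDD]
    omega

end PRAM

namespace PRAM

variable {B X ν κ : ℕ}

/-! ## Balls

The arrays `16` and `5` hold one list for every vertex, its ball. -/

/-- Pairs with word zero are immaterial. This discards the empty cells of a buffer, which have no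
counterpart in the set that it represents. -/
theorem IsTopK.congr_set {K : ℕ} {In In' : Set (ℕ × ℝ)} {L : ℕ → ℕ × ℝ} (h : IsTopK K In L)
    (hI : ∀ p, p.1 ≠ 0 → (p ∈ In' ↔ p ∈ In)) : IsTopK K In' L :=
  ⟨fun k hk h0 => (hI _ h0).2 (h.mem k hk h0), h.inj, fun p hp h0 => h.dom p ((hI p h0).1 hp) h0⟩

/-- The ball of `v`. -/
def ball (κ : ℕ) (σ : Mem) (v k : ℕ) : ℕ × ℝ :=
  (σ.int 16 (v * 2 ^ κ + k), σ.real 5 (v * 2 ^ κ + k))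

/-- The entries reached from `v` in two steps of the lists `L`. -/
def joinSet (K : ℕ) (L : ℕ → ℕ → ℕ × ℝ) (v : ℕ) : Set (ℕ × ℝ) :=
  {p | ∃ a < K, ∃ b < K, (L v a).1 ≠ 0 ∧
    p = ((L ((L v a).1 - 1) b).1, (L v a).2 + (L ((L v a).1 - 1) b).2)}

/-- The entries of the lists `L` of the marked vertices, shifted by their distances `d`. -/
def relaxSet (N K : ℕ) (S : ℕ → ℕ) (d : ℕ → ℝ) (L : ℕ → ℕ → ℕ × ℝ) : Set (ℕ × ℝ) :=
  {p | ∃ u < N, ∃ k < K, S u ≠ 0 ∧ p = ((L u k).1, d u + (L u k).2)}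

/-- The word of the middle entry. -/
def mid : IExp := .read 16 (.idx / reg 5)

/-- The cell of the ball of the middle vertex. -/
def midCell : IExp := (mid - 1) * reg 5 + .idx % reg 5

/-- The cell of the buffer that is stored by the processor. -/
def ballSrc : IExp := .idx / reg 5 * reg 7 + .idx % reg 5

/-- Double the number of hops of the balls. -/
def square : Prog :=
  mapI (reg 6) 11 (.ite mid (.read 16 midCell) 0) ;;
  mapR (reg 6) 2 (.read 5 (.idx / reg 5) + .read 5 midCell) ;;
  topk ;;
  mapI (reg 4 * reg 5) 16 (.read 11 ballSrc) ;;
  mapR (reg 4 * reg 5) 5 (.read 2 ballSrc) ;;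
  setReg 18 (reg 18 * 2)

theorem width_lists (b : Bounds B X ν κ) : 2 ^ ν * 2 ^ κ ≤ X := by
  have h1 := b.width
  have h2 : 2 ^ ν * 2 ^ κ ≤ 2 ^ ν * (2 ^ κ * 2 ^ κ) := Nat.mul_le_mul_left _ (le_sq_pow κ)
  omega

/-- The cell `a * 2 ^ κ + c` of the segment of `v` receives the entry `c` of the ball of the `a`-th
member of the ball of `v`, or is left empty if there is no such member. -/
theorem square_run (b : Bounds B X ν κ) {σ : Mem} (hσ : Setup ν κ σ)
    (hball : ∀ i, σ.int 16 i ≤ 2 ^ ν) {r : ℕ} (h18 : σ.int 18 0 = r) (hr : r ≤ 2 ^ ν)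
    (h7 : σ.int 7 0 = 2 ^ (2 * κ)) (h6 : σ.int 6 0 = 2 ^ ν * 2 ^ (2 * κ)) :
    Run B X square σ (3600 * ((ν + 1) * (ν + 1)) + 300) fun σ' =>
      σ'.int 18 0 = r * 2 ∧ Setup ν κ σ' ∧ (∀ i, σ'.int 16 i ≤ 2 ^ ν) ∧
      Frame [8, 9, 10, 11, 12, 16, 18] [2, 5] σ σ' ∧
      ∀ v < 2 ^ ν, IsTopK (2 ^ κ) (joinSet (2 ^ κ) (ball κ σ) v) (ball κ σ' v) := by
  have hX1 := b.width_pos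
  have hXB := b.width_le
  have hp2 : 2 ^ (2 * κ) = 2 ^ κ * 2 ^ κ := by rw [two_mul, pow_add]
  have htot : 2 ^ ν * 2 ^ (2 * κ) ≤ X := by
    rw [hp2]
    have := b.width
    omega
  have hst := width_lists b
  have h4B := b.four_lt
  have hKB := b.lt_word (one_le_sq_pow ν) le_rfl
  have hK : 0 < 2 ^ κ := by positivity
  have h4 := hσ.size
  have h5 := hσ.len
  have hval : ∀ i, IExp.eval σ i (.ite mid (.read 16 midCell) 0) =
      if σ.int 16 (i / 2 ^ κ) = 0 then 0
      else σ.int 16 ((σ.int 16 (i / 2 ^ κ) - 1) * 2 ^ κ + i % 2 ^ κ) := by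
    intro i
    simp [mid, midCell, h5]
  have hvalR : ∀ f i, RExp.eval (σ.setI 11 f) i (.read 5 (.idx / reg 5) + .read 5 midCell) =
      σ.real 5 (i / 2 ^ κ) + σ.real 5 ((σ.int 16 (i / 2 ^ κ) - 1) * 2 ^ κ + i % 2 ^ κ) := by
    intro f i
    simp [mid, midCell, h5]
  have hle : ∀ i, (if σ.int 16 (i / 2 ^ κ) = 0 then 0
      else σ.int 16 ((σ.int 16 (i / 2 ^ κ) - 1) * 2 ^ κ + i % 2 ^ κ)) ≤ 2 ^ ν := by
    intro i
    split_ifs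
    · omega
    · exact hball _
  refine Run.seq 40 (3600 * ((ν + 1) * (ν + 1)) + 260) ?_
  refine Run.mapI (by simpa [h6] using htot) hX1 ?_ (by decide) ?_
  · intro i hi
    rw [eval_reg, h6] at hi
    rw [hval]
    have := hle i
    omega
  refine Run.seq 40 (3600 * ((ν + 1) * (ν + 1)) + 220) ?_
  refine Run.mapR (by simpa [h6] using htot) hX1 ?_ (by decide) ?_
  · intro i hi
    simp only [eval_reg, setI_int, Nat.reduceEqDiff, if_false, h6] at hi
    omega
  simp only [eval_reg, h6, setI_int, setI_real, Nat.reduceEqDiff, if_false, hval, hvalR]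
  set τ := (σ.setI 11 _).setR 2 _ with hτ
  have hf : Frame [8, 9, 10, 11, 12] [2] σ τ := (Frame.refl σ).setI.setR
  have hτbuf : ∀ i < 2 ^ ν * 2 ^ (2 * κ), buf τ i = (if σ.int 16 (i / 2 ^ κ) = 0 then 0
      else σ.int 16 ((σ.int 16 (i / 2 ^ κ) - 1) * 2 ^ κ + i % 2 ^ κ), 
      σ.real 5 (i / 2 ^ κ) + σ.real 5 ((σ.int 16 (i / 2 ^ κ) - 1) * 2 ^ κ + i % 2 ^ κ)) := by
    intro i hi
    simp only [buf, hτ, setR_int, setI_int, if_true, if_pos hi, setR_real]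
  have hτw : ∀ i, τ.int 11 i ≤ 2 ^ ν := by
    intro i
    simp only [hτ, setR_int, setI_int, if_true]
    by_cases hi : i < 2 ^ ν * 2 ^ (2 * κ)
    · rw [if_pos hi]
      exact hle i
    · rw [if_neg hi]
      exact hσ.buf_le i
  clear_value τ
  refine Run.seq (3600 * ((ν + 1) * (ν + 1))) 200 ?_
  refine (topk_run_le (q := 2 ^ ν) (l := 2 * κ) b (by rw [hf.int 7 (by decide), h7])
    (by rw [hf.int 6 (by decide), h6]) (by rw [hf.int 4 (by decide), h4]) htot
    (by have := b.le; omega) (Nat.le_mul_of_pos_right _ hK) (by rw [hp2]; omega) hτw).mono le_rfl ?_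
  rintro τ₁ ⟨htop, hw₁, hf₁⟩
  have hf1 : Frame [8, 9, 10, 11, 12] [2] σ τ₁ := hf.comp hf₁
  have e4 : τ₁.int 4 0 = 2 ^ ν := by rw [hf1.int 4 (by decide), h4]
  have e5 : τ₁.int 5 0 = 2 ^ κ := by rw [hf1.int 5 (by decide), h5]
  have e7 : τ₁.int 7 0 = 2 ^ (2 * κ) := by rw [hf1.int 7 (by decide), h7]
  have e18 : τ₁.int 18 0 = r := by rw [hf1.int 18 (by decide), h18]
  have hsrc : ∀ i, ballSrc.eval τ₁ i = i / 2 ^ κ * 2 ^ (2 * κ) + i % 2 ^ κ := by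
    intro i
    simp [ballSrc, e5, e7]
  have hsrc' : ∀ f i, ballSrc.eval (τ₁.setI 16 f) i = i / 2 ^ κ * 2 ^ (2 * κ) + i % 2 ^ κ := by
    intro f i
    simp [ballSrc, e5, e7]
  refine Run.seq 60 140 ?_
  refine Run.mapI (by simpa [e4, e5] using hst) hX1 ?_ (by decide) ?_
  · intro i hi
    simp only [eval_mul, eval_reg, e4, e5] at hi
    rw [eval_read]
    have := hw₁ (ballSrc.eval τ₁ i)
    omega
  refine Run.seq 60 80 ?_
  refine Run.mapR (by simpa [e4, e5] using hst) hX1 ?_ (by decide) ?_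
  · intro i hi
    simp only [eval_mul, eval_reg, setI_int, Nat.reduceEqDiff, if_false, e4, e5] at hi
    omega
  refine Run.setReg hX1 ?_ (by decide) ?_
  · simp only [eval_mul, eval_reg, setI_int, setR_int, Nat.reduceEqDiff, if_false, e18, eval_two]
    omega
  simp only [eval_mul, eval_reg, eval_two, setI_int, setI_real, setR_int, Nat.reduceEqDiff, if_false,
    e4, e5, eval_read, evalR_read, hsrc, hsrc', e18]
  set σ' := ((τ₁.setI 16 _).setR 5 _).setI 18 _ with hσ'
  have hf' : Frame [8, 9, 10, 11, 12, 16, 18] [2, 5] σ σ' := (hf1.mono).setI.setR.setI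
  have hb16 : ∀ i, σ'.int 16 i ≤ 2 ^ ν := by
    intro i
    simp only [hσ', setI_int, setR_int, Nat.reduceEqDiff, if_false, if_true]
    split_ifs
    · exact hw₁ _
    · rw [hf1.int 16 (by decide)]
      exact hball i
  refine ⟨by simp, ⟨?_, ?_, ?_, ?_, ?_⟩, hb16, hf', ?_⟩
  · rw [hf'.int 4 (by decide), h4]
  · rw [hf'.int 5 (by decide), h5]
  · intro i
    simpa [hσ'] using hw₁ i
  · rw [hf'.int 14 (by decide)]
    exact hσ.tree_le
  · rw [hf'.int 13 (by decide)]
    exact hσ.targets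
  intro v hv
  have hKK : 2 ^ κ ≤ 2 ^ (2 * κ) := by
    rw [hp2]
    exact le_sq_pow κ
  refine ((htop v hv (2 ^ κ) hKK).congr fun k hk => ?_).congr_set fun p hp => ?_
  · have hlt := seg_lt hv hk
    simp only [ball, buf, hσ', setI_int, setI_real, setR_int, setR_real, Nat.reduceEqDiff, if_false,
      if_true, if_pos hlt, seg_div v hk, seg_mod v hk]
  · simp only [joinSet, segSet, Set.mem_ofPred_eq]
    have hcell : ∀ a < 2 ^ κ, ∀ c < 2 ^ κ, v * 2 ^ (2 * κ) + (a * 2 ^ κ + c) < 2 ^ ν * 2 ^ (2 * κ) ∧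
        (v * 2 ^ (2 * κ) + (a * 2 ^ κ + c)) / 2 ^ κ = v * 2 ^ κ + a ∧
        (v * 2 ^ (2 * κ) + (a * 2 ^ κ + c)) % 2 ^ κ = c ∧ a * 2 ^ κ + c < 2 ^ (2 * κ) := by
      intro a ha c hc
      have h1 : a * 2 ^ κ + c < 2 ^ (2 * κ) := by
        rw [hp2]
        exact seg_lt ha hc
      have h2 : v * 2 ^ (2 * κ) + (a * 2 ^ κ + c) = (v * 2 ^ κ + a) * 2 ^ κ + c := by
        rw [hp2]
        ring
      refine ⟨seg_lt hv h1, ?_, ?_, h1⟩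
      · rw [h2, seg_div _ hc]
      · rw [h2, seg_mod _ hc]
    constructor
    · rintro ⟨a, ha, c, hc, h0, rfl⟩
      obtain ⟨c1, c2, c3, c4⟩ := hcell a ha c hc
      refine ⟨a * 2 ^ κ + c, c4, ?_⟩
      rw [hτbuf _ c1, c2, c3]
      simp only [ball] at h0 ⊢
      rw [if_neg h0]
    · rintro ⟨i, hi, rfl⟩
      have hi' : i = i / 2 ^ κ * 2 ^ κ + i % 2 ^ κ := by
        rw [mul_comm, Nat.div_add_mod]
      have ha : i / 2 ^ κ < 2 ^ κ := by
        rw [Nat.div_lt_iff_lt_mul hK, ← hp2]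
        exact hi
      have hc : i % 2 ^ κ < 2 ^ κ := Nat.mod_lt _ hK
      obtain ⟨c1, c2, c3, c4⟩ := hcell _ ha _ hc
      rw [← hi'] at c1 c2 c3
      rw [hτbuf _ c1, c2, c3] at hp ⊢
      refine ⟨i / 2 ^ κ, ha, i % 2 ^ κ, hc, ?_, ?_⟩
      · intro h0
        simp only [ball] at h0
        exact hp (if_pos h0)
      · simp only [ball]
        rw [if_neg]
        intro h0
        exact hp (if_pos h0)

/-- The cell of the root's list. -/
def rootCell : IExp := (.idx / reg 5 * (2 * reg 4) + 1) * reg 5 + .idx % reg 5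

/-- Compute the balls for `2 ^ ν` hops. -/
def balls : Prog :=
  mapI (reg 4 * reg 5) 16 (.read 14 rootCell) ;;
  mapR (reg 4 * reg 5) 5 (.read 3 rootCell) ;;
  setReg 7 (reg 5 * reg 5) ;;
  setReg 6 (reg 4 * reg 7) ;;
  setReg 18 1 ;;
  .loop (.le (reg 18 + 1) (reg 4)) square

/-- The property `J` is abstract in order to separate the handling of memory from the graph
argument; it is going to be `BallInv` for `2 ^ m` hops. -/
theorem balls_run (b : Bounds B X ν κ) {σ : Mem} (hσ : Setup ν κ σ)
    (hball : ∀ i, σ.int 16 i ≤ 2 ^ ν) (J : ℕ → (ℕ → ℕ → ℕ × ℝ) → Prop)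
    (h0 : ∀ L : ℕ → ℕ → ℕ × ℝ, (∀ v < 2 ^ ν, ∀ k < 2 ^ κ, L v k = node ν κ σ v 1 k) → J 0 L)
    (hstep : ∀ m, ∀ L L' : ℕ → ℕ → ℕ × ℝ, J m L →
      (∀ v < 2 ^ ν, IsTopK (2 ^ κ) (joinSet (2 ^ κ) L v) (L' v)) → J (m + 1) L') :
    Run B X balls σ ((ν + 1) * (5000 * ((ν + 1) * (ν + 1)))) fun σ' =>
      Setup ν κ σ' ∧ (∀ i, σ'.int 16 i ≤ 2 ^ ν) ∧
      Frame [6, 7, 8, 9, 10, 11, 12, 16, 18] [2, 5] σ σ' ∧ J ν (ball κ σ') := by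
  have hX1 := b.width_pos
  have hXB := b.width_le
  have hst := width_lists b
  have h4B := b.four_lt
  have hKB := b.lt_word (one_le_sq_pow ν) le_rfl
  have htotB := b.lt_word (le_sq_pow ν) le_rfl
  have hp2 : 2 ^ (2 * κ) = 2 ^ κ * 2 ^ κ := by rw [two_mul, pow_add]
  have h4 := hσ.size
  have h5 := hσ.len
  set S := (ν + 1) * (ν + 1) with hS
  have hS1 : 1 ≤ S := Nat.mul_pos (by omega) (by omega)
  have hDD : (ν + 1) * (5000 * S) = 5000 * (ν * S) + 5000 * S := by ring
  have hroot : ∀ i, rootCell.eval σ i = (i / 2 ^ κ * (2 * 2 ^ ν) + 1) * 2 ^ κ + i % 2 ^ κ := by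
    intro i
    simp [rootCell, h4, h5]
  have hroot' : ∀ f i, rootCell.eval (σ.setI 16 f) i =
      (i / 2 ^ κ * (2 * 2 ^ ν) + 1) * 2 ^ κ + i % 2 ^ κ := by
    intro f i
    simp [rootCell, h4, h5]
  refine Run.seq 40 ((ν + 1) * (5000 * S) - 40) ?_
  refine Run.mapI (by simpa [h4, h5] using hst) hX1 ?_ (by decide) ?_
  · intro i hi
    simp only [eval_mul, eval_reg, h4, h5] at hi
    rw [eval_read]
    have := hσ.tree_le (rootCell.eval σ i)
    omega
  refine Run.seq 40 ((ν + 1) * (5000 * S) - 80) ?_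
  refine Run.mapR (by simpa [h4, h5] using hst) hX1 ?_ (by decide) ?_
  · intro i hi
    simp only [eval_mul, eval_reg, setI_int, Nat.reduceEqDiff, if_false, h4, h5] at hi
    omega
  refine Run.seq 20 ((ν + 1) * (5000 * S) - 100) ?_
  refine Run.setReg hX1 ?_ (by decide) ?_
  · simp only [eval_mul, eval_reg, setI_int, setR_int, Nat.reduceEqDiff, if_false, h5]
    omega
  refine Run.seq 20 ((ν + 1) * (5000 * S) - 120) ?_
  refine Run.setReg hX1 ?_ (by decide) ?_
  · simp only [eval_mul, eval_reg, setI_int, setR_int, Nat.reduceEqDiff, if_false, if_true, h5, h4]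
    omega
  refine Run.seq 20 ((ν + 1) * (5000 * S) - 140) ?_
  refine Run.setReg hX1 ?_ (by decide) ?_
  · rw [eval_one]
    have : 0 < 2 ^ ν := by positivity
    omega
  simp only [eval_mul, eval_reg, eval_one, h4, h5, setI_int, setR_int, setI_real, Nat.reduceEqDiff,
    if_false, if_true, eval_read, evalR_read, hroot, hroot']
  set τ := ((((σ.setI 16 _).setR 5 _).setI 7 _).setI 6 _).setI 18 _ with hτ
  have hf : Frame [6, 7, 8, 9, 10, 11, 12, 16, 18] [2, 5] σ τ :=
    (Frame.refl σ).setI.setR.setI.setI.setI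
  have hset : Setup ν κ τ := by
    obtain ⟨a1, a2, a3, a4, a5⟩ := hσ
    refine ⟨?_, ?_, ?_, ?_, ?_⟩ <;> simpa [hτ]
  have hb : ∀ i, τ.int 16 i ≤ 2 ^ ν := by
    intro i
    simp only [hτ, setI_int, setR_int, Nat.reduceEqDiff, if_false, if_true]
    split_ifs
    · exact hσ.tree_le _
    · exact hball i
  have hJ : J 0 (ball κ τ) := by
    refine h0 _ fun v hv k hk => ?_
    simp only [ball, node, tree, hτ, setI_int, setR_int, setI_real, setR_real, Nat.reduceEqDiff,
      if_false, if_true, if_pos (seg_lt hv hk), seg_div v hk, seg_mod v hk]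
  have h6 : τ.int 6 0 = 2 ^ ν * 2 ^ (2 * κ) := by simp [hτ, hp2]
  have h7 : τ.int 7 0 = 2 ^ (2 * κ) := by simp [hτ, hp2]
  have h18 : τ.int 18 0 = 1 := by simp [hτ]
  clear_value τ
  refine Run.loop ν (3600 * S + 300) (fun m ρ => ρ.int 18 0 = 2 ^ m ∧ Setup ν κ ρ ∧
    (∀ i, ρ.int 16 i ≤ 2 ^ ν) ∧ Frame [8, 9, 10, 11, 12, 16, 18] [2, 5] τ ρ ∧ J m (ball κ ρ))
    hX1 ⟨by simpa using h18, hset, hb, Frame.refl _, hJ⟩ ?_ ?_ ?_ ?_ ?_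
  · rintro m hm ρ ⟨q1, q2, -⟩
    simp only [eval_le, eval_add, eval_reg, q1, q2.size, eval_one]
    rw [if_pos (Nat.succ_le_of_lt (Nat.pow_lt_pow_right (by norm_num) hm))]
    exact one_ne_zero
  · rintro m hm ρ ⟨q1, q2, q3, q4, q5⟩
    refine (square_run b q2 q3 q1 (Nat.pow_le_pow_right (by norm_num) hm.le)
      (by rw [q4.int 7 (by decide), h7]) (by rw [q4.int 6 (by decide), h6])).mono le_rfl ?_
    rintro ρ' ⟨r1, r2, r3, r4, r5⟩
    exact ⟨by rw [r1, ← pow_succ], r2, r3, q4.comp r4, hstep m _ _ q5 r5⟩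
  · rintro ρ ⟨q1, q2, -⟩
    simp only [eval_le, eval_add, eval_reg, q1, q2.size, eval_one]
    rw [if_neg (by omega)]
  · rintro ρ ⟨-, q2, q3, q4, q5⟩
    exact ⟨q2, q3, hf.comp q4.mono, q5⟩
  · have hc : (IExp.le (reg 18 + 1) (reg 4)).cost = 7 := rfl
    have h1 : ν * (7 + (3600 * S + 300)) = 3600 * (ν * S) + 307 * ν := by ring
    have h2 : ν ≤ ν * S := Nat.le_mul_of_pos_right _ hS1
    rw [hc, h1, hDD]
    omega

/-! ## Settling vertices -/

/-- Find the best vertices outside the marked set, and mark them with their distances. -/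
def settle : Prog :=
  setReg 6 (reg 4 * reg 5) ;;
  setReg 7 (reg 6) ;;
  mapI (reg 6) 11 (.ite (.read 3 (.idx / reg 5)) (.read 16 .idx) 0) ;;
  mapR (reg 6) 2 (.read 1 (.idx / reg 5) + .read 5 .idx) ;;
  topk ;;
  mapI (reg 5) 13 (.read 11 .idx - 1) ;;
  .parR (reg 5) (.read 11 .idx) 1 (.read 11 .idx - 1) (.read 2 .idx) ;;
  .parI (reg 5) (.read 11 .idx) 3 (.read 11 .idx - 1) 1

/-- All balls together form a single segment, so one selection compares the offers of all marked
vertices. The selected words are distinct, hence the labels and marks are written without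
collisions. -/
theorem settle_run (b : Bounds B X ν κ) {σ : Mem} (hσ : Setup ν κ σ)
    (hball : ∀ i, σ.int 16 i ≤ 2 ^ ν) :
    Run B X settle σ (3600 * ((ν + 1) * (ν + 1)) + 400) fun σ' =>
      Setup ν κ σ' ∧ Frame [3, 6, 7, 8, 9, 10, 11, 12, 13] [1, 2] σ σ' ∧
      ∃ F : ℕ → ℕ × ℝ,
        IsTopK (2 ^ κ) (relaxSet (2 ^ ν) (2 ^ κ) (σ.int 3) (σ.real 1) (ball κ σ)) F ∧
        (∀ k < 2 ^ κ, σ'.int 13 k = (F k).1 - 1) ∧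
        ∀ x, (∃ k < 2 ^ κ, (F k).1 = x + 1 ∧ σ'.int 3 x = 1 ∧ σ'.real 1 x = (F k).2) ∨
          ((∀ k < 2 ^ κ, (F k).1 ≠ x + 1) ∧ σ'.int 3 x = σ.int 3 x ∧
            σ'.real 1 x = σ.real 1 x) := by
  have hX1 := b.width_pos
  have hXB := b.width_le
  have hst := width_lists b
  have h4B := b.four_lt
  have hKN := b.pow_le
  have hKB := b.lt_word (le_sq_pow ν) (le_sq_pow κ)
  have hK : 0 < 2 ^ κ := by positivity
  have hN : 0 < 2 ^ ν := by positivity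
  have hp2 : 2 ^ (ν + κ) = 2 ^ ν * 2 ^ κ := pow_add _ _ _
  have hKX : 2 ^ κ ≤ X := (Nat.le_mul_of_pos_left _ hN).trans hst
  have h4 := hσ.size
  have h5 := hσ.len
  refine Run.seq 20 (3600 * ((ν + 1) * (ν + 1)) + 380) ?_
  refine Run.setReg hX1 ?_ (by decide) ?_
  · simp only [eval_mul, eval_reg, h4, h5]
    omega
  refine Run.seq 20 (3600 * ((ν + 1) * (ν + 1)) + 360) ?_
  refine Run.setReg hX1 ?_ (by decide) ?_
  · simp only [eval_mul, eval_reg, h4, h5, setI_int, if_true]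
    omega
  simp only [eval_mul, eval_reg, h4, h5, setI_int, if_true]
  set τ := (σ.setI 6 _).setI 7 _ with hτ
  have hf : Frame [6, 7] [] σ τ := (Frame.refl σ).setI.setI
  have h6 : τ.int 6 0 = 2 ^ ν * 2 ^ κ := by simp [hτ]
  have h7 : τ.int 7 0 = 2 ^ (ν + κ) := by simp [hτ, hp2]
  clear_value τ
  have a5 : τ.int 5 0 = 2 ^ κ := by rw [hf.int 5 (by decide), h5]
  have hval : ∀ i, IExp.eval τ i (.ite (.read 3 (.idx / reg 5)) (.read 16 .idx) 0) =
      if σ.int 3 (i / 2 ^ κ) = 0 then 0 else σ.int 16 i := by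
    intro i
    simp [a5, hf.int 3, hf.int 16]
  have hvalR : ∀ f i, RExp.eval (τ.setI 11 f) i (.read 1 (.idx / reg 5) + .read 5 .idx) =
      σ.real 1 (i / 2 ^ κ) + σ.real 5 i := by
    intro f i
    simp [a5, hf.real 1, hf.real 5]
  have hle : ∀ i, (if σ.int 3 (i / 2 ^ κ) = 0 then 0 else σ.int 16 i) ≤ 2 ^ ν := by
    intro i
    split_ifs
    · omega
    · exact hball _
  refine Run.seq 30 (3600 * ((ν + 1) * (ν + 1)) + 330) ?_
  refine Run.mapI (by simpa [h6] using hst) hX1 ?_ (by decide) ?_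
  · intro i hi
    rw [eval_reg, h6] at hi
    rw [hval]
    have := hle i
    omega
  refine Run.seq 30 (3600 * ((ν + 1) * (ν + 1)) + 300) ?_
  refine Run.mapR (by simpa [h6] using hst) hX1 ?_ (by decide) ?_
  · intro i hi
    simp only [eval_reg, setI_int, Nat.reduceEqDiff, if_false, h6] at hi
    omega
  simp only [eval_reg, h6, setI_int, setI_real, Nat.reduceEqDiff, if_false, hval, hvalR]
  set τ₁ := (τ.setI 11 _).setR 2 _ with hτ₁
  have hf₁ : Frame [6, 7, 8, 9, 10, 11, 12] [2] σ τ₁ := (hf.mono).setI.setR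
  have hbuf : ∀ i < 2 ^ ν * 2 ^ κ, buf τ₁ i =
      (if σ.int 3 (i / 2 ^ κ) = 0 then 0 else σ.int 16 i, σ.real 1 (i / 2 ^ κ) + σ.real 5 i) := by
    intro i hi
    simp only [buf, hτ₁, setR_int, setI_int, if_true, if_pos hi, setR_real]
  have hw : ∀ i, τ₁.int 11 i ≤ 2 ^ ν := by
    intro i
    simp only [hτ₁, setR_int, setI_int, if_true]
    by_cases hi : i < 2 ^ ν * 2 ^ κ
    · rw [if_pos hi]
      exact hle i
    · rw [if_neg hi, hf.int 11 (by decide)]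
      exact hσ.buf_le i
  have b6 : τ₁.int 6 0 = 1 * 2 ^ (ν + κ) := by
    rw [one_mul, hp2]
    simp [hτ₁, h6]
  have b7 : τ₁.int 7 0 = 2 ^ (ν + κ) := by simp [hτ₁, h7]
  clear_value τ₁
  refine Run.seq (3600 * ((ν + 1) * (ν + 1))) 300 ?_
  refine (topk_run_le (q := 1) (l := ν + κ) b b7 b6 (by rw [hf₁.int 4 (by decide), h4])
    (by rw [one_mul, hp2]; exact hst) (by have := b.le; omega)
    (Nat.mul_pos hN hK) (by rw [hp2]; omega) hw).mono le_rfl ?_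
  rintro τ₂ ⟨htop, hw₂, hf₂⟩
  have hf2 : Frame [6, 7, 8, 9, 10, 11, 12] [2] σ τ₂ := hf₁.comp hf₂.mono
  have e5 : τ₂.int 5 0 = 2 ^ κ := by rw [hf2.int 5 (by decide), h5]
  have htk := htop 0 one_pos (2 ^ κ) (by rw [hp2]; exact Nat.le_mul_of_pos_left _ hN)
  simp only [zero_mul, zero_add] at htk
  -- An empty entry yields the target `0` by truncated subtraction. This is harmless: leaves are
  -- recomputed from the current marks, whatever the target.
  refine Run.seq 100 200 ?_
  refine Run.mapI (by simpa [e5] using hKX) hX1 ?_ (by decide) ?_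
  · intro i hi
    rw [eval_reg, e5] at hi
    simp only [eval_sub, eval_read, eval_idx, eval_one]
    have := hw₂ i
    omega
  refine Run.seq 100 100 ?_
  refine Run.parR (by simpa [e5] using hKX) hX1 ?_ (by decide) ?_
  · intro i hi _
    simp only [eval_sub, eval_read, eval_idx, eval_one, setI_int, Nat.reduceEqDiff, if_false]
    have := hw₂ i
    omega
  refine Run.parI (by simpa [e5] using hKX) hX1 ?_ (by decide) ?_
  · intro i hi _
    simp only [eval_sub, eval_read, eval_idx, eval_one, setI_int, setR_int, Nat.reduceEqDiff,
      if_false]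
    have := hw₂ i
    omega
  set σ' := ((τ₂.setI 13 _).setR 1 _).setI 3 _ with hσ'
  simp only [eval_reg, e5, eval_sub, eval_read, eval_idx, eval_one, evalR_read, setI_int, setR_int,
    setI_real, Nat.reduceEqDiff, if_false] at hσ'
  have hf' : Frame [3, 6, 7, 8, 9, 10, 11, 12, 13] [1, 2] σ σ' := (hf2.mono).setI.setR.setI
  have h13 : ∀ i, σ'.int 13 i = if i < 2 ^ κ then τ₂.int 11 i - 1 else σ.int 13 i := by
    intro i
    simp only [hσ', setI_int, setR_int, Nat.reduceEqDiff, if_false, if_true, hf2.int 13 (by decide)]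
  have h3 : σ'.int 3 = scatter (2 ^ κ) (fun i => τ₂.int 11 i ≠ 0) (fun i => τ₂.int 11 i - 1)
      (fun _ => 1) (σ.int 3) := by
    simp only [hσ', setI_int, if_true, hf2.int 3 (by decide)]
  have h1 : σ'.real 1 = scatter (2 ^ κ) (fun i => τ₂.int 11 i ≠ 0) (fun i => τ₂.int 11 i - 1)
      (fun i => τ₂.real 2 i) (σ.real 1) := by
    simp only [hσ', setI_real, setR_real, if_true, hf2.real 1 (by decide)]
  have h11 : ∀ i, σ'.int 11 i = τ₂.int 11 i := by
    intro i
    simp [hσ']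
  clear_value σ'
  refine ⟨⟨?_, ?_, ?_, ?_, ?_⟩, hf', buf τ₂, ?_, ?_, ?_⟩
  · rw [hf'.int 4 (by decide), h4]
  · rw [hf'.int 5 (by decide), h5]
  · intro i
    rw [h11]
    exact hw₂ i
  · rw [hf'.int 14 (by decide)]
    exact hσ.tree_le
  · intro i
    rw [h13]
    have := hw₂ i
    have := hσ.targets i
    split_ifs <;> omega
  · refine htk.congr_set fun p hp => ?_
    simp only [relaxSet, segSet, Set.mem_ofPred_eq, zero_mul, zero_add, hp2]
    constructor
    · rintro ⟨u, hu, k, hk, h0, rfl⟩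
      refine ⟨u * 2 ^ κ + k, seg_lt hu hk, ?_⟩
      rw [hbuf _ (seg_lt hu hk), seg_div u hk, if_neg h0]
      rfl
    · rintro ⟨i, hi, rfl⟩
      rw [hbuf i hi] at hp ⊢
      have hi' : i / 2 ^ κ * 2 ^ κ + i % 2 ^ κ = i := by
        rw [mul_comm, Nat.div_add_mod]
      have hs : σ.int 3 (i / 2 ^ κ) ≠ 0 := fun h => hp (if_pos h)
      refine ⟨i / 2 ^ κ, (Nat.div_lt_iff_lt_mul hK).2 hi, i % 2 ^ κ, Nat.mod_lt _ hK, hs, ?_⟩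
      simp only [ball, hi', if_neg hs]
  · intro k hk
    rw [h13, if_pos hk]
    rfl
  · intro x
    by_cases hex : ∃ k < 2 ^ κ, τ₂.int 11 k = x + 1
    · left
      obtain ⟨k, hk, hkx⟩ := hex
      have hinj : ∀ i' < 2 ^ κ, τ₂.int 11 i' ≠ 0 → τ₂.int 11 i' - 1 = τ₂.int 11 k - 1 → i' = k := by
        intro i' hi' h0 he
        exact htk.inj i' hi' k hk h0 (by simp only [buf]; omega)
      have hk0 : τ₂.int 11 k ≠ 0 := by omega
      have hx : τ₂.int 11 k - 1 = x := by omega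
      refine ⟨k, hk, hkx, ?_, ?_⟩
      · rw [h3, ← hx]
        exact scatter_inj (addr := fun i => τ₂.int 11 i - 1) hk hk0 hinj
      · rw [h1, ← hx]
        exact scatter_inj (addr := fun i => τ₂.int 11 i - 1) hk hk0 hinj
    · right
      have hno : ∀ k < 2 ^ κ, τ₂.int 11 k ≠ 0 → τ₂.int 11 k - 1 ≠ x := by
        intro k hk h0 he
        exact hex ⟨k, hk, by omega⟩
      refine ⟨fun k hk he => hex ⟨k, hk, he⟩, ?_, ?_⟩
      · rw [h3]
        exact scatter_of_not hno
      · rw [h1]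
        exact scatter_of_not hno

end PRAM

namespace PRAM

/-! ## Chains in reflexive weighted digraphs -/

section Chain

variable (adj : ℕ → ℕ → Prop) (wt : ℕ → ℕ → ℝ) (R : ℕ → Prop)

/-- `l` lists the vertices after `u` of a walk, all of which satisfy `R`. -/
def Chain : ℕ → List ℕ → Prop
  | _, [] => True
  | u, a :: l => adj u a ∧ R a ∧ Chain a l

/-- The weight of a chain. -/
def chainWeight : ℕ → List ℕ → ℝ
  | _, [] => 0
  | u, a :: l => wt u a + chainWeight a l

/-- The last vertex of a chain. -/
def chainEnd : ℕ → List ℕ → ℕ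
  | u, [] => u
  | _, a :: l => chainEnd a l

/-- A digraph on the numbers below `N` with non-negative weights, and loops of weight zero at all
heads of edges. -/
structure ReflGraph (N : ℕ) : Prop where
  lt : ∀ u v, adj u v → v < N
  refl : ∀ u v, adj u v → adj v v
  diag : ∀ v, adj v v → wt v v = 0
  nonneg : ∀ u v, adj u v → 0 ≤ wt u v

variable {adj wt R}

theorem chain_append {u : ℕ} {l l' : List ℕ} :
    Chain adj R u (l ++ l') ↔ Chain adj R u l ∧ Chain adj R (chainEnd u l) l' := by
  induction l generalizing u with
  | nil => simp [Chain, chainEnd]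
  | cons a l ih => simp [Chain, chainEnd, ih, and_assoc]

theorem chainWeight_append {u : ℕ} {l l' : List ℕ} :
    chainWeight wt u (l ++ l') = chainWeight wt u l + chainWeight wt (chainEnd u l) l' := by
  induction l generalizing u with
  | nil => simp [chainWeight, chainEnd]
  | cons a l ih => simp [chainWeight, chainEnd, ih, add_assoc]

theorem chainEnd_append {u : ℕ} {l l' : List ℕ} :
    chainEnd u (l ++ l') = chainEnd (chainEnd u l) l' := by
  induction l generalizing u with
  | nil => simp [chainEnd]
  | cons a l ih => simp [chainEnd, ih]

variable {N : ℕ}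

theorem chainWeight_nonneg (hG : ReflGraph adj wt N) {u : ℕ} {l : List ℕ} (hl : Chain adj R u l) :
    0 ≤ chainWeight wt u l := by
  induction l generalizing u with
  | nil => exact le_rfl
  | cons a l ih => exact add_nonneg (hG.nonneg _ _ hl.1) (ih hl.2.2)

theorem Chain.refl_end (hG : ReflGraph adj wt N) {u : ℕ} {l : List ℕ} (hl : Chain adj R u l)
    (h0 : l ≠ []) : adj (chainEnd u l) (chainEnd u l) := by
  induction l generalizing u with
  | nil => exact absurd rfl h0
  | cons a l ih =>
    by_cases hl0 : l = []
    · subst hl0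
      exact hG.refl _ _ hl.1
    · exact ih hl.2.2 hl0

theorem Chain.lt_of_mem (hG : ReflGraph adj wt N) {u : ℕ} {l : List ℕ} (hl : Chain adj R u l)
    {x : ℕ} (hx : x ∈ l) : x < N := by
  induction l generalizing u with
  | nil => simp at hx
  | cons a l ih =>
    rcases List.mem_cons.1 hx with rfl | hx
    · exact hG.lt _ _ hl.1
    · exact ih hl.2.2 hx

/-- If the first listed vertex recurs, the closed walk between the two occurrences is cut out, which
cannot increase a non-negative weight. The number `n` serves only for induction on the length. -/
theorem Chain.exists_nodup (hG : ReflGraph adj wt N) (n : ℕ) :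
    ∀ {u : ℕ} {l : List ℕ}, l.length ≤ n → Chain adj R u l →
    ∃ l', l'.Nodup ∧ l' ⊆ l ∧ Chain adj R u l' ∧ chainEnd u l' = chainEnd u l ∧
      chainWeight wt u l' ≤ chainWeight wt u l := by
  induction n with
  | zero =>
    intro u l hn hl
    obtain rfl : l = [] := List.length_eq_zero_iff.1 (by omega)
    exact ⟨[], List.nodup_nil, by simp, hl, rfl, le_rfl⟩
  | succ n ih =>
    intro u l hn hl
    cases l with
    | nil => exact ⟨[], List.nodup_nil, by simp, hl, rfl, le_rfl⟩
    | cons a t =>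
      simp only [List.length_cons, Nat.add_le_add_iff_right] at hn
      by_cases ha : a ∈ t
      · obtain ⟨t₁, t₂, rfl⟩ := List.append_of_mem ha
        obtain ⟨h1, h2, h3⟩ := hl
        obtain ⟨h4, h5, -, h6⟩ := chain_append.1 h3
        have hlen : (a :: t₂).length ≤ n := by
          simp only [List.length_append, List.length_cons] at hn ⊢
          omega
        obtain ⟨l', k1, k2, k3, k4, k5⟩ := ih (u := u) (l := a :: t₂) hlen ⟨h1, h2, h6⟩
        refine ⟨l', k1, fun x hx => ?_, k3, ?_, k5.trans ?_⟩
        · have := k2 hx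
          simp only [List.mem_cons, List.mem_append] at this ⊢
          tauto
        · rw [k4]
          simp only [chainEnd, chainEnd_append]
        · simp only [chainWeight, chainWeight_append]
          have := chainWeight_nonneg hG h4
          have := hG.nonneg _ _ h5
          linarith
      · obtain ⟨l', k1, k2, k3, k4, k5⟩ := ih hn hl.2.2
        exact ⟨a :: l', List.nodup_cons.2 ⟨fun h => ha (k2 h), k1⟩,
          List.cons_subset_cons _ k2, ⟨hl.1, hl.2.1, k3⟩, k4, add_le_add_right k5 _⟩

/-- Chains can be brought to any length that is at least `N`. -/
theorem Chain.exists_length (hG : ReflGraph adj wt N) {u : ℕ} {l : List ℕ}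
    (hl : Chain adj R u l)
    (hR : R (chainEnd u l)) (hr : adj (chainEnd u l) (chainEnd u l)) {h : ℕ} (hN : N ≤ h) :
    ∃ l', l'.length = h ∧ Chain adj R u l' ∧ chainEnd u l' = chainEnd u l ∧
      chainWeight wt u l' ≤ chainWeight wt u l := by
  obtain ⟨l', k1, -, k3, k4, k5⟩ := Chain.exists_nodup hG l.length le_rfl hl
  have hlen : l'.length ≤ N := by
    have h1 : l'.toFinset ⊆ Finset.range N := fun x hx =>
      Finset.mem_range.2 (Chain.lt_of_mem hG k3 (List.mem_toFinset.1 hx))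
    have h2 := Finset.card_le_card h1
    rwa [List.toFinset_card_of_nodup k1, Finset.card_range] at h2
  -- A repetition-free chain has at most `N` vertices; the missing hops are spent on the free loop
  -- at its end.
  have hrep : ∀ (x m : ℕ), R x → adj x x → Chain adj R x (List.replicate m x) ∧
      chainEnd x (List.replicate m x) = x ∧ chainWeight wt x (List.replicate m x) = 0 := by
    intro x m hx hxx
    induction m with
    | zero => exact ⟨trivial, rfl, rfl⟩
    | succ m ih =>
      refine ⟨⟨hxx, hx, ih.1⟩, ih.2.1, ?_⟩
      rw [List.replicate_succ, chainWeight, ih.2.2, hG.diag _ hxx, add_zero]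
  obtain ⟨r1, r2, r3⟩ := hrep _ (h - l'.length) hR hr
  rw [← k4] at r1 r2 r3
  refine ⟨l' ++ List.replicate (h - l'.length) (chainEnd u l'), ?_, chain_append.2 ⟨k3, r1⟩, ?_, ?_⟩
  · simp only [List.length_append, List.length_replicate]
    omega
  · rw [chainEnd_append, r2, k4]
  · rw [chainWeight_append, r3, add_zero]
    exact k5

/-- A walk stays among the vertices with `R` after its last other vertex. -/
theorem chain_split_last {u : ℕ} {l : List ℕ} (hl : Chain adj (fun _ => True) u l) :
    Chain adj R u l ∨ ∃ l₁ l₂, l = l₁ ++ l₂ ∧ ¬ R (chainEnd u l₁) ∧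
      Chain adj R (chainEnd u l₁) l₂ := by
  induction l generalizing u with
  | nil => exact .inl trivial
  | cons a l ih =>
    rcases ih hl.2.2 with h | ⟨l₁, l₂, rfl, h1, h2⟩
    · by_cases ha : R a
      · exact .inl ⟨hl.1, ha, h⟩
      · exact .inr ⟨[a], l, rfl, ha, h⟩
    · exact .inr ⟨a :: l₁, l₂, rfl, h1, h2⟩

end Chain

/-! ## Lists that dominate -/

/-- The list `L` has an entry for `x` of value at most `ω`, or `K` entries of value at most `ω`. -/
def Dom (K : ℕ) (L : ℕ → ℕ × ℝ) (x : ℕ) (ω : ℝ) : Prop :=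
  (∃ k < K, (L k).1 = x + 1 ∧ (L k).2 ≤ ω) ∨ ∀ k < K, (L k).1 ≠ 0 ∧ (L k).2 ≤ ω

theorem Dom.mono {K : ℕ} {L : ℕ → ℕ × ℝ} {x : ℕ} {ω ω' : ℝ} (h : Dom K L x ω) (hω : ω ≤ ω') :
    Dom K L x ω' := by
  rcases h with ⟨k, hk, h1, h2⟩ | h
  · exact .inl ⟨k, hk, h1, h2.trans hω⟩
  · exact .inr fun k hk => ⟨(h k hk).1, (h k hk).2.trans hω⟩

theorem IsTopK.dom_of_mem {K : ℕ} {In : Set (ℕ × ℝ)} {L : ℕ → ℕ × ℝ} (h : IsTopK K In L)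
    {x : ℕ} {y ω : ℝ} (hx : (x + 1, y) ∈ In) (hy : y ≤ ω) : Dom K L x ω :=
  Dom.mono (h.dom _ hx (Nat.succ_ne_zero x)) hy

/-- If `K` distinct words have values at most `ω`, then so have all entries of the list. -/
theorem IsTopK.full {K : ℕ} {In : Set (ℕ × ℝ)} {L : ℕ → ℕ × ℝ} (h : IsTopK K In L) {ω : ℝ}
    (g : ℕ → ℕ) (hg : ∀ a < K, ∀ b < K, g a = g b → a = b)
    (hm : ∀ a < K, g a ≠ 0 ∧ ∃ y ≤ ω, (g a, y) ∈ In) :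
    ∀ k < K, (L k).1 ≠ 0 ∧ (L k).2 ≤ ω := by
  by_cases hall : ∀ a < K, ∃ k < K, (L k).1 = g a ∧ (L k).2 ≤ ω
  -- If all `K` words `g a` occur in the list at cost at most `ω`, they occupy `K` distinct
  -- positions, hence all of them.
  · choose! f hf using hall
    have hsurj := Finset.surjOn_of_injOn_of_card_le (s := Finset.range K) (t := Finset.range K) f
      (fun a ha => by
        rw [Finset.mem_coe, Finset.mem_range] at ha ⊢
        exact (hf a ha).1)
      (fun a ha b hb hab => by
        rw [Finset.mem_coe, Finset.mem_range] at ha hb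
        refine hg a ha b hb ?_
        rw [← (hf a ha).2.1, ← (hf b hb).2.1, hab]) le_rfl
    intro k hk
    obtain ⟨a, ha, rfl⟩ := hsurj (Finset.mem_coe.2 (Finset.mem_range.2 hk))
    rw [Finset.mem_coe, Finset.mem_range] at ha
    obtain ⟨-, h1, h2⟩ := hf a ha
    exact ⟨h1 ▸ (hm a ha).1, h2⟩
  · push Not at hall
    -- A word that is missing at this cost can only be accounted for by a full list of entries that
    -- are no worse.
    obtain ⟨a, ha, hno⟩ := hall
    obtain ⟨h0, y, hy, hin⟩ := hm a ha
    rcases h.dom _ hin h0 with ⟨k, hk, h1, h2⟩ | hfull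
    · exact absurd (h2.trans hy) (not_le.2 (hno k hk h1))
    · exact fun k hk => ⟨(hfull k hk).1, (hfull k hk).2.trans hy⟩

/-- Domination is passed on from a list to the best entries of a set with its shifted entries. -/
theorem IsTopK.dom_shift {K : ℕ} {In : Set (ℕ × ℝ)} {L M : ℕ → ℕ × ℝ} (h : IsTopK K In L)
    {c : ℝ} (hM : ∀ k < K, (M k).1 ≠ 0 → ((M k).1, c + (M k).2) ∈ In)
    (hinj : ∀ k < K, ∀ k' < K, (M k).1 ≠ 0 → (M k).1 = (M k').1 → k = k') {x : ℕ} {ω : ℝ}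
    (hd : Dom K M x ω) : Dom K L x (c + ω) := by
  rcases hd with ⟨k, hk, h1, h2⟩ | hfull
  · have := hM k hk (by omega)
    rw [h1] at this
    exact h.dom_of_mem this (by linarith)
  · refine .inr (h.full (fun a => (M a).1) (fun a ha b hb => hinj a ha b hb (hfull a ha).1)
      fun a ha => ⟨(hfull a ha).1, _, ?_, hM a ha (hfull a ha).1⟩)
    have := (hfull a ha).2
    linarith

-- Nearest unsettled vertices by walks with a bounded number of hops.

section Ball

variable {adj : ℕ → ℕ → Prop} {wt : ℕ → ℕ → ℝ} {R : ℕ → Prop} {N K : ℕ}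

/-- The lists `L` contain the vertices with `R` that are nearest by chains of `h` hops. -/
structure BallInv (adj : ℕ → ℕ → Prop) (wt : ℕ → ℕ → ℝ) (R : ℕ → Prop) (N K h : ℕ)
    (L : ℕ → ℕ → ℕ × ℝ) : Prop where
  sound : ∀ v < N, ∀ k < K, (L v k).1 ≠ 0 → R ((L v k).1 - 1) ∧ adj ((L v k).1 - 1) ((L v k).1 - 1) ∧
    ∃ l, Chain adj (fun _ => True) v l ∧ chainEnd v l = (L v k).1 - 1 ∧
      chainWeight wt v l = (L v k).2
  inj : ∀ v < N, ∀ k < K, ∀ k' < K, (L v k).1 ≠ 0 → (L v k).1 = (L v k').1 → k = k'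
  dom : ∀ v < N, ∀ l, l.length = h → Chain adj R v l → Dom K (L v) (chainEnd v l) (chainWeight wt v l)

/-- A walk of `2 * h` hops is halved at a middle vertex. If the list of `v` has that vertex at no
greater cost, the list of the middle vertex dominates the second half, and the shift carries this
over. Otherwise the list of `v` is full of entries no worse than the first half, and `K` distinct
words in the join have to be exhibited at that cost. Either some member has a full list of entries
of value at most `0`, and these serve, or every member occurs in its own list at value at most `0`,
and the members themselves serve. -/
theorem BallInv.square (hG : ReflGraph adj wt N) {h : ℕ} {L L' : ℕ → ℕ → ℕ × ℝ}
    (hL : BallInv adj wt R N K h L) (hL' : ∀ v < N, IsTopK K (joinSet K L v) (L' v)) :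
    BallInv adj wt R N K (h * 2) L' := by
  refine ⟨?_, fun v hv => (hL' v hv).inj, ?_⟩
  · intro v hv k hk h0
    obtain ⟨a, ha, c, hc, hm, he⟩ := (hL' v hv).mem k hk h0
    obtain ⟨-, r2, l₁, l1, l2, l3⟩ := hL.sound v hv a ha hm
    rw [he] at h0 ⊢
    obtain ⟨s1, s2, l₂, s3, s4, s5⟩ := hL.sound _ (hG.lt _ _ r2) c hc h0
    rw [← l2] at s3
    exact ⟨s1, s2, l₁ ++ l₂, chain_append.2 ⟨l1, s3⟩, by rw [chainEnd_append, l2, s4],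
      by rw [chainWeight_append, l2, l3, s5]⟩
  · intro v hv l hl hc
    obtain ⟨l₁, l₂, rfl, e1, e2⟩ : ∃ l₁ l₂, l = l₁ ++ l₂ ∧ l₁.length = h ∧ l₂.length = h :=
      ⟨l.take h, l.drop h, (List.take_append_drop h l).symm, by simp; omega, by simp; omega⟩
    obtain ⟨c1, c2⟩ := chain_append.1 hc
    rw [chainEnd_append, chainWeight_append]
    have hmid : ∀ a < K, (L v a).1 ≠ 0 → ∀ k < K, (L ((L v a).1 - 1) k).1 ≠ 0 →
        ((L ((L v a).1 - 1) k).1, (L v a).2 + (L ((L v a).1 - 1) k).2) ∈ joinSet K L v :=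
      fun a ha h0 k hk _ => ⟨a, ha, k, hk, h0, rfl⟩
    have hlt : ∀ a < K, (L v a).1 ≠ 0 → (L v a).1 - 1 < N := fun a ha h0 =>
      hG.lt _ _ (hL.sound v hv a ha h0).2.1
    have hw2 := chainWeight_nonneg hG c2
    rcases hL.dom v hv l₁ e1 c1 with ⟨a, ha, h1, h2⟩ | hfull
    · have h0 : (L v a).1 ≠ 0 := by omega
      have hu : (L v a).1 - 1 = chainEnd v l₁ := by omega
      have hd := hL.dom _ (hu ▸ hlt a ha h0) l₂ e2 c2
      rw [← hu] at hd ⊢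
      refine Dom.mono ((hL' v hv).dom_shift (hmid a ha h0) (hL.inj _ (hlt a ha h0)) hd) ?_
      linarith
    · right
      -- The walk that takes the free loop `h` times has exactly `h` hops and weight zero.
      have hself : ∀ a < K, Dom K (L ((L v a).1 - 1)) ((L v a).1 - 1) 0 := by
        intro a ha
        obtain ⟨s1, s2, -⟩ := hL.sound v hv a ha (hfull a ha).1
        have hrep : ∀ m, Chain adj R ((L v a).1 - 1) (List.replicate m ((L v a).1 - 1)) ∧
            chainEnd ((L v a).1 - 1) (List.replicate m ((L v a).1 - 1)) = (L v a).1 - 1 ∧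
            chainWeight wt ((L v a).1 - 1) (List.replicate m ((L v a).1 - 1)) = 0 := by
          intro m
          induction m with
          | zero => exact ⟨trivial, rfl, rfl⟩
          | succ m ih =>
            refine ⟨⟨s2, s1, ih.1⟩, ih.2.1, ?_⟩
            rw [List.replicate_succ, chainWeight, ih.2.2, hG.diag _ s2, add_zero]
        obtain ⟨q1, q2, q3⟩ := hrep h
        have := hL.dom _ (hlt a ha (hfull a ha).1) _ (List.length_replicate ..) q1
        rwa [q2, q3] at this
      by_cases hex : ∃ a < K, ∀ k < K, (L ((L v a).1 - 1) k).1 ≠ 0 ∧ (L ((L v a).1 - 1) k).2 ≤ 0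
      · obtain ⟨a, ha, hfa⟩ := hex
        have h0 := (hfull a ha).1
        have hfa' : Dom K (L ((L v a).1 - 1)) 0 0 := .inr hfa
        refine (hL' v hv).full (fun k => (L ((L v a).1 - 1) k).1)
          (fun k hk k' hk' => hL.inj _ (hlt a ha h0) k hk k' hk' (hfa k hk).1)
          fun k hk => ⟨(hfa k hk).1, _, ?_, hmid a ha h0 k hk (hfa k hk).1⟩
        have := (hfull a ha).2
        have := (hfa k hk).2
        linarith
      · push Not at hex
        refine (hL' v hv).full (fun a => (L v a).1)
          (fun a ha b hb => hL.inj v hv a ha b hb (hfull a ha).1) fun a ha => ⟨(hfull a ha).1, ?_⟩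
        have h0 := (hfull a ha).1
        rcases hself a ha with ⟨k, hk, h1, h2⟩ | hf
        · have hm := hmid a ha h0 k hk (by omega)
          have h3 : (L ((L v a).1 - 1) k).1 = (L v a).1 := by omega
          rw [h3] at hm
          refine ⟨_, ?_, hm⟩
          have := (hfull a ha).2
          linarith
        · obtain ⟨k, hk, hn⟩ := hex a ha
          exact absurd (hf k hk).2 (not_le.2 (hn (hf k hk).1))

/-- `d` is the least weight of a walk from `s` to `x`. -/
def IsDist (adj : ℕ → ℕ → Prop) (wt : ℕ → ℕ → ℝ) (s x : ℕ) (d : ℝ) : Prop :=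
  (∃ l, Chain adj (fun _ => True) s l ∧ chainEnd s l = x ∧ chainWeight wt s l = d) ∧
  ∀ l, Chain adj (fun _ => True) s l → chainEnd s l = x → d ≤ chainWeight wt s l

/-- The best vertices outside the marked set are found with their distances, provided that the
distances of the marked vertices are correct. -/
theorem relax_exact (hG : ReflGraph adj wt N) {S : ℕ → ℕ} {d : ℕ → ℝ} {L : ℕ → ℕ → ℕ × ℝ}
    {F : ℕ → ℕ × ℝ} {s h : ℕ} (hN : N ≤ h) (hL : BallInv adj wt (fun x => S x = 0) N K h L)
    (hs : S s ≠ 0) (hlt : ∀ u, S u ≠ 0 → u < N) (hS : ∀ u, S u ≠ 0 → IsDist adj wt s u (d u))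
    (hF : IsTopK K (relaxSet N K S d L) F) :
    (∀ k < K, (F k).1 ≠ 0 → S ((F k).1 - 1) = 0 ∧ IsDist adj wt s ((F k).1 - 1) (F k).2 ∧
      (F k).1 - 1 < N) ∧
    ((∀ k < K, (F k).1 ≠ 0) ∨ ∀ l, Chain adj (fun _ => True) s l →
      S (chainEnd s l) = 0 → ∃ k < K, (F k).1 = chainEnd s l + 1) := by
  -- The walk is cut at its last settled vertex `u`. Its head weighs at least `d u`; its tail is
  -- unsettled and nonempty, can be brought to exactly `h` hops, and is dominated by the list of
  -- `u`.
  have key : ∀ l, Chain adj (fun _ => True) s l → S (chainEnd s l) = 0 →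
      Dom K F (chainEnd s l) (chainWeight wt s l) := by
    intro l hl hx
    obtain ⟨l₁, l₂, rfl, h1, h2, h3⟩ : ∃ l₁ l₂, l = l₁ ++ l₂ ∧ S (chainEnd s l₁) ≠ 0 ∧
        Chain adj (fun x => S x = 0) (chainEnd s l₁) l₂ ∧ Chain adj (fun _ => True) s l₁ := by
      rcases chain_split_last (R := fun x => S x = 0) hl with h | ⟨l₁, l₂, rfl, h1, h2⟩
      · exact ⟨[], l, rfl, hs, h, trivial⟩
      · exact ⟨l₁, l₂, rfl, h1, h2, (chain_append.1 hl).1⟩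
    rw [chainEnd_append] at hx ⊢
    rw [chainWeight_append]
    set u := chainEnd s l₁ with hu
    have hne : l₂ ≠ [] := by
      rintro rfl
      exact h1 hx
    have hrefl := Chain.refl_end hG h2 hne
    obtain ⟨l', e1, e2, e3, e4⟩ := Chain.exists_length hG h2 hx hrefl hN
    have hd := hL.dom u (hlt u h1) l' e1 e2
    rw [e3] at hd
    have := hF.dom_shift (c := d u) (M := L u) (fun k hk _ => ⟨u, hlt u h1, k, hk, h1, rfl⟩)
      (hL.inj u (hlt u h1)) hd
    refine this.mono ?_
    have := (hS u h1).2 l₁ h3 rfl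
    linarith
  constructor
  · intro k hk h0
    obtain ⟨u, hu, k', hk', hSu, he⟩ := hF.mem k hk h0
    have h0' : (L u k').1 ≠ 0 := by
      rw [he] at h0
      exact h0
    obtain ⟨s1, s2, l₂, l1, l2, l3⟩ := hL.sound u hu k' hk' h0'
    obtain ⟨⟨l₁, m1, m2, m3⟩, -⟩ := hS u hSu
    have he1 : (F k).1 = (L u k').1 := by rw [he]
    have he2 : (F k).2 = d u + (L u k').2 := by rw [he]
    refine ⟨by rw [he1]; exact s1, ⟨⟨l₁ ++ l₂, chain_append.2 ⟨m1, m2 ▸ l1⟩, ?_, ?_⟩, ?_⟩, ?_⟩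
    · rw [chainEnd_append, m2, l2, he1]
    · rw [chainWeight_append, m2, m3, l3, he2]
    · intro l hl hx
      have := key l hl (by rw [hx, he1]; exact s1)
      rw [hx] at this
      -- Either way the walk is no lighter than the entry `k`: the entry found for its end is `k`
      -- itself by distinctness, or all entries are at most its weight.
      rcases this with ⟨j, hj, e1, e2⟩ | hfull
      · have : k = j := hF.inj k hk j hj h0 (by omega)
        rw [this]
        exact e2
      · exact (hfull k hk).2
    · rw [he1]
      exact hG.lt _ _ s2
  -- An empty place rules out the second alternative of `Dom`, so then every reachable unsettled
  -- vertex has an entry of its own.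
  · by_cases hall : ∀ k < K, (F k).1 ≠ 0
    · exact .inl hall
    · right
      intro l hl hx
      rcases key l hl hx with ⟨k, hk, e1, -⟩ | hfull
      · exact ⟨k, hk, e1⟩
      · exact absurd (fun k hk => (hfull k hk).1) hall

end Ball

end PRAM

namespace PRAM

variable {B X ν κ : ℕ}

/-! ## The main loop -/

/-- Adjacency according to the matrix `A` with `2 ^ ν` columns. -/
def MAdj (ν : ℕ) (A : ℕ → ℕ) (u v : ℕ) : Prop := u < 2 ^ ν ∧ v < 2 ^ ν ∧ A (u * 2 ^ ν + v) ≠ 0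

/-- The weights in the matrix `w` with `2 ^ ν` columns. -/
def mWt (ν : ℕ) (w : ℕ → ℝ) (u v : ℕ) : ℝ := w (u * 2 ^ ν + v)

/-- The leaves of the trees are up to date. -/
def TreeLeaf (ν κ : ℕ) (σ : Mem) : Prop :=
  ∀ v < 2 ^ ν, ∀ x < 2 ^ ν, ∀ k < 2 ^ κ, (k = 0 → node ν κ σ v (2 ^ ν + x) k = leafEntry ν σ v x) ∧
    (k ≠ 0 → (node ν κ σ v (2 ^ ν + x) k).1 = 0)

/-- The roots of the trees are the balls for one hop. -/
theorem ballInv_root {σ : Mem} (hG : ReflGraph (MAdj ν (σ.int 15)) (mWt ν (σ.real 4)) (2 ^ ν))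
    (hc : TreeCons ν κ σ) (hl : TreeLeaf ν κ σ) {L : ℕ → ℕ → ℕ × ℝ}
    (hL : ∀ v < 2 ^ ν, ∀ k < 2 ^ κ, L v k = node ν κ σ v 1 k) :
    BallInv (MAdj ν (σ.int 15)) (mWt ν (σ.real 4)) (fun x => σ.int 3 x = 0) (2 ^ ν) (2 ^ κ) 1 L := by
  have hK : 0 < 2 ^ κ := by positivity
  have hN : 0 < 2 ^ ν := by positivity
  have hinj : ∀ v < 2 ^ ν, ∀ h, 1 ≤ h → h < 2 * 2 ^ ν → ∀ k < 2 ^ κ, ∀ k' < 2 ^ κ,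
      (node ν κ σ v h k).1 ≠ 0 → (node ν κ σ v h k).1 = (node ν κ σ v h k').1 → k = k' := by
    intro v hv h h1 h2 k hk k' hk' h0 he
    by_cases hh : h < 2 ^ ν
    · exact (hc v hv h h1 hh).inj k hk k' hk' h0 he
    · obtain ⟨x, rfl⟩ := Nat.exists_eq_add_of_le (not_lt.1 hh)
      have e1 : k = 0 := by
        by_contra hne
        exact h0 ((hl v hv x (by omega) k hk).2 hne)
      have e2 : k' = 0 := by
        by_contra hne
        rw [he] at h0
        exact h0 ((hl v hv x (by omega) k' hk').2 hne)
      rw [e1, e2]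
  -- Children have larger heap numbers, so `j` decreases on the way down, and every nonempty entry
  -- is traced to a leaf.
  have hsound : ∀ j, ∀ v < 2 ^ ν, ∀ h, 1 ≤ h → h < 2 * 2 ^ ν → 2 * 2 ^ ν ≤ h + j → ∀ k < 2 ^ κ,
      (node ν κ σ v h k).1 ≠ 0 → ∃ x, σ.int 3 x = 0 ∧ MAdj ν (σ.int 15) v x ∧
        node ν κ σ v h k = (x + 1, mWt ν (σ.real 4) v x) := by
    intro j
    induction j with
    | zero =>
      intro v hv h h1 h2 h3
      omega
    | succ j ih =>
      intro v hv h h1 h2 h3 k hk h0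
      by_cases hh : h < 2 ^ ν
      · have hm := (hc v hv h h1 hh).mem k hk h0
        rw [mem_kids] at hm
        obtain ⟨k', hk', he | he⟩ := hm
        · rw [← he] at h0 ⊢
          exact ih v hv _ (by omega) (by omega) (by omega) k' hk' h0
        · rw [← he] at h0 ⊢
          exact ih v hv _ (by omega) (by omega) (by omega) k' hk' h0
      · obtain ⟨x, rfl⟩ := Nat.exists_eq_add_of_le (not_lt.1 hh)
        have e1 : k = 0 := by
          by_contra hne
          exact h0 ((hl v hv x (by omega) k hk).2 hne)
        have e2 := (hl v hv x (by omega) k hk).1 e1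
        rw [e2] at h0 ⊢
        simp only [leafEntry] at h0 ⊢
        have e3 : σ.int 3 x = 0 := by
          by_contra hne
          exact h0 (if_neg hne)
        rw [if_pos e3] at h0 ⊢
        have e4 : σ.int 15 (v * 2 ^ ν + x) ≠ 0 := fun hne => h0 (if_pos hne)
        rw [if_neg e4]
        exact ⟨x, e3, ⟨hv, by omega, e4⟩, rfl⟩
  refine ⟨?_, ?_, ?_⟩
  · intro v hv k hk h0
    rw [hL v hv k hk] at h0 ⊢
    obtain ⟨x, h1, h2, h3⟩ := hsound (2 * 2 ^ ν) v hv 1 le_rfl (by omega) (by omega) k hk h0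
    rw [h3, Nat.add_sub_cancel]
    refine ⟨h1, hG.refl _ _ h2, [x], ⟨h2, trivial, trivial⟩, rfl, ?_⟩
    simp [chainWeight]
  · intro v hv k hk k' hk'
    rw [hL v hv k hk, hL v hv k' hk']
    exact hinj v hv 1 le_rfl (by omega) k hk k' hk'
  · intro v hv l hl1 hch
    obtain ⟨x, rfl⟩ := List.length_eq_one_iff.1 hl1
    obtain ⟨h1, h2, -⟩ := hch
    obtain ⟨-, hx, hA⟩ := h1
    -- Domination holds at the leaf of `x` and survives each selection on the way up to the root,
    -- with shift zero.
    have hd : ∀ d ≤ ν, Dom (2 ^ κ) (node ν κ σ v ((2 ^ ν + x) / 2 ^ d)) x (mWt ν (σ.real 4) v x) := by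
      intro d
      induction d with
      | zero =>
        intro _
        rw [pow_zero, Nat.div_one]
        left
        refine ⟨0, hK, ?_⟩
        rw [(hl v hv x hx 0 hK).1 rfl]
        simp only [leafEntry]
        rw [if_pos h2, if_neg hA]
        exact ⟨rfl, le_rfl⟩
      | succ d ih =>
        intro hd
        have hb := anc_bounds hx hd
        have hb' := anc_bounds hx (by omega : d ≤ ν)
        have hdiv : (2 ^ ν + x) / 2 ^ (d + 1) = (2 ^ ν + x) / 2 ^ d / 2 := by
          rw [pow_succ, Nat.div_div_eq_div_mul]
        have hp : 2 * 2 ^ (ν - (d + 1)) ≤ 2 ^ ν := by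
          rw [← pow_succ']
          exact Nat.pow_le_pow_right (by norm_num) (by omega)
        have hp1 : 0 < 2 ^ (ν - (d + 1)) := by positivity
        have hp2 : 2 ^ (ν - d) ≤ 2 ^ ν := Nat.pow_le_pow_right (by norm_num) (by omega)
        have hp3 : 0 < 2 ^ (ν - d) := by positivity
        have htk := hc v hv ((2 ^ ν + x) / 2 ^ (d + 1)) (by omega) (by omega)
        have := htk.dom_shift (c := 0) (M := node ν κ σ v ((2 ^ ν + x) / 2 ^ d)) ?_
          (hinj v hv _ (by omega) (by omega)) (ih (by omega))
        · rwa [zero_add] at this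
        · intro k hk _
          rw [zero_add, mem_kids, hdiv]
          refine ⟨k, hk, ?_⟩
          rcases Nat.mod_two_eq_zero_or_one ((2 ^ ν + x) / 2 ^ d) with hp | hp
          · left
            congr 1
            omega
          · right
            congr 1
            omega
    have := hd ν le_rfl
    have h1 : (2 ^ ν + x) / 2 ^ ν = 1 := by
      rw [Nat.add_div_left _ hN, Nat.div_eq_of_lt hx]
    rw [h1] at this
    simp only [chainEnd, chainWeight, add_zero]
    refine this.imp ?_ ?_
    · rintro ⟨k, hk, e⟩
      exact ⟨k, hk, by rw [hL v hv k hk]; exact e⟩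
    · intro e k hk
      rw [hL v hv k hk]
      exact e k hk

-- The phases and their number.

/-- The invariant of the main loop, for the source `s` in the digraph with the matrices
`A` and `w`. -/
structure MainInv (ν κ : ℕ) (A : ℕ → ℕ) (w : ℕ → ℝ) (s : ℕ) (σ : Mem) : Prop where
  setup : Setup ν κ σ
  ball_le : ∀ i, σ.int 16 i ≤ 2 ^ ν
  adj : σ.int 15 = A
  wt : σ.real 4 = w
  cons : TreeCons ν κ σ
  leaf : TreeLeaf ν κ σ
  src : σ.int 3 s ≠ 0
  lt : ∀ u, σ.int 3 u ≠ 0 → u < 2 ^ ν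
  exact : ∀ u, σ.int 3 u ≠ 0 → IsDist (MAdj ν A) (mWt ν w) s u (σ.real 1 u)

/-- The number of settled vertices. -/
def settled (ν : ℕ) (σ : Mem) : ℕ := ((Finset.range (2 ^ ν)).filter fun u => σ.int 3 u ≠ 0).card

/-- All vertices that can be reached from `s` are settled. -/
def AllSettled (ν : ℕ) (A : ℕ → ℕ) (s : ℕ) (σ : Mem) : Prop :=
  ∀ l, Chain (MAdj ν A) (fun _ => True) s l → σ.int 3 (chainEnd s l) ≠ 0

/-- One phase: settle the next vertices. -/
def phase : Prog := balls ;; settle ;; update ;; setReg 20 (reg 20 + 1)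

theorem node_congr {σ σ' : Mem} (h1 : σ'.int 14 = σ.int 14) (h2 : σ'.real 3 = σ.real 3) :
    node ν κ σ' = node ν κ σ := by
  funext v h k
  simp only [node, tree, h1, h2]

theorem treeCons_congr {σ σ' : Mem} (h1 : σ'.int 14 = σ.int 14) (h2 : σ'.real 3 = σ.real 3)
    (h : TreeCons ν κ σ) : TreeCons ν κ σ' := by
  intro v hv g h3 h4
  have hn := node_congr (ν := ν) (κ := κ) h1 h2
  rw [hn, kids_congr (σ' := σ') (σ := σ) (fun _ _ => by rw [hn]) (fun _ _ => by rw [hn])]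
  exact h v hv g h3 h4

theorem phase_run (b : Bounds B X ν κ) {A : ℕ → ℕ} {w : ℕ → ℝ} {s p : ℕ}
    (hG : ReflGraph (MAdj ν A) (mWt ν w) (2 ^ ν)) {σ : Mem} (hσ : MainInv ν κ A w s σ)
    (h20 : σ.int 20 0 = p) (hp : p < 2 ^ ν) :
    Run B X phase σ ((ν + 1) * (15000 * ((ν + 1) * (ν + 1)))) fun σ' =>
      MainInv ν κ A w s σ' ∧ σ'.int 20 0 = p + 1 ∧
      (AllSettled ν A s σ → AllSettled ν A s σ') ∧
      (settled ν σ + 2 ^ κ ≤ settled ν σ' ∨ AllSettled ν A s σ') := by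
  have h4B := b.four_lt
  have hX1 := b.width_pos
  obtain ⟨hset, hball, hA, hw, hcons, hleaf, hsrc, hlt, hex⟩ := hσ
  set S := (ν + 1) * (ν + 1) with hS
  have hS1 : 1 ≤ S := Nat.mul_pos (by omega) (by omega)
  have hD5 : (ν + 1) * (5000 * S) = 5000 * (ν * S) + 5000 * S := by ring
  have hD15 : (ν + 1) * (15000 * S) = 15000 * (ν * S) + 15000 * S := by ring
  rw [hD15]
  refine Run.seq (5000 * (ν * S) + 5000 * S) (5000 * (ν * S) + 8600 * S + 1000) ?_
    (by clear hD5 hD15; clear_value S; omega)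
  rw [← hD5]
  refine (balls_run b hset hball
    (fun m => BallInv (MAdj ν A) (mWt ν w) (fun x => σ.int 3 x = 0) (2 ^ ν) (2 ^ κ) (2 ^ m))
    ?_ ?_).mono le_rfl ?_
  · intro L hL
    rw [pow_zero]
    subst hA hw
    exact ballInv_root hG hcons hleaf hL
  · intro m L L' hL hL'
    rw [pow_succ]
    exact hL.square hG hL'
  rintro τ ⟨t1, t2, t3, t4⟩
  refine Run.seq (3600 * S + 400) (5000 * (ν * S) + 5000 * S + 600) ?_
    (by clear hD5 hD15; clear_value S; omega)
  refine (settle_run b t1 t2).mono le_rfl ?_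
  rintro τ₁ ⟨u1, u2, F, u3, u4, u5⟩
  rw [t3.int 3 (by decide), t3.real 1 (by decide)] at u3
  rw [t3.int 3 (by decide), t3.real 1 (by decide)] at u5
  obtain ⟨f1, f2⟩ := relax_exact hG le_rfl t4 hsrc hlt hex u3
  have hf : Frame [3, 6, 7, 8, 9, 10, 11, 12, 13, 16, 18] [1, 2, 5] σ τ₁ :=
    Frame.comp t3.mono u2.mono
  rw [← hD5]
  refine Run.seq ((ν + 1) * (5000 * S)) 600 ?_ le_rfl
  refine (update_run b u1).mono le_rfl ?_
  rintro ρ ⟨v1, v2, v3, v4⟩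
  have hf' : Frame [3, 6, 7, 8, 9, 10, 11, 12, 13, 14, 16, 17, 18] [1, 2, 3, 5] σ ρ :=
    Frame.comp hf.mono v2.mono
  refine Run.setReg hX1 ?_ (by decide) ?_
  · simp only [eval_add, eval_reg, hf'.int 20 (by decide), h20, eval_one]
    omega
  simp only [eval_add, eval_reg, hf'.int 20 (by decide), h20, eval_one]
  set ρ' := ρ.setI 20 _ with hρ'
  have hff : Frame [20] [] ρ ρ' := (Frame.refl ρ).setI
  have e20 : ρ'.int 20 0 = p + 1 := by simp [hρ']
  clear_value ρ'
  have e3 : ρ'.int 3 = τ₁.int 3 := by rw [hff.int 3 (by decide), v2.int 3 (by decide)]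
  have e1 : ρ'.real 1 = τ₁.real 1 := by rw [hff.real 1 (by decide), v2.real 1 (by decide)]
  have e14 := hff.int 14 (by decide)
  have er3 := hff.real 3 (by decide)
  have e15 : ρ'.int 15 = σ.int 15 := by rw [hff.int 15 (by decide), hf'.int 15 (by decide)]
  have er4 : ρ'.real 4 = σ.real 4 := by rw [hff.real 4 (by decide), hf'.real 4 (by decide)]
  have hnew : ∀ x, (∃ k < 2 ^ κ, (F k).1 = x + 1 ∧ ρ'.int 3 x ≠ 0 ∧ ρ'.real 1 x = (F k).2) ∨
      ((∀ k < 2 ^ κ, (F k).1 ≠ x + 1) ∧ ρ'.int 3 x = σ.int 3 x ∧ ρ'.real 1 x = σ.real 1 x) := by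
    intro x
    rw [e3, e1]
    rcases u5 x with ⟨k, hk, h1, h2, h3⟩ | h
    · exact .inl ⟨k, hk, h1, by rw [h2]; exact one_ne_zero, h3⟩
    · exact .inr h
  have hmono : ∀ x, σ.int 3 x ≠ 0 → ρ'.int 3 x ≠ 0 := by
    intro x hx
    rcases hnew x with ⟨k, -, -, h, -⟩ | ⟨-, h, -⟩
    · exact h
    · rw [h]
      exact hx
  refine ⟨⟨?_, ?_, ?_, ?_, ?_, ?_, hmono s hsrc, ?_, ?_⟩, e20, fun h l hl => hmono _ (h l hl), ?_⟩
  · obtain ⟨a1, a2, a3, a4, a5⟩ := v1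
    refine ⟨?_, ?_, ?_, ?_, ?_⟩
    · rwa [hff.int 4 (by decide)]
    · rwa [hff.int 5 (by decide)]
    · rwa [hff.int 11 (by decide)]
    · rwa [hff.int 14 (by decide)]
    · rwa [hff.int 13 (by decide)]
  · rw [hff.int 16 (by decide), v2.int 16 (by decide), u2.int 16 (by decide)]
    exact t2
  · rw [e15, hA]
  · rw [er4, hw]
  · refine treeCons_congr e14 er3 (v3 (treeCons_congr ?_ ?_ hcons))
    · exact hf.int 14 (by decide)
    · exact hf.real 3 (by decide)
  · intro v hv x hx k hk
    rw [node_congr e14 er3]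
    have hle : leafEntry ν τ₁ v x = leafEntry ν ρ' v x := by
      simp only [leafEntry, e3, e15, er4, hf.int 15 (by decide), hf.real 4 (by decide)]
    have hnd := node_congr (ν := ν) (κ := κ) (hf.int 14 (by decide)) (hf.real 3 (by decide))
    rcases v4 v hv x hx k hk with ⟨rfl, -, h⟩ | ⟨hn, h⟩
    · exact ⟨fun _ => by rw [h, hle], fun h => absurd rfl h⟩
    · rw [h, hnd]
      refine ⟨?_, (hleaf v hv x hx k hk).2⟩
      rintro rfl
      rw [(hleaf v hv x hx 0 hk).1 rfl]
      -- All newly marked vertices are among the targets, so a leaf that was not recomputed belongs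
      -- to a vertex with an unchanged mark.
      have hxs : ρ'.int 3 x = σ.int 3 x := by
        rcases hnew x with ⟨k, hk, h1, -⟩ | ⟨-, h, -⟩
        · refine absurd ⟨rfl, k, hk, ?_⟩ hn
          rw [u4 k hk, h1, Nat.add_sub_cancel]
        · exact h
      simp only [leafEntry, hxs, e15, er4]
  · intro u hu
    rcases hnew u with ⟨k, hk, h1, -⟩ | ⟨-, h, -⟩
    · have := (f1 k hk (by omega)).2.2
      rwa [h1, Nat.add_sub_cancel] at this
    · rw [h] at hu
      exact hlt u hu
  · intro u hu
    rcases hnew u with ⟨k, hk, h1, -, h2⟩ | ⟨-, h, h2⟩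
    · have := (f1 k hk (by omega)).2.1
      rwa [h1, Nat.add_sub_cancel, ← h2] at this
    · rw [h] at hu
      rw [h2]
      exact hex u hu
  · rcases f2 with hfull | hall
    · left
      -- A full selection consists of `2 ^ κ` distinct vertices, none of them settled before.
      have hsub : (Finset.range (2 ^ κ)).image (fun k => (F k).1 - 1) ∪
          (Finset.range (2 ^ ν)).filter (fun u => σ.int 3 u ≠ 0) ⊆
          (Finset.range (2 ^ ν)).filter (fun u => ρ'.int 3 u ≠ 0) := by
        intro x hx
        simp only [Finset.mem_union, Finset.mem_image, Finset.mem_filter, Finset.mem_range] at hx ⊢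
        rcases hx with ⟨k, hk, rfl⟩ | ⟨h1, h2⟩
        · refine ⟨(f1 k hk (hfull k hk)).2.2, ?_⟩
          rcases hnew ((F k).1 - 1) with ⟨_, -, -, h, -⟩ | ⟨h, -⟩
          · exact h
          · have := hfull k hk
            exact absurd (by omega) (h k hk)
        · exact ⟨h1, hmono x h2⟩
      have hcard := Finset.card_le_card hsub
      rw [Finset.card_union_of_disjoint, Finset.card_image_of_injOn, Finset.card_range] at hcard
      · simp only [settled]
        omega
      · intro k hk k' hk' he
        rw [Finset.mem_coe, Finset.mem_range] at hk hk'
        have h1 := hfull k hk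
        have h2 := hfull k' hk'
        exact u3.inj k hk k' hk' h1 (by simp only at he; omega)
      · rw [Finset.disjoint_left]
        intro x hx
        simp only [Finset.mem_image, Finset.mem_filter, Finset.mem_range] at hx ⊢
        obtain ⟨k, hk, rfl⟩ := hx
        exact fun h => h.2 (f1 k hk (hfull k hk)).1
    · right
      intro l hl
      by_cases h0 : σ.int 3 (chainEnd s l) = 0
      · obtain ⟨k, hk, h1⟩ := hall l hl h0
        rcases hnew (chainEnd s l) with ⟨_, -, -, h, -⟩ | ⟨h, -⟩
        · exact h
        · exact absurd h1 (h k hk)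
      · exact hmono _ h0

/-- All phases. -/
def phases : Prog := .loop (.le (reg 20 * reg 5 + 1) (reg 4)) phase

/-- The source contributes the `+ 1` in the count. If all `2 ^ (ν - κ)` phases gained `2 ^ κ`
vertices, then `2 ^ ν + 1` of the `2 ^ ν` vertices would be settled; so the reachable ones must have
been exhausted. -/
theorem phases_run (b : Bounds B X ν κ) {A : ℕ → ℕ} {w : ℕ → ℝ} {s : ℕ}
    (hG : ReflGraph (MAdj ν A) (mWt ν w) (2 ^ ν)) {σ : Mem} (hσ : MainInv ν κ A w s σ)
    (h20 : σ.int 20 0 = 0) :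
    Run B X phases σ (2 ^ (ν - κ) * ((ν + 1) * (16000 * ((ν + 1) * (ν + 1))))) fun σ' =>
      MainInv ν κ A w s σ' ∧ AllSettled ν A s σ' := by
  have hX1 := b.width_pos
  have hpow : 2 ^ (ν - κ) * 2 ^ κ = 2 ^ ν := by rw [← pow_add, Nat.sub_add_cancel b.le]
  have hK : 0 < 2 ^ κ := by positivity
  have hP : 0 < 2 ^ (ν - κ) := by positivity
  refine Run.loop (2 ^ (ν - κ)) ((ν + 1) * (15000 * ((ν + 1) * (ν + 1))))
    (fun p τ => MainInv ν κ A w s τ ∧ τ.int 20 0 = p ∧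
      (p * 2 ^ κ + 1 ≤ settled ν τ ∨ AllSettled ν A s τ)) hX1 ?_ ?_ ?_ ?_ ?_ ?_
  · refine ⟨hσ, h20, .inl ?_⟩
    rw [zero_mul, zero_add, settled, Nat.one_le_iff_ne_zero, Finset.card_ne_zero]
    exact ⟨s, Finset.mem_filter.2 ⟨Finset.mem_range.2 (hσ.lt s hσ.src), hσ.src⟩⟩
  · rintro p hp τ ⟨h1, h2, -⟩
    simp only [eval_le, eval_add, eval_mul, eval_reg, eval_one, h2, h1.setup.len, h1.setup.size]
    have := Nat.mul_lt_mul_of_pos_right hp hK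
    rw [if_pos (by omega)]
    exact one_ne_zero
  · rintro p hp τ ⟨h1, h2, h3⟩
    have hpN : p < 2 ^ ν := hp.trans_le (Nat.pow_le_pow_right (by norm_num) (Nat.sub_le _ _))
    refine (phase_run b hG h1 h2 hpN).mono le_rfl ?_
    rintro τ' ⟨k1, k2, k3, k4⟩
    refine ⟨k1, k2, ?_⟩
    rcases h3 with h3 | h3
    · rcases k4 with k4 | k4
      · left
        rw [Nat.succ_mul]
        omega
      · exact .inr k4
    · exact .inr (k3 h3)
  · rintro τ ⟨h1, h2, -⟩
    simp only [eval_le, eval_add, eval_mul, eval_reg, eval_one, h2, h1.setup.len, h1.setup.size]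
    rw [if_neg (by omega)]
  · rintro τ ⟨h1, -, h3 | h3⟩
    · have : settled ν τ ≤ 2 ^ ν := (Finset.card_filter_le _ _).trans (Finset.card_range _).le
      omega
    · exact ⟨h1, h3⟩
  · have hc : (IExp.le (reg 20 * reg 5 + 1) (reg 4)).cost = 10 := rfl
    rw [hc]
    have hS1 : 1 ≤ (ν + 1) * (ν + 1) := Nat.mul_pos (by omega) (by omega)
    generalize (ν + 1) * (ν + 1) = S at hS1
    have h1 : 1 ≤ (ν + 1) * S := Nat.mul_pos (by omega) hS1
    have h2 : (ν + 1) * (15000 * S) = 15000 * ((ν + 1) * S) := by ring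
    have h3 : (ν + 1) * (16000 * S) = 16000 * ((ν + 1) * S) := by ring
    rw [h2, h3]
    generalize (ν + 1) * S = T at h1
    calc 2 ^ (ν - κ) * (10 + 15000 * T) + 10 ≤ 2 ^ (ν - κ) * (10 + 15000 * T) + 2 ^ (ν - κ) * 10 := by
          have := Nat.le_mul_of_pos_left 10 hP
          omega
      _ = 2 ^ (ν - κ) * (10 + 15000 * T + 10) := by ring
      _ ≤ 2 ^ (ν - κ) * (16000 * T) := Nat.mul_le_mul_left _ (by omega)

/-! ## Building the trees -/

/-- Fill in the leaves, `2 ^ κ` targets at a time. -/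
def build : Prog :=
  .loop (.le (reg 19 * reg 5 + 1) (reg 4))
    (mapI (reg 5) 13 (reg 19 * reg 5 + .idx) ;; update ;; setReg 19 (reg 19 + 1))

/-- Empty trees are consistent, and `update` keeps them so while leaves are filled in. Doing this
for `2 ^ κ` targets at a time keeps the width at that of a phase, and takes only as many rounds as
there are phases. -/
theorem build_run (b : Bounds B X ν κ) {σ : Mem} (hσ : Setup ν κ σ) (h19 : σ.int 19 0 = 0)
    (h14 : ∀ i, σ.int 14 i = 0) :
    Run B X build σ (2 ^ (ν - κ) * ((ν + 1) * (6000 * ((ν + 1) * (ν + 1))))) fun σ' =>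
      Setup ν κ σ' ∧ TreeCons ν κ σ' ∧ TreeLeaf ν κ σ' ∧
      Frame [6, 7, 8, 9, 10, 11, 12, 13, 14, 17, 19] [2, 3] σ σ' := by
  have hX1 := b.width_pos
  have hXB := b.width_le
  have h4B := b.four_lt
  have hKX : 2 ^ κ ≤ X := (Nat.le_mul_of_pos_left _ (by positivity)).trans (width_lists b)
  have hpow : 2 ^ (ν - κ) * 2 ^ κ = 2 ^ ν := by rw [← pow_add, Nat.sub_add_cancel b.le]
  have hK : 0 < 2 ^ κ := by positivity
  have hP : 0 < 2 ^ (ν - κ) := by positivity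
  refine Run.loop (2 ^ (ν - κ)) ((ν + 1) * (5000 * ((ν + 1) * (ν + 1))) + 100)
    (fun p τ => Setup ν κ τ ∧ τ.int 19 0 = p ∧ TreeCons ν κ τ ∧
      Frame [6, 7, 8, 9, 10, 11, 12, 13, 14, 17, 19] [2, 3] σ τ ∧
      ∀ v < 2 ^ ν, ∀ x < 2 ^ ν, ∀ k < 2 ^ κ,
        (x < p * 2 ^ κ → k = 0 → node ν κ τ v (2 ^ ν + x) k = leafEntry ν τ v x) ∧
        (k ≠ 0 → (node ν κ τ v (2 ^ ν + x) k).1 = 0)) hX1 ?_ ?_ ?_ ?_ ?_ ?_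
  · have hn : ∀ v h k, (node ν κ σ v h k).1 = 0 := fun v h k => h14 _
    refine ⟨hσ, h19, fun v _ h _ _ => ⟨?_, ?_, ?_⟩, Frame.refl _, fun v _ x _ k _ => ⟨?_, ?_⟩⟩
    · exact fun k _ h0 => absurd (hn _ _ _) h0
    · exact fun k _ _ _ h0 => absurd (hn _ _ _) h0
    · rintro p ⟨r, -, rfl⟩ h0
      exact absurd (h14 _) h0
    · intro h
      omega
    · exact fun _ => hn _ _ _
  · rintro p hp τ ⟨h1, h2, -⟩
    simp only [eval_le, eval_add, eval_mul, eval_reg, eval_one, h2, h1.len, h1.size]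
    have := Nat.mul_lt_mul_of_pos_right hp hK
    rw [if_pos (by omega)]
    exact one_ne_zero
  · rintro p hp τ ⟨h1, h2, h3, h4, h5⟩
    have hle : p * 2 ^ κ + 2 ^ κ ≤ 2 ^ ν := by
      rw [← hpow, ← Nat.succ_mul]
      exact Nat.mul_le_mul_right _ hp
    have hpN : p < 2 ^ ν := hp.trans_le (Nat.pow_le_pow_right (by norm_num) (Nat.sub_le _ _))
    refine Run.seq 50 ((ν + 1) * (5000 * ((ν + 1) * (ν + 1))) + 50) ?_
    refine Run.mapI (by simpa [h1.len] using hKX) hX1 ?_ (by decide) ?_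
    · intro i hi
      simp only [eval_reg, h1.len] at hi
      simp only [eval_add, eval_mul, eval_reg, eval_idx, h1.len, h2]
      omega
    simp only [eval_add, eval_mul, eval_reg, eval_idx, h1.len, h2]
    set τ₁ := τ.setI 13 _ with hτ₁
    have f1 : Frame [13] [] τ τ₁ := (Frame.refl τ).setI
    have h13 : ∀ j, τ₁.int 13 j = if j < 2 ^ κ then p * 2 ^ κ + j else τ.int 13 j := by
      intro j
      simp [hτ₁]
    have hset : Setup ν κ τ₁ := by
      obtain ⟨a1, a2, a3, a4, a5⟩ := h1
      refine ⟨?_, ?_, ?_, ?_, ?_⟩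
      · rwa [f1.int 4 (by decide)]
      · rwa [f1.int 5 (by decide)]
      · rwa [f1.int 11 (by decide)]
      · rwa [f1.int 14 (by decide)]
      · intro j
        rw [h13]
        have := a5 j
        split_ifs <;> omega
    clear_value τ₁
    refine Run.seq ((ν + 1) * (5000 * ((ν + 1) * (ν + 1)))) 50 ?_
    refine (update_run b hset).mono le_rfl ?_
    rintro ρ ⟨k1, k2, k3, k4⟩
    have f2 : Frame [6, 7, 8, 9, 10, 11, 12, 13, 14, 17] [2, 3] τ ρ := Frame.comp f1.mono k2.mono
    refine Run.setReg hX1 ?_ (by decide) ?_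
    · simp only [eval_add, eval_reg, f2.int 19 (by decide), h2, eval_one]
      omega
    simp only [eval_add, eval_reg, f2.int 19 (by decide), h2, eval_one]
    set ρ' := ρ.setI 19 _ with hρ'
    have hff : Frame [19] [] ρ ρ' := (Frame.refl ρ).setI
    have e19 : ρ'.int 19 0 = p + 1 := by simp [hρ']
    clear_value ρ'
    have e14 := hff.int 14 (by decide)
    have er3 := hff.real 3 (by decide)
    have f3 : Frame [6, 7, 8, 9, 10, 11, 12, 13, 14, 17, 19] [2, 3] τ ρ' :=
      Frame.comp f2.mono hff.mono
    refine ⟨?_, e19, ?_, h4.comp f3, ?_⟩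
    · obtain ⟨a1, a2, a3, a4, a5⟩ := k1
      refine ⟨?_, ?_, ?_, ?_, ?_⟩
      · rwa [hff.int 4 (by decide)]
      · rwa [hff.int 5 (by decide)]
      · rwa [hff.int 11 (by decide)]
      · rwa [hff.int 14 (by decide)]
      · rwa [hff.int 13 (by decide)]
    · exact treeCons_congr e14 er3 (k3 (treeCons_congr (f1.int 14 (by decide))
        (f1.real 3 (by decide)) h3))
    · intro v hv x hx k hk
      have hl1 : leafEntry ν τ₁ v x = leafEntry ν τ v x := by
        simp only [leafEntry, f1.int 3 (by decide), f1.int 15 (by decide), f1.real 4 (by decide)]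
      have hl2 : leafEntry ν ρ' v x = leafEntry ν τ v x := by
        simp only [leafEntry, f3.int 3 (by decide), f3.int 15 (by decide), f3.real 4 (by decide)]
      have hn1 := node_congr (ν := ν) (κ := κ) (f1.int 14 (by decide)) (f1.real 3 (by decide))
      rw [node_congr e14 er3, hl2]
      rcases k4 v hv x hx k hk with ⟨rfl, -, h⟩ | ⟨hn, h⟩
      · exact ⟨fun _ _ => by rw [h, hl1], fun h => absurd rfl h⟩
      · rw [h, hn1]
        refine ⟨?_, (h5 v hv x hx k hk).2⟩
        rintro hxp rfl
        refine (h5 v hv x hx 0 hk).1 ?_ rfl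
        by_contra hge
        push Not at hge
        rw [Nat.succ_mul] at hxp
        refine hn ⟨rfl, x - p * 2 ^ κ, by omega, ?_⟩
        rw [h13, if_pos (by omega)]
        omega
  · rintro τ ⟨h1, h2, -⟩
    simp only [eval_le, eval_add, eval_mul, eval_reg, eval_one, h2, h1.len, h1.size]
    rw [if_neg (by omega)]
  · rintro τ ⟨h1, -, h3, h4, h5⟩
    exact ⟨h1, h3, fun v hv x hx k hk =>
      ⟨(h5 v hv x hx k hk).1 (by rw [hpow]; exact hx), (h5 v hv x hx k hk).2⟩, h4⟩
  · have hc : (IExp.le (reg 19 * reg 5 + 1) (reg 4)).cost = 10 := rfl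
    rw [hc]
    have hS1 : 1 ≤ (ν + 1) * (ν + 1) := Nat.mul_pos (by omega) (by omega)
    generalize (ν + 1) * (ν + 1) = S at hS1
    have h1 : 1 ≤ (ν + 1) * S := Nat.mul_pos (by omega) hS1
    have h2 : (ν + 1) * (5000 * S) = 5000 * ((ν + 1) * S) := by ring
    have h3 : (ν + 1) * (6000 * S) = 6000 * ((ν + 1) * S) := by ring
    rw [h2, h3]
    generalize (ν + 1) * S = T at h1
    calc 2 ^ (ν - κ) * (10 + (5000 * T + 100)) + 10 ≤
        2 ^ (ν - κ) * (10 + (5000 * T + 100)) + 2 ^ (ν - κ) * 10 := by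
          have := Nat.le_mul_of_pos_left 10 hP
          omega
      _ = 2 ^ (ν - κ) * (10 + (5000 * T + 100) + 10) := by ring
      _ ≤ 2 ^ (ν - κ) * (6000 * T) := Nat.mul_le_mul_left _ (by omega)

end PRAM

namespace PRAM

variable {B X : ℕ}

/-! ## Chains and paths -/

theorem exists_path_of_chain {n : ℕ} {G : Digraph (Fin n)} {w : Fin n → Fin n → ℝ}
    {adj : ℕ → ℕ → Prop} {wt : ℕ → ℕ → ℝ}
    (h : ∀ (u : Fin n) v, adj u v → (v = u ∧ wt u v = 0) ∨
      ∃ v' : Fin n, v = v' ∧ G.Adj u v' ∧ wt u v = w u v') (l : List ℕ) :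
    ∀ u : Fin n, Chain adj (fun _ => True) u l → ∃ (v : Fin n) (p : List (Fin n × Fin n)),
      chainEnd u l = v ∧ WDigraph.IsPath G u v p ∧ WDigraph.pathWeight w p = chainWeight wt u l := by
  induction l with
  | nil => exact fun u _ => ⟨u, [], rfl, rfl, rfl⟩
  | cons a l ih =>
    rintro u ⟨h1, -, h2⟩
    rcases h u a h1 with ⟨rfl, h3⟩ | ⟨a, rfl, h3, h4⟩
    · obtain ⟨v, p, k1, k2, k3⟩ := ih u h2
      exact ⟨v, p, k1, k2, by rw [chainWeight, h3, zero_add, k3]⟩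
    · obtain ⟨v, p, k1, k2, k3⟩ := ih a h2
      refine ⟨v, (u, a) :: p, k1, ⟨rfl, h3, k2⟩, ?_⟩
      rw [chainWeight, h4, ← k3]
      simp [WDigraph.pathWeight]

/-- Only an inequality of weights can be expected, as a loop of `G` is replaced by one of weight
zero. -/
theorem exists_chain_of_path {n : ℕ} {G : Digraph (Fin n)} {w : Fin n → Fin n → ℝ}
    {adj : ℕ → ℕ → Prop} {wt : ℕ → ℕ → ℝ}
    (h : ∀ u v : Fin n, G.Adj u v → adj u v ∧ wt u v ≤ w u v) {v : Fin n}
    (p : List (Fin n × Fin n)) : ∀ u : Fin n, WDigraph.IsPath G u v p →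
      ∃ l, Chain adj (fun _ => True) u l ∧ chainEnd u l = v ∧
        chainWeight wt u l ≤ WDigraph.pathWeight w p := by
  induction p with
  | nil =>
    rintro u rfl
    exact ⟨[], trivial, rfl, le_rfl⟩
  | cons e p ih =>
    rintro u ⟨rfl, h1, h2⟩
    obtain ⟨l, k1, k2, k3⟩ := ih _ h2
    obtain ⟨h3, h4⟩ := h _ _ h1
    refine ⟨e.2 :: l, ⟨h3, trivial, k1⟩, k2, ?_⟩
    have := add_le_add h4 k3
    simpa [WDigraph.pathWeight, chainWeight] using this

/-! ## Reading the input -/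

theorem cell_inj {N u v u' v' : ℕ} (hv : v < N) (hv' : v' < N) (h : u * N + v = u' * N + v') :
    u = u' ∧ v = v' := by
  have h1 := congrArg (· / N) h
  have h2 := congrArg (· % N) h
  have hN : 0 < N := by omega
  simp only [Nat.mul_add_mod_of_lt hv, Nat.mul_add_mod_of_lt hv'] at h2
  rw [Nat.mul_comm u, Nat.mul_comm u'] at h1
  simp only [Nat.mul_add_div hN, Nat.div_eq_of_lt hv, Nat.div_eq_of_lt hv', add_zero] at h1
  exact ⟨h1, h2⟩

/-- Double the register `a`, starting from `1`, while `b` holds. -/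
def doubling (a : ℕ) (b : IExp) : Prog := setReg a 1 ;; .loop b (setReg a (reg a * 2))

theorem doubling_run {a m : ℕ} {b : IExp} {σ : Mem} (hX1 : 1 ≤ X) (hB : 2 ^ m < B)
    (hb : ∀ τ, Frame [a] [] σ τ → ∀ j, τ.int a 0 = 2 ^ j → (b.eval τ 0 ≠ 0 ↔ j < m)) :
    Run B X (doubling a b) σ (5 + (m * (b.cost + 8) + b.cost)) fun τ =>
      τ.int a 0 = 2 ^ m ∧ Frame [a] [] σ τ := by
  have h1 : 1 ≤ 2 ^ m := Nat.one_le_two_pow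
  refine Run.seq 5 (m * (b.cost + 8) + b.cost) ?_ le_rfl
  refine Run.setReg hX1 (by simp only [eval_one]; omega) le_rfl ?_
  refine Run.loop m 8 (fun j τ => τ.int a 0 = 2 ^ j ∧ Frame [a] [] σ τ) hX1 ?_ ?_ ?_ ?_ ?_ le_rfl
  · exact ⟨by simp, (Frame.refl σ).setI (by simp)⟩
  · exact fun j hj τ hτ => (hb τ hτ.2 j hτ.1).2 hj
  · rintro j hj τ ⟨h2, h3⟩
    have h4 : 2 ^ (j + 1) ≤ 2 ^ m := Nat.pow_le_pow_right (by norm_num) hj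
    rw [pow_succ] at h4
    refine Run.setReg hX1 ?_ le_rfl ⟨?_, h3.setI (by simp)⟩
    · simp only [eval_mul, eval_reg, eval_two, h2]
      omega
    · simp [h2, pow_succ]
  · rintro τ ⟨h2, h3⟩
    by_contra h
    exact lt_irrefl m ((hb τ h3 m h2).1 h)
  · exact fun τ h => h

/-- The number of the matrix cell of the edge `idx`. -/
def inputCell : IExp := .read 1 .idx * reg 4 + .read 2 .idx

/-- Fill in the matrices. -/
def matrices : Prog :=
  .parI (.read 0 1) 1 15 inputCell 1 ;; .parR (.read 0 1) 1 4 inputCell (.read 0 .idx) ;;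
  .parI (reg 4) 1 15 (.idx * reg 4 + .idx) 1 ;; .parR (reg 4) 1 4 (.idx * reg 4 + .idx) .zero

/-- The memory holds the matrices of the digraph with the edges `L` and the weights `w`, with
loops of weight zero. -/
structure Matrices {n : ℕ} (N : ℕ) (L : List (Fin n × Fin n)) (w : Fin n → Fin n → ℝ)
    (σ : Mem) : Prop where
  adj : ∀ u < N, ∀ v < N, σ.int 15 (u * N + v) ≠ 0 ↔ u = v ∨ ∃ e ∈ L, (e.1 : ℕ) = u ∧ (e.2 : ℕ) = v
  diag : ∀ u < N, σ.real 4 (u * N + u) = 0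
  wt : ∀ e ∈ L, e.1 ≠ e.2 → σ.real 4 (e.1 * N + e.2) = w e.1 e.2

/-- All edges are entered at once, which needs up to `N * N` processors. The diagonal is written
last, so the free loops override any loops of the input and also appear at the padding vertices. -/
theorem matrices_run {n N : ℕ} {L : List (Fin n × Fin n)} {w : Fin n → Fin n → ℝ} {s : Fin n}
    {t : ℕ} {σ : Mem} (hn : n ≤ N) (hL : L.length ≤ N * N) (hB : N * N < B)
    (h4 : σ.int 4 0 = N) (hσ : Frame [4, 5] [] (input L w s t) σ) :
    Run B (N * N) matrices σ 100 fun τ => Matrices N L w τ ∧ Frame [15] [4] σ τ := by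
  have hN : 0 < N := by have := s.isLt; omega
  have hX : N ≤ N * N := Nat.le_mul_of_pos_left _ hN
  have hX1 : 1 ≤ N * N := by omega
  have hcell : ∀ u < N, ∀ v < N, u * N + v < N * N := by
    intro u hu v hv
    calc u * N + v < (u + 1) * N := by rw [Nat.succ_mul]; omega
      _ ≤ N * N := Nat.mul_le_mul_right _ hu
  have h01 : σ.int 0 1 = L.length := by rw [hσ.int 0 (by decide)]; rfl
  have h1 : ∀ i (hi : i < L.length), σ.int 1 i = (L[i].1 : ℕ) := by
    intro i hi
    rw [hσ.int 1 (by decide)]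
    simp [input, hi]
  have h2 : ∀ i (hi : i < L.length), σ.int 2 i = (L[i].2 : ℕ) := by
    intro i hi
    rw [hσ.int 2 (by decide)]
    simp [input, hi]
  have h0 : ∀ i (hi : i < L.length), σ.real 0 i = w L[i].1 L[i].2 := by
    intro i hi
    rw [hσ.real 0 (by decide)]
    simp [input, hi]
  have h15 : ∀ i, σ.int 15 i = 0 := by
    intro i
    rw [hσ.int 15 (by decide)]
    rfl
  have hlt : ∀ u : Fin n, (u : ℕ) < N := fun u => u.isLt.trans_le hn
  have hecell : ∀ i < L.length, σ.int 1 i * N + σ.int 2 i < N * N := by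
    intro i hi
    rw [h1 i hi, h2 i hi]
    exact hcell _ (hlt _) _ (hlt _)
  refine Run.seq 25 75 (Run.parI (by simpa [h01] using hL) hX1 ?_ (by decide) ?_)
  · intro i hi _
    simp only [eval_read, eval_one, h01] at hi
    simp only [inputCell, eval_add, eval_mul, eval_read, eval_reg, eval_idx, h4, eval_one]
    have := hecell i hi
    omega
  simp only [inputCell, eval_add, eval_mul, eval_read, eval_reg, eval_idx, h4, eval_one, h01]
  set τ₁ := σ.setI 15 _ with hτ₁
  have f1 : Frame [15] [4] σ τ₁ := (Frame.refl σ).setI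
  have g1 : ∀ u < N, ∀ v < N, τ₁.int 15 (u * N + v) ≠ 0 ↔ ∃ e ∈ L, (e.1 : ℕ) = u ∧ (e.2 : ℕ) = v := by
    intro u hu v hv
    rw [hτ₁, setI_int, if_pos rfl]
    rcases scatter_cases (N := L.length) (act := fun _ => 1 ≠ 0)
      (addr := fun i => σ.int 1 i * N + σ.int 2 i) (val := fun _ => 1) (old := σ.int 15)
      (u * N + v) with ⟨i, k1, -, k2, k3⟩ | ⟨k1, k2⟩
    · rw [k3]
      rw [h1 i k1, h2 i k1] at k2
      exact ⟨fun _ => ⟨L[i], List.getElem_mem k1, cell_inj (hlt _) hv k2⟩, fun _ => one_ne_zero⟩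
    · rw [k2, h15]
      refine ⟨fun h => absurd rfl h, ?_⟩
      rintro ⟨e, he, rfl, rfl⟩
      obtain ⟨i, hi, rfl⟩ := List.getElem_of_mem he
      exact absurd (by rw [h1 i hi, h2 i hi]) (k1 i hi one_ne_zero)
  clear_value τ₁
  refine Run.seq 25 50 (Run.parR ?_ hX1 ?_ (by decide) ?_)
  · simpa [f1.int 0 (by decide), h01] using hL
  · intro i hi _
    simp only [eval_read, eval_one, f1.int 0 (by decide), h01] at hi
    simp only [eval_add, eval_mul, eval_read, eval_reg, eval_idx, f1.int 1 (by decide),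
      f1.int 2 (by decide), f1.int 4 (by decide), h4]
    exact (hecell i hi).trans hB
  simp only [eval_add, eval_mul, eval_read, eval_reg, eval_idx, eval_one, evalR_read,
    f1.int 0 (by decide), f1.int 1 (by decide), f1.int 2 (by decide), f1.int 4 (by decide),
    f1.real 0 (by decide), h4, h01]
  set τ₂ := τ₁.setR 4 _ with hτ₂
  have f2 : Frame [15] [4] σ τ₂ := f1.setR
  have g2 : τ₂.int 15 = τ₁.int 15 := rfl
  have g3 : ∀ e ∈ L, τ₂.real 4 (e.1 * N + e.2) = w e.1 e.2 := by
    intro e he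
    rw [hτ₂, setR_real, if_pos rfl]
    rcases scatter_cases (N := L.length) (act := fun _ => 1 ≠ 0)
      (addr := fun i => σ.int 1 i * N + σ.int 2 i) (val := σ.real 0) (old := τ₁.real 4)
      (e.1 * N + e.2) with ⟨i, k1, -, k2, k3⟩ | ⟨k1, -⟩
    · rw [k3, h0 i k1]
      rw [h1 i k1, h2 i k1] at k2
      obtain ⟨e1, e2⟩ := cell_inj (hlt _) (hlt _) k2
      rw [Fin.ext e1, Fin.ext e2]
    · obtain ⟨i, hi, rfl⟩ := List.getElem_of_mem he
      exact absurd (by rw [h1 i hi, h2 i hi]) (k1 i hi one_ne_zero)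
  clear_value τ₂
  have e4 : τ₂.int 4 0 = N := by rw [f2.int 4 (by decide), h4]
  refine Run.seq 25 25 (Run.parI (by simpa [e4] using hX) hX1 ?_ (by decide) ?_)
  · intro i hi _
    simp only [eval_reg, e4] at hi
    simp only [eval_add, eval_mul, eval_reg, eval_idx, e4, eval_one]
    have := hcell i hi i hi
    omega
  simp only [eval_add, eval_mul, eval_reg, eval_idx, eval_one, e4]
  set τ₃ := τ₂.setI 15 _ with hτ₃
  have f3 : Frame [15] [4] σ τ₃ := f2.setI
  have g4 : τ₃.real 4 = τ₂.real 4 := rfl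
  have e4' : τ₃.int 4 0 = N := by rw [f3.int 4 (by decide), h4]
  have g5 : ∀ u < N, ∀ v < N, τ₃.int 15 (u * N + v) ≠ 0 ↔
      u = v ∨ ∃ e ∈ L, (e.1 : ℕ) = u ∧ (e.2 : ℕ) = v := by
    intro u hu v hv
    rw [hτ₃, setI_int, if_pos rfl]
    rcases scatter_cases (N := N) (act := fun _ => 1 ≠ 0)
      (addr := fun i => i * N + i) (val := fun _ => 1) (old := τ₂.int 15)
      (u * N + v) with ⟨i, k1, -, k2, k3⟩ | ⟨k1, k2⟩
    · rw [k3]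
      obtain ⟨rfl, rfl⟩ := cell_inj k1 hv k2
      exact ⟨fun _ => .inl rfl, fun _ => one_ne_zero⟩
    · rw [k2, g2, g1 u hu v hv]
      refine ⟨.inr, fun h => h.resolve_left ?_⟩
      rintro rfl
      exact k1 u hu one_ne_zero rfl
  clear_value τ₃
  refine Run.parR (by simpa [e4'] using hX) hX1 ?_ (by decide) ?_
  · intro i hi _
    simp only [eval_reg, e4'] at hi
    simp only [eval_add, eval_mul, eval_reg, eval_idx, e4']
    exact (hcell i hi i hi).trans hB
  simp only [eval_add, eval_mul, eval_reg, eval_idx, eval_one, evalR_zero, e4']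
  refine ⟨⟨g5, ?_, ?_⟩, f3.setR⟩
  · intro u hu
    rw [setR_real, if_pos rfl]
    exact scatter_inj (addr := fun i => i * N + i) hu one_ne_zero
      fun i hi _ he => (cell_inj hi hu he).1
  · intro e he hne
    rw [setR_real, if_pos rfl, scatter_of_not, g4, g3 e he]
    intro i hi _ h
    obtain ⟨e1, e2⟩ := cell_inj hi (hlt _) h
    exact hne (Fin.ext (e1.symm.trans e2))

/-- Read the input and mark the source. -/
def init : Prog :=
  doubling 4 (.le (reg 4 + 1) (.read 0 0)) ;; doubling 5 (.le (reg 5 * 2) (.read 0 3)) ;;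
  matrices ;; .parI 1 1 3 (.read 0 2) 1

/-- The first test is `2 ^ j < n`, that is `j < clog 2 n`; the second is `2 ^ (j + 1) ≤ t`, that is
`j < log 2 t`. So the doublings stop at the least power of two that is at least `n`, and at the
greatest that is at most `t`. -/
theorem init_run {n t : ℕ} {L : List (Fin n × Fin n)} {w : Fin n → Fin n → ℝ} {s : Fin n}
    (ht : 1 ≤ t) (hL : L.length ≤ 2 ^ Nat.clog 2 n * 2 ^ Nat.clog 2 n)
    (hle : Nat.log 2 t ≤ Nat.clog 2 n)
    (hB : 2 ^ Nat.clog 2 n * 2 ^ Nat.clog 2 n < B) :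
    Run B (2 ^ Nat.clog 2 n * 2 ^ Nat.clog 2 n) init (input L w s t) (200 * (Nat.clog 2 n + 1))
      fun τ => τ.int 4 0 = 2 ^ Nat.clog 2 n ∧ τ.int 5 0 = 2 ^ Nat.log 2 t ∧
        Matrices (2 ^ Nat.clog 2 n) L w τ ∧ (∀ j, τ.int 3 j ≠ 0 ↔ j = s) ∧
        Frame [3, 4, 5, 15] [4] (input L w s t) τ := by
  have hn : n ≤ 2 ^ Nat.clog 2 n := Nat.le_pow_clog (by norm_num) n
  have hN : 2 ^ Nat.clog 2 n ≤ 2 ^ Nat.clog 2 n * 2 ^ Nat.clog 2 n := le_sq_pow _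
  have hX1 : 1 ≤ 2 ^ Nat.clog 2 n * 2 ^ Nat.clog 2 n := one_le_sq_pow _
  have hK : 2 ^ Nat.log 2 t ≤ 2 ^ Nat.clog 2 n := Nat.pow_le_pow_right (by norm_num) hle
  have c4 : (IExp.le (reg 4 + 1) (.read 0 0)).cost = 7 := rfl
  have c5 : (IExp.le (reg 5 * 2) (.read 0 3)).cost = 7 := rfl
  refine Run.seq (5 + (Nat.clog 2 n * (7 + 8) + 7)) (150 + Nat.log 2 t * 15) ?_
  have := doubling_run (B := B) (X := 2 ^ Nat.clog 2 n * 2 ^ Nat.clog 2 n)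
    (a := 4) (m := Nat.clog 2 n) (b := .le (reg 4 + 1) (.read 0 0)) (σ := input L w s t)
    hX1 (by omega) ?_
  · rw [c4] at this
    refine this.mono le_rfl ?_
    rintro σ ⟨h4, hσ⟩
    refine Run.seq (5 + (Nat.log 2 t * (7 + 8) + 7)) 130 ?_
    have := doubling_run (B := B) (X := 2 ^ Nat.clog 2 n * 2 ^ Nat.clog 2 n)
      (a := 5) (m := Nat.log 2 t) (b := .le (reg 5 * 2) (.read 0 3)) (σ := σ)
      hX1 (by omega) ?_
    · rw [c5] at this
      refine this.mono le_rfl ?_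
      rintro τ ⟨h5, hτ⟩
      have f1 : Frame [4, 5] [] (input L w s t) τ := Frame.comp hσ.mono hτ.mono
      have e4 : τ.int 4 0 = 2 ^ Nat.clog 2 n := by rw [hτ.int 4 (by decide), h4]
      refine Run.seq 100 30 ((matrices_run hn hL hB e4 f1).mono le_rfl ?_)
      rintro ρ ⟨k1, k2⟩
      have f2 : Frame [3, 4, 5, 15] [4] (input L w s t) ρ := Frame.comp f1.mono k2.mono
      have e02 : ρ.int 0 2 = s := by rw [f2.int 0 (by decide)]; rfl
      have e3 : ∀ j, ρ.int 3 j = 0 := by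
        intro j
        rw [k2.int 3 (by decide), f1.int 3 (by decide)]
        rfl
      have hs := s.isLt
      refine Run.parI (by simpa using hX1) hX1 ?_ (by decide) ?_
      · intro i _ _
        simp only [eval_read, eval_two, eval_one, e02]
        omega
      simp only [eval_read, eval_two, eval_one, e02]
      refine ⟨?_, ?_, ⟨k1.adj, k1.diag, k1.wt⟩, ?_, f2.setI⟩
      · rw [setI_int, if_neg (by decide), k2.int 4 (by decide), e4]
      · rw [setI_int, if_neg (by decide), k2.int 5 (by decide), h5]
      · intro j
        rw [setI_int, if_pos rfl]
        rcases scatter_cases (N := 1) (act := fun _ => 1 ≠ 0)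
          (addr := fun _ => (s : ℕ)) (val := fun _ => 1) (old := ρ.int 3) j with
          ⟨i, -, -, k3, k4⟩ | ⟨k3, k4⟩
        · rw [k4]
          exact ⟨fun _ => k3.symm, fun _ => one_ne_zero⟩
        · rw [k4, e3]
          exact ⟨fun h => absurd rfl h, fun h => absurd h.symm (k3 0 one_pos one_ne_zero)⟩
    · intro τ hτ j hj
      have e0 : τ.int 0 3 = t := by
        rw [hτ.int 0 (by decide), hσ.int 0 (by decide)]
        rfl
      have e3 : (OfNat.ofNat 3 : IExp).eval τ 0 = 3 := rfl
      simp only [eval_le, eval_mul, eval_reg, eval_two, eval_read, hj, e3, e0, ← pow_succ]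
      rw [← Nat.succ_le_iff, Nat.le_log_iff_pow_le (by norm_num) (by omega)]
      split_ifs with h
      · exact ⟨fun _ => h, fun _ => one_ne_zero⟩
      · exact ⟨fun h => absurd rfl h, fun h' => absurd h' h⟩
  · intro τ hτ j hj
    have e0 : τ.int 0 0 = n := by
      rw [hτ.int 0 (by decide)]
      rfl
    simp only [eval_le, eval_add, eval_reg, eval_one, eval_read, eval_zero, hj, e0]
    rw [Nat.lt_clog_iff_pow_lt (by norm_num)]
    split_ifs with h
    · exact ⟨fun _ => h, fun _ => one_ne_zero⟩
    · exact ⟨fun h => absurd rfl h, fun h' => absurd h' h⟩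

end PRAM

namespace PRAM

/-! ## The whole program -/

/-- The whole program: single-source distances. -/
def distances : Prog := init ;; build ;; phases

/-- The depth of the whole program. -/
def distDepth (ν κ : ℕ) : ℕ :=
  2 ^ (ν - κ) * ((ν + 1) * (6000 * ((ν + 1) * (ν + 1)))) +
    2 ^ (ν - κ) * ((ν + 1) * (16000 * ((ν + 1) * (ν + 1))))

theorem Matrices.reflGraph {n ν : ℕ} {G : Digraph (Fin n)} {L : List (Fin n × Fin n)}
    {w : Fin n → Fin n → ℝ} {σ : Mem} (h : Matrices (2 ^ ν) L w σ)
    (hL : ∀ u v, (u, v) ∈ L ↔ G.Adj u v) (hw : ∀ u v, G.Adj u v → 0 ≤ w u v) :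
    ReflGraph (MAdj ν (σ.int 15)) (mWt ν (σ.real 4)) (2 ^ ν) := by
  refine ⟨fun u v h1 => h1.2.1, fun u v h1 => ⟨h1.2.1, h1.2.1, ?_⟩, fun v h1 => h.diag v h1.1, ?_⟩
  · exact (h.adj v h1.2.1 v h1.2.1).2 (.inl rfl)
  · rintro u v ⟨h1, h2, h3⟩
    rcases (h.adj u h1 v h2).1 h3 with rfl | ⟨e, he, rfl, rfl⟩
    · exact (h.diag u h1).ge
    · by_cases hne : e.1 = e.2
      · rw [mWt, hne]
        exact (h.diag _ h2).ge
      · rw [mWt, h.wt e he hne]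
        exact hw _ _ ((hL _ _).1 he)

/-- Settled vertices have their distances as labels, and the others cannot be reached. -/
theorem output_eq_dist {n ν : ℕ} {G : Digraph (Fin n)} {L : List (Fin n × Fin n)}
    {w : Fin n → Fin n → ℝ} {σ τ : Mem} {s : Fin n} (hn : n ≤ 2 ^ ν)
    (h : Matrices (2 ^ ν) L w σ)
    (hL : ∀ u v, (u, v) ∈ L ↔ G.Adj u v) (hw : ∀ u v, G.Adj u v → 0 ≤ w u v)
    (hex : ∀ u, τ.int 3 u ≠ 0 → IsDist (MAdj ν (σ.int 15)) (mWt ν (σ.real 4)) s u (τ.real 1 u))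
    (hall : AllSettled ν (σ.int 15) s τ) (v : Fin n) :
    output τ v = WDigraph.dist G w s v := by
  have hlt : ∀ u : Fin n, (u : ℕ) < 2 ^ ν := fun u => u.isLt.trans_le hn
  have hpath : ∀ (u : Fin n) x, MAdj ν (σ.int 15) u x → (x = u ∧ mWt ν (σ.real 4) u x = 0) ∨
      ∃ x' : Fin n, x = x' ∧ G.Adj u x' ∧ mWt ν (σ.real 4) u x = w u x' := by
    rintro u x ⟨h1, h2, h3⟩
    by_cases hne : (u : ℕ) = x
    · subst hne
      exact .inl ⟨rfl, h.diag _ h1⟩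
    · obtain ⟨⟨a, b⟩, he, h4, rfl⟩ := ((h.adj _ h1 x h2).1 h3).resolve_left hne
      obtain rfl : a = u := Fin.ext h4
      exact .inr ⟨b, rfl, (hL _ _).1 he, h.wt _ he fun hab => hne (congrArg _ hab)⟩
  have hchain : ∀ u x : Fin n, G.Adj u x →
      MAdj ν (σ.int 15) u x ∧ mWt ν (σ.real 4) u x ≤ w u x := by
    intro u x h1
    have h2 := (hL u x).2 h1
    refine ⟨⟨hlt _, hlt _, (h.adj _ (hlt _) _ (hlt _)).2 (.inr ⟨_, h2, rfl, rfl⟩)⟩, ?_⟩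
    by_cases hne : u = x
    · subst hne
      exact (h.diag _ (hlt _)).le.trans (hw _ _ h1)
    · exact (h.wt _ h2 hne).le
  rw [output, WDigraph.dist]
  split_ifs with h0
  · symm
    rw [iInf_eq_top]
    rintro ⟨p, hp⟩
    obtain ⟨l, h1, h2, -⟩ := exists_chain_of_path hchain p s hp
    exact absurd h0 (h2 ▸ hall l h1)
  · obtain ⟨⟨l, h1, h2, h3⟩, h4⟩ := hex v h0
    apply le_antisymm
    · refine le_iInf ?_
      rintro ⟨p, hp⟩
      obtain ⟨l', k1, k2, k3⟩ := exists_chain_of_path hchain p s hp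
      exact EReal.coe_le_coe_iff.2 ((h4 l' k1 k2).trans k3)
    · obtain ⟨v', p, k1, k2, k3⟩ := exists_path_of_chain hpath l s h1
      obtain rfl : v' = v := Fin.ext (k1.symm.trans h2)
      exact iInf_le_of_le ⟨p, k2⟩ (by rw [k3, h3])

theorem build_phases_run {B X n t ν κ : ℕ} (b : Bounds B X ν κ) {G : Digraph (Fin n)}
    {L : List (Fin n × Fin n)} {w : Fin n → Fin n → ℝ} {s : Fin n} {σ : Mem}
    (hn : n ≤ 2 ^ ν) (hL : ∀ u v, (u, v) ∈ L ↔ G.Adj u v) (hw : ∀ u v, G.Adj u v → 0 ≤ w u v)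
    (h4 : σ.int 4 0 = 2 ^ ν) (h5 : σ.int 5 0 = 2 ^ κ) (hm : Matrices (2 ^ ν) L w σ)
    (h3 : ∀ j, σ.int 3 j ≠ 0 ↔ j = s) (hf : Frame [3, 4, 5, 15] [4] (input L w s t) σ) :
    Run B X (build ;; phases) σ (distDepth ν κ) fun τ =>
      ∀ v : Fin n, output τ v = WDigraph.dist G w s v := by
  have h0 : ∀ a, a ∉ [0, 1, 2, 3, 4, 5, 15] → ∀ j, σ.int a j = 0 := by
    intro a ha j
    simp only [List.mem_cons, List.not_mem_nil, or_false, not_or] at ha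
    rw [hf.int a (by simp; tauto)]
    obtain ⟨a, rfl⟩ := Nat.exists_eq_add_of_le' (show 3 ≤ a by omega)
    rfl
  have hG := hm.reflGraph hL hw
  have hset : Setup ν κ σ := by
    refine ⟨h4, h5, fun i => ?_, fun i => ?_, fun i => ?_⟩ <;> rw [h0 _ (by decide)] <;> positivity
  refine Run.seq _ _ ((build_run b hset (h0 _ (by decide) _) (h0 _ (by decide))).mono le_rfl ?_) le_rfl
  rintro ρ ⟨k1, k2, k3, k4⟩
  have e3 := k4.int 3 (by decide)
  have hinv : MainInv ν κ (σ.int 15) (σ.real 4) s ρ := by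
    refine ⟨k1, fun i => ?_, k4.int 15 (by decide), k4.real 4 (by decide), k2, k3, ?_, ?_, ?_⟩
    · rw [k4.int 16 (by decide), h0 _ (by decide)]
      positivity
    · rw [e3]
      exact (h3 _).2 rfl
    · intro u hu
      rw [e3] at hu
      rw [(h3 u).1 hu]
      exact s.isLt.trans_le hn
    -- Only the source is marked. Its label is the initial `0` of the real array `1`, which is exact
    -- because weights are non-negative.
    · intro u hu
      rw [e3] at hu
      rw [(h3 u).1 hu, k4.real 1 (by decide), hf.real 1 (by decide)]
      exact ⟨⟨[], trivial, rfl, rfl⟩, fun l hl _ => chainWeight_nonneg hG hl⟩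
  refine (phases_run b hG hinv ?_).mono le_rfl ?_
  · rw [k4.int 20 (by decide), h0 _ (by decide)]
  · rintro τ ⟨q1, q2⟩ v
    exact output_eq_dist hn hm hL hw q1.exact q2 v

theorem list_length_le {n : ℕ} {L : List (Fin n × Fin n)} (hL : L.Nodup) : L.length ≤ n * n := by
  have := hL.length_le_card
  rwa [Fintype.card_prod, Fintype.card_fin] at this

/-! ## Estimates -/

/-- If `clog 2 n = m + 1`, then `2 ^ m < n`, and `log 2 ≥ 1 / 2` gives `m ≤ 2 * log n`. -/
theorem clog_add_one_le (n : ℕ) : ((Nat.clog 2 n : ℕ) : ℝ) + 1 ≤ 2 * (1 + Real.log n) := by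
  have h0 : 0 ≤ Real.log n := Real.log_natCast_nonneg n
  rcases Nat.eq_zero_or_pos (Nat.clog 2 n) with h | h
  · rw [h, Nat.cast_zero]
    linarith
  · obtain ⟨m, hm⟩ := Nat.exists_eq_add_of_le' h
    have h1 : 2 ^ m < n := (Nat.lt_clog_iff_pow_lt (by norm_num)).1 (by omega)
    have h2 : (2 : ℝ) ^ m ≤ n := by exact_mod_cast h1.le
    have h3 := Real.log_le_log (by positivity) h2
    rw [Real.log_pow] at h3
    have h4 : (m : ℝ) * (1 / 2) ≤ m * Real.log 2 :=
      mul_le_mul_of_nonneg_left (by linarith [Real.log_two_gt_d9]) (Nat.cast_nonneg m)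
    rw [hm]
    push_cast
    linarith

theorem pow_clog_le {n : ℕ} (hn : 1 ≤ n) : 2 ^ Nat.clog 2 n ≤ 2 * n := by
  rcases Nat.eq_zero_or_pos (Nat.clog 2 n) with h | h
  · rw [h]
    omega
  · obtain ⟨m, hm⟩ := Nat.exists_eq_add_of_le' h
    have h1 : 2 ^ m < n := (Nat.lt_clog_iff_pow_lt (by norm_num)).1 (by omega)
    rw [hm, pow_succ]
    omega

end PRAM

/-- Single-source distances in non-negatively weighted digraphs: the program grows the settled set
by at least `2 ^ κ ≈ t` vertices in each of `2 ^ (ν - κ) ≈ n / t` phases, each of polylogarithmic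
depth. -/
theorem mainTheorem3 :
    ∃ (P : PRAM.Prog) (c k : ℕ) (C : ℝ),
      ∀ (n t : ℕ), 1 ≤ t → t ≤ n →
      ∀ (G : Digraph (Fin n)) (w : Fin n → Fin n → ℝ), (∀ u v, G.Adj u v → 0 ≤ w u v) →
      ∀ (L : List (Fin n × Fin n)), L.Nodup → (∀ u v, (u, v) ∈ L ↔ G.Adj u v) →
      ∀ s : Fin n,
        ∃ (σ : PRAM.Mem) (W D : ℕ),
          PRAM.Exec ((n + 1) ^ c) P (PRAM.input L w s t) σ W D ∧
          (W : ℝ) ≤ C * ((n : ℝ) ^ 2 * t) * (1 + Real.log n) ^ k ∧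
          (D : ℝ) ≤ C * ((n : ℝ) / t) * (1 + Real.log n) ^ k ∧
          ∀ v : Fin n, PRAM.output σ v = WDigraph.dist G w s v := by
  -- The exponent `9` makes room for the word bound, at most `2 ^ 5 * n ^ 4`. Of the three
  -- logarithms, two come from sorting and one from the levels or squarings. The constant exceeds
  -- `44200 * 4 * 8` for work and `22200 * 4 * 8` for depth.
  refine ⟨PRAM.distances, 9, 3, 2000000, fun n t ht htn G w hw L hnd hL s => ?_⟩
  have hn1 : 1 ≤ n := ht.trans htn
  set ν := Nat.clog 2 n with hν
  set κ := Nat.log 2 t with hκ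
  have hnN : n ≤ 2 ^ ν := Nat.le_pow_clog (by norm_num) n
  have hNn : 2 ^ ν ≤ 2 * n := PRAM.pow_clog_le hn1
  have hKt : 2 ^ κ ≤ t := Nat.pow_log_le_self 2 (by omega)
  have htK : t ≤ 2 * 2 ^ κ := by
    have := Nat.lt_pow_succ_log_self (by norm_num : 1 < 2) t
    rw [Nat.succ_eq_add_one, pow_succ, ← hκ] at this
    omega
  have hle : κ ≤ ν := (Nat.pow_le_pow_iff_right (by norm_num : 1 < 2)).1 (hKt.trans (htn.trans hnN))
  have hP : 2 ^ (ν - κ) * 2 ^ κ = 2 ^ ν := by rw [← pow_add, Nat.sub_add_cancel hle]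
  have hS := PRAM.clog_add_one_le n
  rw [← hν] at hS
  have hword : 8 * (2 ^ ν * 2 ^ ν * (2 ^ κ * 2 ^ κ)) ≤ (n + 1) ^ 9 := by
    calc 8 * (2 ^ ν * 2 ^ ν * (2 ^ κ * 2 ^ κ)) ≤ 8 * ((2 * n) * (2 * n) * (n * n)) := by
          gcongr <;> exact hKt.trans htn
      _ = 2 ^ 5 * n ^ 4 := by ring
      _ ≤ (n + 1) ^ 5 * (n + 1) ^ 4 := by gcongr <;> omega
      _ = (n + 1) ^ 9 := by ring
  have b : PRAM.Bounds ((n + 1) ^ 9) (2 * (2 ^ ν * (2 ^ κ * 2 ^ κ))) ν κ := by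
    refine ⟨hle, le_rfl, le_trans ?_ hword, hword⟩
    calc 2 * (2 ^ ν * (2 ^ κ * 2 ^ κ)) ≤ 8 * (2 ^ ν * 2 ^ ν * (2 ^ κ * 2 ^ κ)) := by
          gcongr
          · norm_num
          · exact PRAM.le_sq_pow ν
      _ = _ := rfl
  have hB : 2 ^ ν * 2 ^ ν < (n + 1) ^ 9 := by
    have := b.lt_word le_rfl (PRAM.one_le_sq_pow κ)
    omega
  have hlen : L.length ≤ 2 ^ ν * 2 ^ ν :=
    (PRAM.list_length_le hnd).trans (Nat.mul_le_mul hnN hnN)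
  -- The initialization runs at width `N * N` with logarithmic depth, the rest at width `2 * N * K ^
  -- 2`; the two amounts of work are added.
  obtain ⟨σ, W₁, D₁, x1, x2, x3, x4, x5, x6, x7, x8⟩ :=
    PRAM.init_run (w := w) (s := s) ht hlen hle hB
  obtain ⟨τ, W₂, D₂, y1, y2, y3, y4⟩ :=
    PRAM.build_phases_run b hnN hL hw x4 x5 x6 x7 x8
  refine ⟨τ, _, _, .seq x1 y1, ?_, ?_, y4⟩
  all_goals
    rw [← hν] at x2 x3
    have hd : PRAM.distDepth ν κ = 22000 * (2 ^ (ν - κ) * (ν + 1) ^ 3) := by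
      rw [PRAM.distDepth]
      ring
    rw [hd] at y3
    clear_value ν κ
  · have key : W₁ + W₂ ≤ 44200 * ((2 ^ ν) ^ 2 * 2 ^ κ * (ν + 1) ^ 3) := by
      calc W₁ + W₂ ≤ 2 ^ ν * 2 ^ ν * (200 * (ν + 1)) +
            2 * (2 ^ ν * (2 ^ κ * 2 ^ κ)) * (22000 * (2 ^ (ν - κ) * (ν + 1) ^ 3)) :=
            add_le_add (x2.trans (Nat.mul_le_mul_left _ x3)) (y2.trans (Nat.mul_le_mul_left _ y3))
        _ = 200 * ((2 ^ ν) ^ 2 * 1 * (ν + 1) ^ 1) +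
            44000 * (2 ^ ν * (2 ^ (ν - κ) * 2 ^ κ) * 2 ^ κ * (ν + 1) ^ 3) := by ring
        _ ≤ 200 * ((2 ^ ν) ^ 2 * 2 ^ κ * (ν + 1) ^ 3) +
            44000 * (2 ^ ν * (2 ^ (ν - κ) * 2 ^ κ) * 2 ^ κ * (ν + 1) ^ 3) := by
            gcongr
            · exact Nat.one_le_two_pow
            · omega
            · norm_num
        _ = 44200 * ((2 ^ ν) ^ 2 * 2 ^ κ * (ν + 1) ^ 3) := by
            rw [hP]
            ring
    have h1 : ((2 : ℝ) ^ ν) ≤ 2 * n := by exact_mod_cast hNn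
    have h2 : ((2 : ℝ) ^ κ) ≤ t := by exact_mod_cast hKt
    calc ((W₁ + W₂ : ℕ) : ℝ) ≤ ((44200 * ((2 ^ ν) ^ 2 * 2 ^ κ * (ν + 1) ^ 3) : ℕ) : ℝ) :=
          Nat.cast_le.2 key
      _ = 44200 * (((2 : ℝ) ^ ν) ^ 2 * 2 ^ κ * (ν + 1) ^ 3) := by push_cast; rfl
      _ ≤ 44200 * ((2 * (n : ℝ)) ^ 2 * t * (2 * (1 + Real.log n)) ^ 3) := by gcongr
      _ = 1414400 * ((n : ℝ) ^ 2 * t * (1 + Real.log n) ^ 3) := by ring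
      _ ≤ 2000000 * ((n : ℝ) ^ 2 * t * (1 + Real.log n) ^ 3) := by
          have := Real.log_natCast_nonneg n
          gcongr
          norm_num
      _ = _ := by ring
  · have key : D₁ + D₂ ≤ 22200 * (2 ^ (ν - κ) * (ν + 1) ^ 3) := by
      calc D₁ + D₂ ≤ 200 * (1 * (ν + 1) ^ 1) + 22000 * (2 ^ (ν - κ) * (ν + 1) ^ 3) := by
            rw [one_mul, pow_one]
            exact add_le_add x3 y3
        _ ≤ 200 * (2 ^ (ν - κ) * (ν + 1) ^ 3) + 22000 * (2 ^ (ν - κ) * (ν + 1) ^ 3) := by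
            gcongr
            · exact Nat.one_le_two_pow
            · omega
            · norm_num
        _ = _ := by ring
    have ht0 : (0 : ℝ) < t := by exact_mod_cast ht
    -- One factor `2` is lost in rounding `n` up, another in rounding `t` down.
    have h1 : (2 : ℝ) ^ (ν - κ) ≤ 4 * (n / t) := by
      rw [← mul_div_assoc, le_div_iff₀ ht0]
      have : 2 ^ (ν - κ) * t ≤ 4 * n := by
        calc 2 ^ (ν - κ) * t ≤ 2 ^ (ν - κ) * (2 * 2 ^ κ) := Nat.mul_le_mul_left _ htK
          _ = 2 * (2 ^ (ν - κ) * 2 ^ κ) := by ring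
          _ ≤ 4 * n := by
            rw [hP]
            omega
      exact_mod_cast this
    calc ((D₁ + D₂ : ℕ) : ℝ) ≤ ((22200 * (2 ^ (ν - κ) * (ν + 1) ^ 3) : ℕ) : ℝ) :=
          Nat.cast_le.2 key
      _ = 22200 * ((2 : ℝ) ^ (ν - κ) * (ν + 1) ^ 3) := by push_cast; rfl
      _ ≤ 22200 * (4 * ((n : ℝ) / t) * (2 * (1 + Real.log n)) ^ 3) := by gcongr
      _ = 710400 * ((n : ℝ) / t * (1 + Real.log n) ^ 3) := by ring
      _ ≤ 2000000 * ((n : ℝ) / t * (1 + Real.log n) ^ 3) := by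
          have := Real.log_natCast_nonneg n
          gcongr
          norm_num
      _ = _ := by ring
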